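/- **Network revolt game.** Let $G$ be a graph with $n$ vertices (agents). A prior $P=(p,\mu,D_T^A,D_T^B,D_S)$ with rational data consists of thresholds $0<p<1$, $0<\mu<1$, a distribution $D_S$ on the states $\{A,B\}$, and for each state $s$ a distribution $D_T^s$ on the types $\{\alpha,\chi,\nu\}$, with $D_T^A(\nu)<D_T^B(\nu)$. Nature draws a state $s$ from $D_S$ and then the types of the agents independently from $D_T^s$. The context of an agent is her own type together with the multiset of the types of her neighbors; a strategy maps contexts to {Revolt, Yield}. An agent of type $\alpha$ gets payoff $1$ for Revolt and $0$ for Yield, one of type $\nu$ the reverse. An agent of type $\chi$ gets $1-p$ if she revolts and at least $\mu n$ agents revolt, $p$ if she yields and fewer than $\mu n$ agents revolt, and $0$ otherwise. A strategy profile is an equilibrium if each strategy maximizes its agent's ex ante expected payoff given the others. "A revolt of size $m$ is supported with probability $q$" means that $q$ is the largest value, over all equilibria, of the ex ante probability that at least $mn$ agents revolt. **PROMISE REVOLT**$(G,P,\mu^*,\epsilon,\delta)$, with rational $\mu^*\in[0,1]$ and $\epsilon,\delta>0$. Let $P^{\pm}$ be $P$ with $(p,\mu)$ replaced by $(p\pm\delta,\mu\pm\epsilon)$.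 When exactly one of the following cases is true, output its symbol. * $\Omega$: a revolt of size $\mu^*-\epsilon$ is supported with probability $q\ge 1-\delta$ under $P^-$. * $\mathbf A$: a revolt of size $\mu^*$ is supported with probability $q\in[\Pr[A]-\delta,\Pr[A]+\delta]$ under $P$. * $\emptyset$: a revolt of size $\mu^*+\epsilon$ is supported with probability $q\le\delta$ under $P^+$. **Algorithms.** Let $e_s(\cdot)$ be the expected fraction of agents of the given kind in state $s$. Let $C_C$ be the candidate agents, that is, the agents of type $\chi$ whose context $c$ satisfies $\Pr[A\mid c]\ge p$. * *Algorithm 1*$(G,P)$ returns $(X_A,X_B)$. It sets $X_s=e_s(\alpha)$ for both $s$ if $e_s(\chi\cup\alpha)<\mu$ in both states, and $X_s=e_s(\chi\cup\alpha)$ if $e_s(\chi\cup\alpha)\ge\mu$ in both states. If $e_s(\chi\cup\alpha)\ge\mu$ only in state $A$, it sets $X_s=e_s(C_C\cup\alpha)$ if $e_A(C_C\cup\alpha)\ge\mu$, and $X_s=e_s(\alpha)$ otherwise. * *Algorithm 2*$(X_A,X_B,\mu^*)$ returns $\Omega$ if $X_A,X_B\ge\mu^*$; $\mathbf A$ if $X_A\ge\mu^*>X_B$;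 and $\emptyset$ if $X_A,X_B<\mu^*$. * *Algorithm 3*$(G,P,\mu^*,\epsilon,\delta)$ runs Algorithms 1 and 2 with thresholds $(p+\frac\delta3,\mu+\frac\epsilon3)$ and again with $(p-\frac\delta3,\mu-\frac\epsilon3)$. It returns the common answer, or NULL if the two differ. The states are *correctly labeled* for $(G,P,\epsilon,\delta)$ if Algorithm 1, run with any thresholds $(p',\mu')$ with $|p'-p|\le\delta$ and $|\mu'-\mu|\le\epsilon$, returns $X_A\ge X_B$. The *degree sequence* of $G$ is the anonymous list of its vertex degrees (in any order). *Polynomial time* means polynomial in the bit length of the input, which consists of $n$, the degree sequence, $P$, $\mu^*$, $\epsilon$ and $\delta$, on a logarithmic-cost random access machine with rational arithmetic. The time bound holds for the degree sequences of all graphs. **Proposition.** 1. Algorithm 1 uses only the degree sequence: it returns the same pair for any two graphs with the same degree sequence. 2. The output of Algorithm 3 can be computed from the degree sequence, $P$, $\mu^*$, $\epsilon$, $\delta$ alone, in polynomial time. 3. PROMISE REVOLT can be solved in polynomial time from the degree sequence alone, with an answer that is valid for every graph consistent with it. Precisely, there is a polynomial-time computable function $f(d,P,\mu^*,\epsilon,\delta)$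 of a degree sequence $d$ and the parameters such that for every $\epsilon>0$, every prior $P$ and every constant $C$ there is $\delta_0(n)\in 1/\exp(\Omega_{\epsilon,P,C}(\sqrt[3]{n}))$, $\delta_0(n)>0$, with the following property. For all $\mu^*\in[0,1]$, all $n$, all $\delta\ge\delta_0(n)$, all degree sequences $d$, and every graph $G$ with $n$ vertices, degree sequence $d$ and maximum degree at most $C\sqrt[3]{n}$ for which the states are correctly labeled, $f(d,P,\mu^*,\epsilon,\delta)$ is a correct answer to PROMISE REVOLT$(G,P,\mu^*,\epsilon,\delta)$. -/

import Mathlib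

open Finset Filter

/-! ## The network revolt game (two states, three types) -/

/-- The states of the world: the anti-government state `A`, the pro-government state `B`. -/
inductive WorldState
  | A
  | B
  deriving DecidableEq

instance : Fintype WorldState where
  elems := {.A, .B}
  complete := by intro s; cases s <;> simp

/-- Agent types: `α` (always revolt), `χ` (revolt conditionally), `ν` (never revolt). -/
inductive AgentType
  | α
  | χ
  | ν
  deriving DecidableEq

instance : Fintype AgentType where
  elems := {.α, .χ, .ν}
  complete := by intro t; cases t <;> simp

/-- The two actions: revolt and yield. -/
inductive Move
  | R
  | Y
  deriving DecidableEq

/-- The common prior `(p, μ, D_T^A, D_T^B, D_S)`, with rational data; `D_S` is given by the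
probability `probA` of the state `A`. -/
structure Prior where
  p : ℚ
  μ : ℚ
  typeDist : WorldState → AgentType → ℚ
  probA : ℚ

namespace Prior

/-- The probability of a state under `D_S`. -/
def stateProb (P : Prior) : WorldState → ℚ
  | .A => P.probA
  | .B => 1 - P.probA

/-- The same distributions with other thresholds. -/
def withThresholds (P : Prior) (p μ : ℚ) : Prior := { P with p := p, μ := μ }

/-- The thresholds lie strictly between `0` and `1`, the three distributions are probability
distributions, and type `ν` is less likely in state `A` than in state `B`. -/
structure Valid (P : Prior) : Prop where
  p_pos : 0 < P.p
  p_lt_one : P.p < 1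
  μ_pos : 0 < P.μ
  μ_lt_one : P.μ < 1
  typeDist_nonneg : ∀ s t, 0 ≤ P.typeDist s t
  typeDist_sum : ∀ s, ∑ t, P.typeDist s t = 1
  probA_nonneg : 0 ≤ P.probA
  probA_le_one : P.probA ≤ 1
  ν_lt : P.typeDist .A .ν < P.typeDist .B .ν

end Prior

/-- A context: the type of an agent together with the (anonymous) multiset of the types of her
neighbors. -/
abbrev Context := AgentType × Multiset AgentType

/-- A strategy chooses an action for each context. -/
abbrev Strategy := Context → Move

section Game

variable {n : ℕ}

/-- The context of agent `v` when the types are `t`. -/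
def contextOf (G : SimpleGraph (Fin n)) [DecidableRel G.Adj] (t : Fin n → AgentType)
    (v : Fin n) : Context :=
  (t v, (G.neighborFinset v).val.map t)

/-- The probability of the type assignment `t` in state `s`: independent draws from `D_T^s`. -/
def typesProb (P : Prior) (s : WorldState) (t : Fin n → AgentType) : ℚ :=
  ∏ v, P.typeDist s (t v)

/-- The ex ante probability of the state and type assignment `w`. -/
def worldProb (P : Prior) (w : WorldState × (Fin n → AgentType)) : ℚ :=
  P.stateProb w.1 * typesProb P w.1 w.2

/-- The set of agents who revolt under the strategy profile `σ` when the types are `t`. -/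
def revolters (G : SimpleGraph (Fin n)) [DecidableRel G.Adj] (σ : Fin n → Strategy)
    (t : Fin n → AgentType) : Finset (Fin n) :=
  {v | σ v (contextOf G t v) = .R}

/-- Payoff of an agent with the given type and action when `r` of the `n` agents (she included,
if she revolts) revolt. -/
def payoff (P : Prior) (n r : ℕ) : AgentType → Move → ℚ
  | .α, .R => 1
  | .α, .Y => 0
  | .ν, .R => 0
  | .ν, .Y => 1
  | .χ, .R => if P.μ * n ≤ r then 1 - P.p else 0
  | .χ, .Y => if (r : ℚ) < P.μ * n then P.p else 0

/-- Ex ante expected payoff of agent `i` under the strategy profile `σ`. -/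
def expectedPayoff (G : SimpleGraph (Fin n)) [DecidableRel G.Adj] (P : Prior)
    (σ : Fin n → Strategy) (i : Fin n) : ℚ :=
  ∑ w : WorldState × (Fin n → AgentType),
    worldProb P w * payoff P n (revolters G σ w.2).card (w.2 i) (σ i (contextOf G w.2 i))

/-- Every agent's strategy is a best response to the strategies of the others. -/
def IsEquilibrium (G : SimpleGraph (Fin n)) [DecidableRel G.Adj] (P : Prior)
    (σ : Fin n → Strategy) : Prop :=
  ∀ (i : Fin n) (τ : Strategy),
    expectedPayoff G P (Function.update σ i τ) i ≤ expectedPayoff G P σ i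

/-- Ex ante probability that at least an `m` fraction of the agents revolts under `σ`. -/
def revoltProb (G : SimpleGraph (Fin n)) [DecidableRel G.Adj] (P : Prior)
    (σ : Fin n → Strategy) (m : ℚ) : ℚ :=
  ∑ w : WorldState × (Fin n → AgentType) with m * n ≤ ((revolters G σ w.2).card : ℚ),
    worldProb P w

/-- A revolt of size `m` is supported with probability `q`: this is the largest probability, over
all equilibria, that at least an `m` fraction of the agents revolts. -/
def SupportedWithProb (G : SimpleGraph (Fin n)) [DecidableRel G.Adj] (P : Prior)
    (m q : ℚ) : Prop :=
  IsGreatest {x | ∃ σ, IsEquilibrium G P σ ∧ x = revoltProb G P σ m} q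

end Game

/-! ## The problem PROMISE REVOLT -/

/-- The three answers `Ω`, `A` and `∅`. -/
inductive Outcome
  | Omega
  | stateA
  | empty
  deriving DecidableEq

/-- The case of the problem that belongs to an answer is true for the given instance. -/
def CaseTrue {n : ℕ} (G : SimpleGraph (Fin n)) [DecidableRel G.Adj] (P : Prior) (μs ε δ : ℚ) :
    Outcome → Prop
  | .Omega => ∃ q, SupportedWithProb G (P.withThresholds (P.p - δ) (P.μ - ε)) (μs - ε) q ∧
      1 - δ ≤ q
  | .stateA => ∃ q, SupportedWithProb G P μs q ∧ P.probA - δ ≤ q ∧ q ≤ P.probA + δ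
  | .empty => ∃ q, SupportedWithProb G (P.withThresholds (P.p + δ) (P.μ + ε)) (μs + ε) q ∧ q ≤ δ

/-- The answer `o` solves the instance: whenever exactly one of the three cases is true, `o` is the
symbol of that case. (`none` stands for the answer NULL.) -/
def SolvesInstance {n : ℕ} (G : SimpleGraph (Fin n)) [DecidableRel G.Adj] (P : Prior)
    (μs ε δ : ℚ) (o : Option Outcome) : Prop :=
  ∀ s, CaseTrue G P μs ε δ s → (∀ r, CaseTrue G P μs ε δ r → r = s) → o = some s

/-! ## The three algorithms, run on a graph -/

section Algorithms

variable {n : ℕ}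

/-- The expected fraction, in state `s`, of agents `v` whose context `c` satisfies `S v c`. -/
def expectedFraction (G : SimpleGraph (Fin n)) [DecidableRel G.Adj] (P : Prior) (s : WorldState)
    (S : Fin n → Context → Prop) [∀ v c, Decidable (S v c)] : ℚ :=
  (∑ t : Fin n → AgentType,
    typesProb P s t * (#{v | S v (contextOf G t v)} : ℚ)) / n

/-- The probability of state `A` given that agent `v` has context `c`. -/
def posteriorA (G : SimpleGraph (Fin n)) [DecidableRel G.Adj] (P : Prior) (v : Fin n)
    (c : Context) : ℚ :=
  (∑ w : WorldState × (Fin n → AgentType) with w.1 = .A ∧ contextOf G w.2 v = c, worldProb P w) /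
    ∑ w : WorldState × (Fin n → AgentType) with contextOf G w.2 v = c, worldProb P w

/-- The expected fraction of agents of type `α`. -/
def fracα (G : SimpleGraph (Fin n)) [DecidableRel G.Adj] (P : Prior) (s : WorldState) : ℚ :=
  expectedFraction G P s fun _ c => c.1 = .α

/-- The expected fraction of agents of type `χ` or `α`. -/
def fracχα (G : SimpleGraph (Fin n)) [DecidableRel G.Adj] (P : Prior) (s : WorldState) : ℚ :=
  expectedFraction G P s fun _ c => c.1 = .χ ∨ c.1 = .α

/-- The expected fraction of agents that are of type `α` or have a candidate context, that is, are
of type `χ` and assign probability at least `p` to state `A`. -/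
def fracCandα (G : SimpleGraph (Fin n)) [DecidableRel G.Adj] (P : Prior) (s : WorldState) : ℚ :=
  expectedFraction G P s fun v c => (c.1 = .χ ∧ P.p ≤ posteriorA G P v c) ∨ c.1 = .α

/-- First algorithm: the pair `(X_A, X_B)`. The set of candidate states is never `{B}`, as type
`ν` is less likely in state `A`. -/
def alg1 (G : SimpleGraph (Fin n)) [DecidableRel G.Adj] (P : Prior) : ℚ × ℚ :=
  if fracχα G P .A < P.μ ∧ fracχα G P .B < P.μ then (fracα G P .A, fracα G P .B)
  else if P.μ ≤ fracχα G P .A ∧ P.μ ≤ fracχα G P .B then (fracχα G P .A, fracχα G P .B)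
  else if P.μ ≤ fracCandα G P .A then (fracCandα G P .A, fracCandα G P .B)
  else (fracα G P .A, fracα G P .B)

/-- Second algorithm: compare `(X_A, X_B)` with `μ*`. It returns nothing if `X_A < μ* ≤ X_B`. -/
def alg2 (X : ℚ × ℚ) (μs : ℚ) : Option Outcome :=
  if μs ≤ X.1 ∧ μs ≤ X.2 then some .Omega
  else if μs ≤ X.1 ∧ X.2 < μs then some .stateA
  else if X.1 < μs ∧ X.2 < μs then some .empty
  else none

/-- Third algorithm; `none` is the answer NULL. -/
def alg3 (G : SimpleGraph (Fin n)) [DecidableRel G.Adj] (P : Prior) (μs ε δ : ℚ) :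
    Option Outcome :=
  let S₁ := alg2 (alg1 G (P.withThresholds (P.p + δ / 3) (P.μ + ε / 3))) μs
  let S₂ := alg2 (alg1 G (P.withThresholds (P.p - δ / 3) (P.μ - ε / 3))) μs
  if S₁ = S₂ then S₁ else none

/-- The states are labeled correctly: the first algorithm returns `X_A ≥ X_B` (for all thresholds
in the range from `(p - δ, μ - ε)` to `(p + δ, μ + ε)` that the problem refers to). -/
def CorrectlyLabeled (G : SimpleGraph (Fin n)) [DecidableRel G.Adj] (P : Prior) (ε δ : ℚ) : Prop :=
  ∀ a b : ℚ, |a - P.p| ≤ δ → |b - P.μ| ≤ ε →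
    (alg1 G (P.withThresholds a b)).2 ≤ (alg1 G (P.withThresholds a b)).1

/-- The list `d` is the degree sequence of `G`: it records the degree of each vertex, in some
order. -/
def IsDegreeSequence (G : SimpleGraph (Fin n)) [DecidableRel G.Adj] (d : List ℕ) : Prop :=
  (d : Multiset ℕ) = (univ : Finset (Fin n)).val.map fun v => G.degree v

end Algorithms

/-! ## A machine model: random access machines with logarithmic cost

Registers and memory cells hold rational numbers. The basic operations are arithmetic, comparison
and indirect addressing; each is charged the bit lengths of the numbers that it involves. -/

namespace RAM

/-- Bit length of (numerator and denominator of) a rational number. -/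
def bits (q : ℚ) : ℕ := Nat.size q.num.natAbs + Nat.size q.den + 1

/-- Contents of the registers and of the memory. -/
structure Config where
  reg : ℕ → ℚ
  mem : ℕ → ℚ

/-- Expressions. -/
inductive Expr
  | const (q : ℚ)
  | reg (x : ℕ)
  | mem (addr : Expr)
  | add (a b : Expr)
  | sub (a b : Expr)
  | mul (a b : Expr)
  | div (a b : Expr)
  | le (a b : Expr)

/-- The value of an expression; `le` yields `1` for true, `0` for false. -/
def Expr.eval (c : Config) : Expr → ℚ
  | .const q => q
  | .reg x => c.reg x
  | .mem a => c.mem ⌊a.eval c⌋₊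
  | .add a b => a.eval c + b.eval c
  | .sub a b => a.eval c - b.eval c
  | .mul a b => a.eval c * b.eval c
  | .div a b => a.eval c / b.eval c
  | .le a b => if a.eval c ≤ b.eval c then 1 else 0

/-- The cost of evaluating an expression: the total bit length of the values of all its
subexpressions. -/
def Expr.cost (c : Config) : Expr → ℕ
  | .const q => bits q
  | .reg x => bits (c.reg x)
  | .mem a => a.cost c + bits (Expr.eval c (.mem a))
  | .add a b => a.cost c + b.cost c + bits (Expr.eval c (.add a b))
  | .sub a b => a.cost c + b.cost c + bits (Expr.eval c (.sub a b))
  | .mul a b => a.cost c + b.cost c + bits (Expr.eval c (.mul a b))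
  | .div a b => a.cost c + b.cost c + bits (Expr.eval c (.div a b))
  | .le a b => a.cost c + b.cost c + bits (Expr.eval c (.le a b))

/-- Programs. A condition holds if its value is not `0`;
`loop e s` repeats `s` while `e` holds. -/
inductive Program
  | skip
  | assign (x : ℕ) (e : Expr)
  | store (addr e : Expr)
  | seq (s t : Program)
  | ite (e : Expr) (s t : Program)
  | loop (e : Expr) (s : Program)

/-- `Exec s c k c'`: started in `c`, the program `s` halts in `c'` at total cost `k`. -/
inductive Exec : Program → Config → ℕ → Config → Prop
  | skip (c : Config) : Exec .skip c 1 c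
  | assign (x : ℕ) (e : Expr) (c : Config) :
      Exec (.assign x e) c (e.cost c + 1) { c with reg := Function.update c.reg x (e.eval c) }
  | store (addr e : Expr) (c : Config) :
      Exec (.store addr e) c (addr.cost c + e.cost c + 1)
        { c with mem := Function.update c.mem ⌊addr.eval c⌋₊ (e.eval c) }
  | seq {s t : Program} {c₁ c₂ c₃ : Config} {k l : ℕ} :
      Exec s c₁ k c₂ → Exec t c₂ l c₃ → Exec (.seq s t) c₁ (k + l) c₃
  | ite_true {e : Expr} {s t : Program} {c₁ c₂ : Config} {k : ℕ} :
      e.eval c₁ ≠ 0 → Exec s c₁ k c₂ → Exec (.ite e s t) c₁ (e.cost c₁ + k + 1) c₂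
  | ite_false {e : Expr} {s t : Program} {c₁ c₂ : Config} {k : ℕ} :
      e.eval c₁ = 0 → Exec t c₁ k c₂ → Exec (.ite e s t) c₁ (e.cost c₁ + k + 1) c₂
  | loop_true {e : Expr} {s : Program} {c₁ c₂ c₃ : Config} {k l : ℕ} :
      e.eval c₁ ≠ 0 → Exec s c₁ k c₂ → Exec (.loop e s) c₂ l c₃ →
        Exec (.loop e s) c₁ (e.cost c₁ + k + l + 1) c₃
  | loop_false {e : Expr} {s : Program} {c : Config} :
      e.eval c = 0 → Exec (.loop e s) c (e.cost c + 1) c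

/-- Initial configuration: the input in the first memory cells, everything else `0`. -/
def init (input : List ℚ) : Config where
  reg := fun _ => 0
  mem := fun i => input.getD i 0

/-- Total bit length of an input. -/
def inputSize (input : List ℚ) : ℕ := (input.map bits).sum

/-- On the given input, the program halts at cost at most `bound`, with `out` in register `0`. -/
def ComputesWithin (s : Program) (input : List ℚ) (bound : ℕ) (out : ℚ) : Prop :=
  ∃ k c, Exec s (init input) k c ∧ k ≤ bound ∧ c.reg 0 = out

end RAM

/-- The input that a machine receives: the number of vertices, the prior, `μ*`, `ε`, `δ` and the
degree sequence. -/
def encodeInput (d : List ℕ) (P : Prior) (μs ε δ : ℚ) : List ℚ :=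
  [(d.length : ℚ), P.p, P.μ,
    P.typeDist .A .α, P.typeDist .A .χ, P.typeDist .A .ν,
    P.typeDist .B .α, P.typeDist .B .χ, P.typeDist .B .ν,
    P.probA, μs, ε, δ] ++ d.map (fun k => (k : ℚ))

/-- Numerical code of an answer. -/
def encodeOutput : Option Outcome → ℚ
  | none => 0
  | some .Omega => 1
  | some .stateA => 2
  | some .empty => 3

/-- The function `f` of a degree sequence, a prior, `μ*`, `ε` and `δ` is computable in time
polynomial in the bit length of its input, on the degree sequences of all graphs. -/
def PolyTimeFromDegrees (f : List ℕ → Prior → ℚ → ℚ → ℚ → Option Outcome) : Prop :=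
  ∃ (prog : RAM.Program) (T : Polynomial ℕ),
    ∀ (n : ℕ) (G : SimpleGraph (Fin n)) [DecidableRel G.Adj] (d : List ℕ), IsDegreeSequence G d →
      ∀ (P : Prior) (μs ε δ : ℚ), P.Valid → 0 ≤ μs → μs ≤ 1 → 0 < ε → 0 < δ →
        RAM.ComputesWithin prog (encodeInput d P μs ε δ)
          (T.eval (RAM.inputSize (encodeInput d P μs ε δ))) (encodeOutput (f d P μs ε δ))

/-!
Condition on the context of one agent: this fixes the types in one closed neighborhood, that is, of
at most `D` agents, where `D - 1` bounds the degrees, and leaves the other types independent. One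
type influences at most `D` contexts. McDiarmid's inequality therefore shows that, with
`D = O(n^{1/3})` and even conditional on any one context, the number of agents with a given kind of
context deviates from its mean by `ε n / 3` with probability at most `exp (-Ω(n^{1/3}))`
(`prodExp_tail_cond_le`, `concentrated_of_degree_le`, `eventually_concentrated`).

Consequently the first algorithm describes the possible equilibria, up to small shifts of the
thresholds. In an equilibrium the agents of type `χ` who revolt are those who believe that the
revolt succeeds; successively excluding agents of type `χ` who have no reason to be confident shows
that its output is an upper bound for the revolts in all equilibria of a game with slightly higher
thresholds (`IsEquilibrium.sum_worldProb_ge_le`). Conversely, in a game with slightly lower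
thresholds the agents that it counts are all willing to revolt together. The game has single
crossing, so that agents can be added until nobody else wants to join; this gives an equilibrium
that is at least as large (`exists_isEquilibrium_ge`, `exists_isEquilibrium_sum_worldProb_lt_le`).

The third algorithm compares the outputs with `μ*` itself, and case `A` of the problem leaves no
slack in `μ*`. The problem is therefore solved by a variant, `RAM.answer`: it answers `Ω` if the
outputs at the lowered thresholds reach `μ* - ε / 2`, the empty outcome if those at the raised
thresholds are at most `μ* + ε / 2`, and `A` otherwise. As the states are correctly labeled,
in the last case `X_A > μ* + ε / 2` at the raised and `X_B < μ* - ε / 2` at the lowered thresholds,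
and both estimates apply to the given prior itself. So the case of the answer is always true
(`solvesInstance_answer`). For the finitely many `n` that are too small for these estimates, the
choice `δ₀ n = 1` makes the cases `Ω` and `∅` both true.

The expected fractions depend on the degrees only, because a neighborhood enters through the
multiset of its independent types: the formal sum of these multisets, weighted with their
probabilities, is a power with the degree as exponent (`sum_typesProb_mul_neighborhood`,
`alg1_eq_listAlg1`). A program evaluates this formula with loops over the agents, the numbers of
neighbors of type `α` and `χ`, and the factors of a trinomial probability. All degrees are less
than the length of the list, hence than the input size `N`, so no loop is iterated more than `N`
times. All numbers that occur have height `O(N⁵)`; a bound for the cost that is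
polynomial in `N` can then be read off from the program text (`RAM.Program.bound`,
`RAM.polyTimeFromDegrees_of_eval`).
-/

/-! ### Concentration of functions of independent types -/

section Concentration

variable {α : Type*} [Fintype α]

/-- The expectation of `f` when the coordinates of its argument are drawn independently with
weights `q`. -/
def prodExp {n : ℕ} (q : α → ℝ) (f : (Fin n → α) → ℝ) : ℝ := ∑ t, (∏ i, q (t i)) * f t

lemma prodExp_succ {n : ℕ} (q : α → ℝ) (f : (Fin (n + 1) → α) → ℝ) :
    prodExp q f = ∑ a, q a * prodExp q fun t => f (Fin.cons a t) := by
  unfold prodExp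
  rw [← (Fin.consEquiv fun _ => α).sum_comp, Fintype.sum_prod_type]
  refine sum_congr rfl fun a _ => ?_
  rw [mul_sum]
  refine sum_congr rfl fun t _ => ?_
  simp [Fin.consEquiv, Fin.prod_univ_succ, mul_assoc]

lemma prodExp_const {n : ℕ} {q : α → ℝ} (hq : ∑ a, q a = 1) (c : ℝ) :
    prodExp (n := n) q (fun _ => c) = c := by
  induction n with
  | zero => simp [prodExp]
  | succ n ih => rw [prodExp_succ]; simp_rw [ih]; rw [← sum_mul, hq, one_mul]

lemma prodExp_mono {n : ℕ} {q : α → ℝ} (h0 : ∀ a, 0 ≤ q a) {f g : (Fin n → α) → ℝ}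
    (h : ∀ t, f t ≤ g t) : prodExp q f ≤ prodExp q g :=
  sum_le_sum fun t _ => mul_le_mul_of_nonneg_left (h t) (prod_nonneg fun _ _ => h0 _)

lemma prodExp_mul_left {n : ℕ} (q : α → ℝ) (c : ℝ) (f : (Fin n → α) → ℝ) :
    prodExp q (fun t => c * f t) = c * prodExp q f := by
  simp only [prodExp, mul_sum]
  exact sum_congr rfl fun t _ => by ring

lemma prodExp_add {n : ℕ} (q : α → ℝ) (f g : (Fin n → α) → ℝ) :
    prodExp q (fun t => f t + g t) = prodExp q f + prodExp q g := by
  simp only [prodExp, ← sum_add_distrib, mul_add]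

/-- Hoeffding's bound (with a non-optimal constant) for the moment generating function of one
random variable whose values differ by at most `D`: on `[-D, D]` the function `exp (r x)` lies
below its chord, and the chord has mean `cosh (r D)`. -/
lemma sum_exp_le_of_abs_sub_le {q : α → ℝ} (h0 : ∀ a, 0 ≤ q a) (h1 : ∑ a, q a = 1) {g : α → ℝ}
    {D : ℝ} (hD : 0 < D) (hg : ∀ a b, |g a - g b| ≤ D) (r : ℝ) :
    ∑ a, q a * Real.exp (r * (g a - ∑ b, q b * g b)) ≤ Real.exp (r ^ 2 * D ^ 2 / 2) := by
  set m := ∑ b, q b * g b with hm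
  have hx : ∀ a, |g a - m| ≤ D := by
    intro a
    have : g a - m = ∑ b, q b * (g a - g b) := by
      simp_rw [mul_sub, sum_sub_distrib, ← sum_mul, h1, hm, one_mul]
    rw [this]
    calc |∑ b, q b * (g a - g b)| ≤ ∑ b, |q b * (g a - g b)| := abs_sum_le_sum_abs _ _
      _ ≤ ∑ b, q b * D := sum_le_sum fun b _ => by
          rw [abs_mul, abs_of_nonneg (h0 b)]; exact mul_le_mul_of_nonneg_left (hg a b) (h0 b)
      _ = D := by rw [← sum_mul, h1, one_mul]
  have hchord : ∀ a, Real.exp (r * (g a - m)) ≤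
      Real.cosh (r * D) + (g a - m) / D * Real.sinh (r * D) := by
    intro a
    have ha := abs_le.1 (hx a)
    have hl : 0 ≤ (1 + (g a - m) / D) / 2 := by
      have : -1 ≤ (g a - m) / D := by rw [le_div_iff₀ hD]; linarith
      linarith
    have hr : 0 ≤ (1 - (g a - m) / D) / 2 := by
      have : (g a - m) / D ≤ 1 := by rw [div_le_iff₀ hD]; linarith
      linarith
    have hc := convexOn_exp.2 (Set.mem_univ (r * D)) (Set.mem_univ (-(r * D))) hl hr (by ring)
    simp only [smul_eq_mul] at hc
    have he : (1 + (g a - m) / D) / 2 * (r * D) + (1 - (g a - m) / D) / 2 * -(r * D)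
        = r * (g a - m) := by field_simp; ring
    rw [he] at hc
    refine hc.trans (le_of_eq ?_)
    rw [Real.cosh_eq, Real.sinh_eq]; ring
  calc ∑ a, q a * Real.exp (r * (g a - m))
      ≤ ∑ a, q a * (Real.cosh (r * D) + (g a - m) / D * Real.sinh (r * D)) :=
        sum_le_sum fun a _ => mul_le_mul_of_nonneg_left (hchord a) (h0 a)
    _ = (∑ a, q a) * Real.cosh (r * D) +
          ((∑ a, q a * g a) - (∑ a, q a) * m) / D * Real.sinh (r * D) := by
        simp_rw [mul_add, sum_add_distrib, sum_mul, ← sum_sub_distrib, sum_div, sum_mul]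
        congr 1
        exact sum_congr rfl fun a _ => by ring
    _ = Real.cosh (r * D) := by rw [h1, ← hm]; ring
    _ ≤ Real.exp (r ^ 2 * D ^ 2 / 2) := by
        have := Real.cosh_le_exp_half_sq (r * D)
        rwa [mul_pow] at this

/-- McDiarmid's inequality in exponential form, proved by averaging out one coordinate at a
time. -/
lemma prodExp_exp_le {q : α → ℝ} (h0 : ∀ a, 0 ≤ q a) (h1 : ∑ a, q a = 1) {D : ℝ} (hD : 0 < D)
    (r : ℝ) : ∀ {n : ℕ} (f : (Fin n → α) → ℝ),
      (∀ t i a, |f (Function.update t i a) - f t| ≤ D) →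
      prodExp q (fun t => Real.exp (r * (f t - prodExp q f))) ≤
        Real.exp (n * (r ^ 2 * D ^ 2 / 2))
  | 0, f, _ => by simp [prodExp]
  | n + 1, f, hf => by
    set g : α → ℝ := fun a => prodExp q fun t => f (Fin.cons a t) with hgdef
    have hm : prodExp q f = ∑ a, q a * g a := prodExp_succ q f
    have hg : ∀ a b, |g a - g b| ≤ D := by
      have key : ∀ a b, g a - g b ≤ D := by
        intro a b
        have : g a ≤ prodExp q fun t => f (Fin.cons b t) + D := by
          refine prodExp_mono h0 fun t => ?_
          have := hf (Fin.cons b t) 0 a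
          rw [Fin.update_cons_zero] at this
          linarith [(abs_le.1 this).2]
        rw [prodExp_add, prodExp_const h1] at this
        simp only [hgdef] at this ⊢
        linarith
      intro a b
      exact abs_le.2 ⟨by linarith [key b a], key a b⟩
    rw [prodExp_succ]
    calc ∑ a, q a * prodExp q (fun t => Real.exp (r * (f (Fin.cons a t) - prodExp q f)))
        = ∑ a, q a * (Real.exp (r * (g a - prodExp q f)) *
            prodExp q fun t => Real.exp (r * (f (Fin.cons a t) - g a))) := by
          refine sum_congr rfl fun a _ => ?_
          rw [← prodExp_mul_left q (Real.exp _)]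
          congr 2
          funext t
          rw [← Real.exp_add]; congr 1; ring
      _ ≤ ∑ a, q a * (Real.exp (r * (g a - prodExp q f)) *
            Real.exp (n * (r ^ 2 * D ^ 2 / 2))) := by
          refine sum_le_sum fun a _ => mul_le_mul_of_nonneg_left ?_ (h0 a)
          refine mul_le_mul_of_nonneg_left ?_ (Real.exp_pos _).le
          refine prodExp_exp_le h0 h1 hD r (fun t => f (Fin.cons a t)) fun t i b => ?_
          have := hf (Fin.cons a t) i.succ b
          rwa [← Fin.cons_update] at this
      _ = (∑ a, q a * Real.exp (r * (g a - ∑ b, q b * g b))) *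
            Real.exp (n * (r ^ 2 * D ^ 2 / 2)) := by
          rw [sum_mul, hm]; exact sum_congr rfl fun a _ => by ring
      _ ≤ Real.exp (r ^ 2 * D ^ 2 / 2) * Real.exp (n * (r ^ 2 * D ^ 2 / 2)) :=
          mul_le_mul_of_nonneg_right (sum_exp_le_of_abs_sub_le h0 h1 hD hg r) (Real.exp_pos _).le
      _ = Real.exp ((n + 1 : ℕ) * (r ^ 2 * D ^ 2 / 2)) := by
          rw [← Real.exp_add]; congr 1; push_cast; ring

/-- McDiarmid's inequality (upper tail), with a non-optimal constant. -/
lemma prodExp_tail_le {q : α → ℝ} (h0 : ∀ a, 0 ≤ q a) (h1 : ∑ a, q a = 1) {D τ : ℝ} (hD : 0 < D)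
    (hτ : 0 ≤ τ) {n : ℕ} (hn : 0 < n) (f : (Fin n → α) → ℝ)
    (hf : ∀ t i a, |f (Function.update t i a) - f t| ≤ D) :
    prodExp q (fun t => if prodExp q f + τ ≤ f t then 1 else 0) ≤
      Real.exp (-(τ ^ 2 / (2 * n * D ^ 2))) := by
  have hn' : (0 : ℝ) < n := by exact_mod_cast hn
  -- the value of the free parameter that minimizes `-r τ + n r² D² / 2`
  set r : ℝ := τ / (n * D ^ 2) with hr
  have hr0 : 0 ≤ r := by positivity
  calc prodExp q (fun t => if prodExp q f + τ ≤ f t then 1 else 0)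
      ≤ prodExp q (fun t => Real.exp (-(r * τ)) * Real.exp (r * (f t - prodExp q f))) := by
        refine prodExp_mono h0 fun t => ?_
        split_ifs with h
        · rw [← Real.exp_add]
          refine Real.one_le_exp ?_
          have : 0 ≤ r * (f t - prodExp q f - τ) := mul_nonneg hr0 (by linarith)
          linarith
        · positivity
    _ = Real.exp (-(r * τ)) * prodExp q (fun t => Real.exp (r * (f t - prodExp q f))) :=
        prodExp_mul_left _ _ _
    _ ≤ Real.exp (-(r * τ)) * Real.exp (n * (r ^ 2 * D ^ 2 / 2)) :=
        mul_le_mul_of_nonneg_left (prodExp_exp_le h0 h1 hD r f hf) (Real.exp_pos _).le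
    _ = Real.exp (-(τ ^ 2 / (2 * n * D ^ 2))) := by
        rw [← Real.exp_add]; congr 1; rw [hr]; field_simp; ring

lemma abs_piecewise_sub_le {α : Type*} {n : ℕ} {f : (Fin n → α) → ℝ} {D : ℝ}
    (hf : ∀ t i a, |f (Function.update t i a) - f t| ≤ D) (N : Finset (Fin n))
    (t₀ t : Fin n → α) : |f (N.piecewise t₀ t) - f t| ≤ #N * D := by
  induction N using Finset.induction_on with
  | empty => simp
  | insert i N hi ih =>
    rw [piecewise_insert, card_insert_of_notMem hi]
    have := hf (N.piecewise t₀ t) i (t₀ i)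
    push_cast
    calc _ ≤ |f (Function.update (N.piecewise t₀ t) i (t₀ i)) - f (N.piecewise t₀ t)|
          + |f (N.piecewise t₀ t) - f t| := abs_sub_le _ _ _
      _ ≤ (#N + 1) * D := by linarith

/-- Resampling: if `t₀` and `t` are independent copies, then so is the assignment that follows
`t₀` on `N` and `t` elsewhere. -/
lemma prodExp_piecewise {n : ℕ} {q : α → ℝ} (h1 : ∑ a, q a = 1) (N : Finset (Fin n))
    (h : (Fin n → α) → ℝ) :
    prodExp q (fun t₀ => prodExp q fun t => h (N.piecewise t₀ t)) = prodExp q h := by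
  have e : prodExp q h = prodExp q (fun t₀ => prodExp (n := n) q fun _ => h t₀) := by
    simp_rw [prodExp_const h1]
  rw [e]
  simp only [prodExp, mul_sum]
  rw [← Fintype.sum_prod_type', ← Fintype.sum_prod_type']
  let swap : (Fin n → α) × (Fin n → α) → (Fin n → α) × (Fin n → α) :=
    fun x => (N.piecewise x.1 x.2, N.piecewise x.2 x.1)
  have hswap : Function.Involutive swap := by
    rintro ⟨x, y⟩
    ext i <;> by_cases hi : i ∈ N <;> simp [swap, hi]
  rw [← Equiv.sum_comp (Function.Involutive.toPerm swap hswap)]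
  refine sum_congr rfl fun x _ => ?_
  obtain ⟨x, y⟩ := x
  have : swap (swap (x, y)) = (x, y) := hswap _
  have hx : N.piecewise (N.piecewise x y) (N.piecewise y x) = x := congrArg Prod.fst this
  simp only [Function.Involutive.coe_toPerm, swap, hx]
  rw [← mul_assoc, ← mul_assoc, ← prod_mul_distrib, ← prod_mul_distrib]
  congr 1
  refine prod_congr rfl fun i _ => ?_
  by_cases hi : i ∈ N <;> simp [hi, mul_comm]

/-- McDiarmid's inequality conditional on an event `E` that depends only on the coordinates
in `N`: the other coordinates are independent of `E`, and fixing those in `N` moves the mean by at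
most `#N * D`. -/
lemma prodExp_tail_cond_le {q : α → ℝ} (h0 : ∀ a, 0 ≤ q a) (h1 : ∑ a, q a = 1) {D τ : ℝ}
    (hD : 0 < D) (hτ : 0 ≤ τ) {n : ℕ} (hn : 0 < n) (f : (Fin n → α) → ℝ)
    (hf : ∀ t i a, |f (Function.update t i a) - f t| ≤ D) (N : Finset (Fin n))
    (E : (Fin n → α) → Prop) [DecidablePred E] (hE : ∀ t₀ t, E (N.piecewise t₀ t) ↔ E t₀) :
    prodExp q (fun t => if E t ∧ prodExp q f + (τ + #N * D) ≤ f t then 1 else 0) ≤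
      Real.exp (-(τ ^ 2 / (2 * n * D ^ 2))) * prodExp q (fun t => if E t then 1 else 0) := by
  rw [← prodExp_piecewise h1 N, ← prodExp_mul_left]
  refine prodExp_mono h0 fun t₀ => ?_
  by_cases h : E t₀
  · simp only [hE, h, true_and, if_true, mul_one]
    set g : (Fin n → α) → ℝ := fun t => f (N.piecewise t₀ t) with hg
    have hgf : prodExp q g ≤ prodExp q f + #N * D := by
      rw [← prodExp_const h1 (n := n) (#N * D), ← prodExp_add]
      refine prodExp_mono h0 fun t => ?_
      linarith [(abs_le.1 (abs_piecewise_sub_le hf N t₀ t)).2]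
    refine le_trans (prodExp_mono h0 fun t => ?_) (prodExp_tail_le h0 h1 hD hτ hn g ?_)
    · split_ifs with ha hb
      · exact le_rfl
      · exact absurd (by simp only [hg] at *; linarith) hb
      · exact zero_le_one
      · exact le_rfl
    · intro t i a
      by_cases hi : i ∈ N
      · have : N.piecewise t₀ (Function.update t i a) = N.piecewise t₀ t := by
          ext j
          by_cases hj : j ∈ N
          · simp [hj]
          · have : j ≠ i := fun h => hj (h ▸ hi)
            simp [hj, this]
        simp [hg, this, hD.le]
      · have : N.piecewise t₀ (Function.update t i a) =
            Function.update (N.piecewise t₀ t) i a := by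
          ext j
          by_cases hj : j ∈ N
          · have : j ≠ i := fun h => hi (h ▸ hj)
            simp [hj, this]
          · by_cases hji : j = i
            · subst hji; simp [hj]
            · simp [hj, hji]
        simp only [hg, this]
        exact hf _ _ _
  · simp only [hE, h, false_and, if_false]
    rw [prodExp_const h1]; simp

end Concentration

/-! ### Concentration of the numbers of contexts -/

section Tails

variable {n : ℕ}

lemma contextOf_congr (G : SimpleGraph (Fin n)) [DecidableRel G.Adj] {t t' : Fin n → AgentType}
    {v : Fin n} (h : ∀ u ∈ insert v (G.neighborFinset v), t u = t' u) :
    contextOf G t v = contextOf G t' v := by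
  unfold contextOf
  rw [h v (mem_insert_self _ _)]
  congr 1
  exact Multiset.map_congr rfl fun u hu => h u (mem_insert_of_mem hu)

/-- The number of agents `v` whose context `c` satisfies `S v c`. -/
def contextCount (G : SimpleGraph (Fin n)) [DecidableRel G.Adj] (S : Fin n → Context → Prop)
    [∀ v c, Decidable (S v c)] (t : Fin n → AgentType) : ℕ :=
  #{v | S v (contextOf G t v)}

/-- One type influences only the contexts in a closed neighborhood. -/
lemma contextCount_update_le (G : SimpleGraph (Fin n)) [DecidableRel G.Adj]
    (S : Fin n → Context → Prop) [∀ v c, Decidable (S v c)] (t t' : Fin n → AgentType) (i : Fin n)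
    (h : ∀ u, u ≠ i → t u = t' u) :
    contextCount G S t ≤ contextCount G S t' + (G.degree i + 1) := by
  have hsub : ({v | S v (contextOf G t v)} : Finset (Fin n)) ⊆
      ({v | S v (contextOf G t' v)} : Finset (Fin n)) ∪ insert i (G.neighborFinset i) := by
    intro v hv
    by_cases hvi : v ∈ insert i (G.neighborFinset i)
    · exact mem_union_right _ hvi
    · refine mem_union_left _ ?_
      simp only [mem_filter_univ] at hv ⊢
      rwa [← contextOf_congr G fun u hu => h u ?_]
      rintro rfl
      simp only [mem_insert, SimpleGraph.mem_neighborFinset] at hu hvi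
      rcases hu with rfl | hu
      · exact hvi (Or.inl rfl)
      · exact hvi (Or.inr hu.symm)
  calc _ ≤ _ := card_le_card hsub
    _ ≤ _ := card_union_le _ _
    _ ≤ _ := by
      gcongr
      · exact le_rfl
      · exact (card_insert_le _ _).trans (by simp)

lemma abs_contextCount_update_sub_le (G : SimpleGraph (Fin n)) [DecidableRel G.Adj]
    (S : Fin n → Context → Prop) [∀ v c, Decidable (S v c)] (t : Fin n → AgentType) (i : Fin n)
    (a : AgentType) {D : ℝ} (hD : (G.degree i : ℝ) + 1 ≤ D) :
    |(contextCount G S (Function.update t i a) : ℝ) - contextCount G S t| ≤ D := by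
  have h1 := contextCount_update_le G S (Function.update t i a) t i fun u hu => by simp [hu]
  have h2 := contextCount_update_le G S t (Function.update t i a) i fun u hu => by simp [hu]
  rw [← Nat.cast_le (α := ℝ)] at h1 h2
  push_cast at h1 h2
  exact abs_le.2 ⟨by linarith, by linarith⟩

/-- McDiarmid's inequality for the type assignments of the game, over the rationals. -/
lemma sum_typesProb_tail_le {P : Prior} (hP : P.Valid) (s : WorldState) {D : ℝ} {ε η : ℚ}
    (hD : 0 < D) (hn : 0 < n) (hε : 0 < ε) (hDε : D ^ 2 + 1 ≤ ε * n / 2)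
    (hη : Real.exp (-((ε * n / 2) ^ 2 / (2 * n * D ^ 2))) ≤ η) (F : (Fin n → AgentType) → ℚ)
    (hF : ∀ t i a, |(F (Function.update t i a) : ℝ) - F t| ≤ D) (N : Finset (Fin n))
    (hN : (#N : ℝ) ≤ D)
    (E : (Fin n → AgentType) → Prop) [DecidablePred E] (hE : ∀ t₀ t, E (N.piecewise t₀ t) ↔ E t₀) :
    ∑ t with E t ∧ (∑ t, typesProb P s t * F t) + ε * n ≤ F t + 1, typesProb P s t ≤
      η * ∑ t with E t, typesProb P s t := by
  have key := prodExp_tail_cond_le (q := fun a => (P.typeDist s a : ℝ))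
    (fun a => by exact_mod_cast hP.typeDist_nonneg s a) (by exact_mod_cast hP.typeDist_sum s)
    hD (τ := ε * n / 2) (by positivity) hn (fun t => (F t : ℝ)) hF N E hE
  have hcast : ∀ f : (Fin n → AgentType) → ℚ,
      prodExp (fun a => (P.typeDist s a : ℝ)) (fun t => (f t : ℝ)) =
        ((∑ t, typesProb P s t * f t : ℚ) : ℝ) := by
    intro f; simp [prodExp, typesProb]
  rw [hcast F] at key
  have h1 : ((∑ t with E t ∧ (∑ t, typesProb P s t * F t) + ε * n ≤ F t + 1,
      typesProb P s t : ℚ) : ℝ) ≤ prodExp (fun a => (P.typeDist s a : ℝ)) (fun t =>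
        if E t ∧ ((∑ t, typesProb P s t * F t : ℚ) : ℝ) + (ε * n / 2 + #N * D) ≤ F t then 1
        else 0) := by
    rw [sum_filter]
    push_cast [prodExp]
    refine sum_le_sum fun t _ => ?_
    have h0 : (0 : ℝ) ≤ ∏ i, (P.typeDist s (t i) : ℝ) :=
      prod_nonneg fun i _ => by exact_mod_cast hP.typeDist_nonneg s _
    split_ifs with ha hb
    · simp [typesProb]
    · refine absurd ⟨ha.1, ?_⟩ hb
      have hND : #N * D ≤ D ^ 2 := by rw [sq]; exact mul_le_mul_of_nonneg_right hN hD.le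
      have : ((∑ t, typesProb P s t * F t : ℚ) : ℝ) + ε * n ≤ F t + 1 := by exact_mod_cast ha.2
      push_cast at this
      linarith
    · simpa using h0
    · simp
  have h2 : prodExp (fun a => (P.typeDist s a : ℝ)) (fun t => if E t then 1 else 0) =
      ((∑ t with E t, typesProb P s t : ℚ) : ℝ) := by
    rw [sum_filter]
    push_cast [prodExp]
    exact sum_congr rfl fun t _ => by split_ifs <;> simp [typesProb]
  rw [h2] at key
  have h3 : (0 : ℝ) ≤ ((∑ t with E t, typesProb P s t : ℚ) : ℝ) := by
    exact_mod_cast sum_nonneg fun t _ => prod_nonneg fun i _ => hP.typeDist_nonneg s _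
  have := (h1.trans key).trans (mul_le_mul_of_nonneg_right hη h3)
  exact_mod_cast this

/-- Up to deviations of `ε n - 1`, the number of agents with a given kind of context is
concentrated around its mean: the tails have probability at most `η`, even conditional on the
context of any one agent. -/
structure Concentrated (G : SimpleGraph (Fin n)) [DecidableRel G.Adj] (P : Prior) (ε η : ℚ) :
    Prop where
  upper : ∀ (S : Fin n → Context → Prop) [∀ v c, Decidable (S v c)] (s : WorldState),
    ∑ t with (expectedFraction G P s S + ε) * n ≤ contextCount G S t + 1, typesProb P s t ≤ η
  lower : ∀ (S : Fin n → Context → Prop) [∀ v c, Decidable (S v c)] (s : WorldState),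
    ∑ t with (contextCount G S t : ℚ) ≤ (expectedFraction G P s S - ε) * n + 1,
      typesProb P s t ≤ η
  upper_cond : ∀ (S : Fin n → Context → Prop) [∀ v c, Decidable (S v c)] (s : WorldState)
    (i : Fin n) (c : Context),
    ∑ t with contextOf G t i = c ∧ (expectedFraction G P s S + ε) * n ≤ contextCount G S t + 1,
      typesProb P s t ≤ η * ∑ t with contextOf G t i = c, typesProb P s t
  lower_cond : ∀ (S : Fin n → Context → Prop) [∀ v c, Decidable (S v c)] (s : WorldState)
    (i : Fin n) (c : Context),
    ∑ t with contextOf G t i = c ∧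
        (contextCount G S t : ℚ) ≤ (expectedFraction G P s S - ε) * n + 1,
      typesProb P s t ≤ η * ∑ t with contextOf G t i = c, typesProb P s t

lemma sum_typesProb {P : Prior} (hP : P.Valid) (s : WorldState) :
    ∑ t : Fin n → AgentType, typesProb P s t = 1 := by
  simp only [typesProb]
  rw [← Fintype.piFinset_univ, ← Finset.prod_univ_sum]
  simp [hP.typeDist_sum s]

/-- Half of the deviation `ε n` pays for the shift of the mean by at most `D ^ 2` that conditioning
on a context causes, and for the difference of `1` in `Concentrated`. -/
lemma concentrated_of_degree_le (G : SimpleGraph (Fin n)) [DecidableRel G.Adj] {P : Prior}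
    (hP : P.Valid) {D : ℝ} {ε η : ℚ} (hn : 0 < n) (hε : 0 < ε)
    (hdeg : ∀ v, (G.degree v : ℝ) + 1 ≤ D)
    (hDε : D ^ 2 + 1 ≤ ε * n / 2)
    (hη : Real.exp (-((ε * n / 2) ^ 2 / (2 * n * D ^ 2))) ≤ η) : Concentrated G P ε η := by
  have hn' : (n : ℚ) ≠ 0 := by exact_mod_cast hn.ne'
  have hD : 0 < D := by
    have := hdeg ⟨0, hn⟩
    have h0 : (0 : ℝ) ≤ G.degree ⟨0, hn⟩ := Nat.cast_nonneg _
    linarith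
  have hmean : ∀ (S : Fin n → Context → Prop) [∀ v c, Decidable (S v c)] (s : WorldState),
      ∑ t, typesProb P s t * (contextCount G S t : ℚ) = expectedFraction G P s S * n := by
    intro S _ s
    rw [expectedFraction, div_mul_cancel₀ _ hn']
    rfl
  have hup : ∀ (S : Fin n → Context → Prop) [∀ v c, Decidable (S v c)] (s : WorldState)
      (N : Finset (Fin n)) (_ : (#N : ℝ) ≤ D) (E : (Fin n → AgentType) → Prop) [DecidablePred E]
      (_ : ∀ t₀ t, E (N.piecewise t₀ t) ↔ E t₀),
      ∑ t with E t ∧ (expectedFraction G P s S + ε) * n ≤ contextCount G S t + 1,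
        typesProb P s t ≤ η * ∑ t with E t, typesProb P s t := by
    intro S _ s N hN E _ hE
    have := sum_typesProb_tail_le hP s hD hn hε hDε hη (fun t => (contextCount G S t : ℚ))
      (fun t i a => by
        push_cast; exact abs_contextCount_update_sub_le G S t i a (hdeg i)) N hN E hE
    simpa only [hmean, add_mul] using this
  have hlow : ∀ (S : Fin n → Context → Prop) [∀ v c, Decidable (S v c)] (s : WorldState)
      (N : Finset (Fin n)) (_ : (#N : ℝ) ≤ D) (E : (Fin n → AgentType) → Prop) [DecidablePred E]
      (_ : ∀ t₀ t, E (N.piecewise t₀ t) ↔ E t₀),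
      ∑ t with E t ∧ (contextCount G S t : ℚ) ≤ (expectedFraction G P s S - ε) * n + 1,
        typesProb P s t ≤ η * ∑ t with E t, typesProb P s t := by
    intro S _ s N hN E _ hE
    have := sum_typesProb_tail_le hP s hD hn hε hDε hη (fun t => -(contextCount G S t : ℚ))
      (fun t i a => by
        push_cast
        rw [← abs_neg, neg_sub_neg, neg_sub]
        exact abs_contextCount_update_sub_le G S t i a (hdeg i)) N hN E hE
    simp only [mul_neg, sum_neg_distrib, hmean] at this
    refine le_trans (le_of_eq ?_) this
    congr 1
    refine filter_congr fun t _ => and_congr_right fun _ => ?_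
    constructor <;> intro h <;> linarith
  have hctx : ∀ (i : Fin n) (c : Context) (t₀ t : Fin n → AgentType),
      contextOf G ((insert i (G.neighborFinset i)).piecewise t₀ t) i = c ↔
        contextOf G t₀ i = c := by
    intro i c t₀ t
    rw [contextOf_congr G fun u hu => piecewise_eq_of_mem _ _ _ hu]
  have hcard : ∀ i : Fin n, (#(insert i (G.neighborFinset i)) : ℝ) ≤ D := by
    intro i
    refine le_trans ?_ (hdeg i)
    have := card_insert_le i (G.neighborFinset i)
    rw [SimpleGraph.card_neighborFinset_eq_degree] at this
    exact_mod_cast this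
  refine ⟨fun S _ s => ?_, fun S _ s => ?_, fun S _ s i c => ?_, fun S _ s i c => ?_⟩
  · simpa [sum_typesProb hP] using hup S s ∅ (by simpa using hD.le) (fun _ => True) (by simp)
  · simpa [sum_typesProb hP] using hlow S s ∅ (by simpa using hD.le) (fun _ => True) (by simp)
  · exact hup S s _ (hcard i) _ (hctx i c)
  · exact hlow S s _ (hcard i) _ (hctx i c)

end Tails

/-! ### Equilibria, context by context -/

lemma univ_worldState : (univ : Finset WorldState) = {.A, .B} := rfl

lemma sum_worldState {M : Type*} [AddCommMonoid M] (f : WorldState → M) :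
    ∑ s, f s = f .A + f .B := by
  rw [univ_worldState, sum_pair (by decide)]

namespace Prior

lemma Valid.stateProb_nonneg {P : Prior} (hP : P.Valid) (s : WorldState) : 0 ≤ P.stateProb s := by
  cases s
  · exact hP.probA_nonneg
  · exact sub_nonneg.2 hP.probA_le_one

end Prior

section Equilibria

variable {n : ℕ}

lemma typesProb_nonneg {P : Prior} (hP : P.Valid) (s : WorldState) (t : Fin n → AgentType) :
    0 ≤ typesProb P s t := prod_nonneg fun _ _ => hP.typeDist_nonneg _ _

lemma worldProb_nonneg {P : Prior} (hP : P.Valid) (w : WorldState × (Fin n → AgentType)) :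
    0 ≤ worldProb P w := mul_nonneg (hP.stateProb_nonneg _) (typesProb_nonneg hP _ _)

lemma sum_filter_world {f : WorldState × (Fin n → AgentType) → ℚ}
    (Q : WorldState × (Fin n → AgentType) → Prop) [DecidablePred Q] :
    ∑ w with Q w, f w = ∑ s, ∑ t with Q (s, t), f (s, t) := by
  simp only [sum_filter, Fintype.sum_prod_type]

/-- Agent `i` plays `m` whatever her context is; the others play according to `σ`. -/
def forced (σ : Fin n → Strategy) (i : Fin n) (m : Move) : Fin n → Strategy :=
  Function.update σ i fun _ => m

variable (G : SimpleGraph (Fin n)) [DecidableRel G.Adj]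

lemma mem_revolters {σ : Fin n → Strategy} {t : Fin n → AgentType} {v : Fin n} :
    v ∈ revolters G σ t ↔ σ v (contextOf G t v) = .R := by
  simp [revolters]

/-- The contribution of the context `c` to the expected payoff of agent `i` if she plays `m` in
that context. -/
def contextPayoff (P : Prior) (σ : Fin n → Strategy) (i : Fin n) (c : Context) (m : Move) : ℚ :=
  ∑ w : WorldState × (Fin n → AgentType) with contextOf G w.2 i = c,
    worldProb P w * payoff P n (#(revolters G (forced σ i m) w.2)) c.1 m

lemma revolters_update (σ : Fin n → Strategy) (i : Fin n) (τ : Strategy) (t : Fin n → AgentType) :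
    revolters G (Function.update σ i τ) t =
      revolters G (forced σ i (τ (contextOf G t i))) t := by
  ext v
  by_cases hv : v = i
  · subst hv; simp [mem_revolters, forced]
  · simp [mem_revolters, forced, hv]

lemma expectedPayoff_update (P : Prior) (σ : Fin n → Strategy) (i : Fin n) (τ : Strategy) :
    expectedPayoff G P (Function.update σ i τ) i =
      ∑ c ∈ univ.image fun t => contextOf G t i, contextPayoff G P σ i c (τ c) := by
  unfold expectedPayoff contextPayoff
  rw [← sum_fiberwise_of_maps_to (g := fun w : WorldState × (Fin n → AgentType) =>
    contextOf G w.2 i) (t := univ.image fun t => contextOf G t i) (by simp)]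
  refine sum_congr rfl fun c _ => sum_congr rfl fun w hw => ?_
  rw [mem_filter_univ] at hw
  rw [revolters_update, ← hw]
  simp [contextOf]

lemma contextPayoff_of_notMem {P : Prior} {σ : Fin n → Strategy} {i : Fin n} {c : Context}
    (hc : ∀ t, contextOf G t i ≠ c) (m : Move) : contextPayoff G P σ i c m = 0 :=
  sum_eq_zero fun w hw => absurd (mem_filter_univ w |>.1 hw) (hc _)

lemma isEquilibrium_iff (P : Prior) (σ : Fin n → Strategy) :
    IsEquilibrium G P σ ↔
      ∀ i c m, contextPayoff G P σ i c m ≤ contextPayoff G P σ i c (σ i c) := by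
  have hσ : ∀ i, expectedPayoff G P σ i =
      ∑ c ∈ univ.image fun t => contextOf G t i, contextPayoff G P σ i c (σ i c) := by
    intro i; rw [← expectedPayoff_update, Function.update_eq_self]
  constructor
  · intro h i c m
    by_cases hc : c ∈ univ.image fun t => contextOf G t i
    · have := h i (Function.update (σ i) c m)
      rw [expectedPayoff_update, hσ, ← add_sum_erase _ _ hc, ← add_sum_erase _ _ hc,
        Function.update_self] at this
      have he : ∑ x ∈ (univ.image fun t => contextOf G t i).erase c,
          contextPayoff G P σ i x (Function.update (σ i) c m x) =
          ∑ x ∈ (univ.image fun t => contextOf G t i).erase c, contextPayoff G P σ i x (σ i x) :=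
        sum_congr rfl fun x hx => by rw [Function.update_of_ne (ne_of_mem_erase hx)]
      linarith
    · have hc' : ∀ t, contextOf G t i ≠ c := by simpa using hc
      rw [contextPayoff_of_notMem G hc', contextPayoff_of_notMem G hc']
  · intro h i τ
    rw [expectedPayoff_update, hσ]
    exact sum_le_sum fun c _ => h i c _

/-- How much more a `χ` agent `i` gains in the context `c` by revolting than by yielding. -/
def advantage (P : Prior) (σ : Fin n → Strategy) (i : Fin n) (c : Context) : ℚ :=
  ∑ w : WorldState × (Fin n → AgentType) with contextOf G w.2 i = c,
    worldProb P w * (payoff P n (#(revolters G (forced σ i .R) w.2)) .χ .R -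
      payoff P n (#(revolters G (forced σ i .Y) w.2)) .χ .Y)

lemma contextPayoff_sub {P : Prior} {σ : Fin n → Strategy} {i : Fin n} {c : Context}
    (hc : c.1 = .χ) :
    contextPayoff G P σ i c .R - contextPayoff G P σ i c .Y = advantage G P σ i c := by
  unfold contextPayoff advantage
  rw [← sum_sub_distrib, hc]
  exact sum_congr rfl fun w _ => by ring

lemma revolters_forced_mono {σ σ' : Fin n → Strategy} {t : Fin n → AgentType}
    (h : ∀ v, σ v (contextOf G t v) = .R → σ' v (contextOf G t v) = .R) (i : Fin n) (m : Move) :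
    revolters G (forced σ i m) t ⊆ revolters G (forced σ' i m) t := by
  intro v
  by_cases hv : v = i
  · subst hv; simp [mem_revolters, forced]
  · simpa [mem_revolters, forced, hv] using h v

lemma revolters_forced_Y_subset (σ : Fin n → Strategy) (i : Fin n) (t : Fin n → AgentType) :
    revolters G (forced σ i .Y) t ⊆ revolters G (forced σ i .R) t := by
  intro v
  by_cases hv : v = i
  · subst hv; simp [mem_revolters, forced]
  · simp [mem_revolters, forced, hv]

lemma revolters_forced_R_subset (σ : Fin n → Strategy) (i : Fin n) (t : Fin n → AgentType) :
    revolters G (forced σ i .R) t ⊆ insert i (revolters G σ t) := by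
  intro v
  by_cases hv : v = i
  · subst hv; simp
  · simp [mem_revolters, forced, hv]

lemma revolters_subset_forced_Y (σ : Fin n → Strategy) (i : Fin n) (t : Fin n → AgentType) :
    revolters G σ t ⊆ insert i (revolters G (forced σ i .Y) t) := by
  intro v
  by_cases hv : v = i
  · subst hv; simp
  · simp [mem_revolters, forced, hv]

/-- Single crossing: if a `χ` agent is willing to revolt, then she remains willing when others
revolt in more contexts. For `0 ≤ p ≤ 1` the payoffs have increasing differences; outside this
range one of the moves is dominant. -/
lemma advantage_nonneg_mono {P Q : Prior} (hQ : Q.Valid)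
    (hPQ : ∀ w, worldProb (n := n) P w = worldProb Q w)
    {σ σ' : Fin n → Strategy}
    (h : ∀ t v, σ v (contextOf G t v) = .R → σ' v (contextOf G t v) = .R) {i : Fin n} {c : Context}
    (h0 : 0 ≤ advantage G P σ i c) : 0 ≤ advantage G P σ' i c := by
  have hW : ∀ w, 0 ≤ worldProb P w := fun w => (hPQ w) ▸ worldProb_nonneg hQ w
  have hR : ∀ t, (#(revolters G (forced σ i .R) t) : ℚ) ≤ #(revolters G (forced σ' i .R) t) :=
    fun t => by exact_mod_cast card_le_card (revolters_forced_mono G (h t) i .R)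
  have hY : ∀ t, (#(revolters G (forced σ i .Y) t) : ℚ) ≤ #(revolters G (forced σ' i .Y) t) :=
    fun t => by exact_mod_cast card_le_card (revolters_forced_mono G (h t) i .Y)
  have hYR : ∀ t, (#(revolters G (forced σ i .Y) t) : ℚ) ≤ #(revolters G (forced σ i .R) t) :=
    fun t => by exact_mod_cast card_le_card (revolters_forced_Y_subset G σ i t)
  rcases lt_or_ge P.p 0 with hp | hp
  · refine sum_nonneg fun w _ => mul_nonneg (hW w) ?_
    simp only [payoff]
    split_ifs <;> linarith
  rcases le_or_gt P.p 1 with hp1 | hp1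
  · refine h0.trans (sum_le_sum fun w _ => mul_le_mul_of_nonneg_left ?_ (hW w))
    have h1 := hR w.2
    have h2 := hY w.2
    simp only [payoff]
    split_ifs <;> linarith
  · have hneg : ∀ w : WorldState × (Fin n → AgentType),
        payoff P n (#(revolters G (forced σ i .R) w.2)) .χ .R -
          payoff P n (#(revolters G (forced σ i .Y) w.2)) .χ .Y < 0 := by
      intro w
      have h1 := hYR w.2
      simp only [payoff]
      split_ifs <;> linarith
    have hz := (sum_eq_zero_iff_of_nonpos fun w _ =>
      mul_nonpos_of_nonneg_of_nonpos (hW w) (hneg w).le).1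
        (le_antisymm (sum_nonpos fun w _ =>
          mul_nonpos_of_nonneg_of_nonpos (hW w) (hneg w).le) h0)
    refine (sum_eq_zero fun w hw => ?_).ge
    rw [(mul_eq_zero.1 (hz w hw)).resolve_right (hneg w).ne, zero_mul]

/-- The profile in which agent `v` revolts in the contexts `c` with `S v c`. -/
def profileOf (S : Fin n → Context → Prop) [∀ v c, Decidable (S v c)] : Fin n → Strategy :=
  fun v c => if S v c then .R else .Y

lemma card_revolters_profileOf (S : Fin n → Context → Prop) [∀ v c, Decidable (S v c)]
    (t : Fin n → AgentType) : #(revolters G (profileOf S) t) = contextCount G S t := by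
  unfold revolters profileOf contextCount
  congr 1
  ext v
  simp

/-- If all `χ` agents of a profile are willing to revolt where they do, then some equilibrium has
at least the same revolters: by single crossing, agents can be added as long as they want to join,
and a maximal extension is an equilibrium. -/
lemma exists_isEquilibrium_ge {P Q : Prior} (hQ : Q.Valid)
    (hPQ : ∀ w, worldProb (n := n) P w = worldProb Q w)
    (S : Fin n → Context → Prop) [∀ v c, Decidable (S v c)]
    (hν : ∀ v c, c.1 = .ν → ¬ S v c)
    (hχ : ∀ v c, c.1 = .χ → S v c → 0 ≤ advantage G P (profileOf S) v c) :
    ∃ σ, IsEquilibrium G P σ ∧ ∀ t, revolters G (profileOf S) t ⊆ revolters G σ t := by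
  classical
  have hW : ∀ w, 0 ≤ worldProb (n := n) P w := fun w => (hPQ w) ▸ worldProb_nonneg hQ w
  let occ : Finset (Fin n × Context) :=
    univ.image fun x : Fin n × (Fin n → AgentType) => (x.1, contextOf G x.2 x.1)
  have hocc : ∀ t v, (v, contextOf G t v) ∈ occ := fun t v => by
    simp only [occ, mem_image]; exact ⟨(v, t), by simp⟩
  let T : Finset (Fin n × Context) → Fin n → Context → Prop :=
    fun K v c => c.1 = .α ∨ (c.1 = .χ ∧ (v, c) ∈ K)
  obtain ⟨A, hA⟩ : ∃ A : Finset (Fin n × Context) → Fin n → Context → ℚ,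
      ∀ K v c, A K v c = advantage G P (profileOf (T K)) v c := ⟨_, fun _ _ _ => rfl⟩
  let good : Finset (Finset (Fin n × Context)) := occ.powerset.filter fun K =>
    (∀ x ∈ occ, S x.1 x.2 → x ∈ K) ∧
      ∀ x ∈ K, x.2.1 = .χ → 0 ≤ A K x.1 x.2
  have hne : good.Nonempty := by
    refine ⟨occ.filter fun x => S x.1 x.2, ?_⟩
    simp only [good, mem_filter, mem_powerset, filter_subset, true_and]
    refine ⟨fun x hx hS => ⟨hx, hS⟩, fun x hx hxχ => ?_⟩
    rw [hA]
    refine advantage_nonneg_mono G hQ hPQ (fun t v => ?_) (hχ x.1 x.2 hxχ hx.2)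
    simp only [profileOf, T, ite_eq_left_iff, mem_filter, hocc, true_and, reduceCtorEq, imp_false,
      not_not]
    intro hS
    rcases hc : (contextOf G t v).1 with _ | _ | _
    · exact Or.inl rfl
    · exact Or.inr ⟨rfl, hS⟩
    · exact absurd hS (hν _ _ hc)
  obtain ⟨K, hK, hmax⟩ := exists_max_image good card hne
  simp only [good, mem_filter, mem_powerset] at hK
  obtain ⟨hKocc, hSK, hsupp⟩ := hK
  refine ⟨profileOf (T K), (isEquilibrium_iff G P _).2 fun i c m => ?_, fun t v => ?_⟩
  · by_cases hic : (i, c) ∈ occ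
    swap
    · have hc' : ∀ t, contextOf G t i ≠ c := by
        rintro t rfl; exact hic (hocc t i)
      rw [contextPayoff_of_notMem G hc', contextPayoff_of_notMem G hc']
    rcases hc : c.1 with _ | _ | _
    · have hR : profileOf (T K) i c = .R := by simp [profileOf, T, hc]
      rw [hR]
      refine sum_le_sum fun w _ => mul_le_mul_of_nonneg_left ?_ (hW w)
      rw [hc]; cases m <;> simp [payoff]
    · have hsub := contextPayoff_sub G (P := P) (σ := profileOf (T K)) (i := i) hc
      by_cases hcK : (i, c) ∈ K
      · have hR : profileOf (T K) i c = .R := by simp [profileOf, T, hc, hcK]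
        have := hsupp _ hcK hc
        rw [hA] at this
        rw [hR]
        cases m
        · exact le_rfl
        · linarith
      · have hY : profileOf (T K) i c = .Y := by simp [profileOf, T, hc, hcK]
        rw [hY]
        cases m
        swap
        · exact le_rfl
        by_contra hlt
        have hadv : 0 ≤ A K i c := by rw [hA]; linarith
        have hmono : ∀ v c', 0 ≤ A K v c' → 0 ≤ A (insert (i, c) K) v c' := by
          intro v c'
          rw [hA, hA]
          refine advantage_nonneg_mono G hQ hPQ fun t u => ?_
          simp only [profileOf, T, ite_eq_left_iff, reduceCtorEq, imp_false, not_not, mem_insert]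
          tauto
        have := hmax (insert (i, c) K) (by
          simp only [good, mem_filter, mem_powerset, insert_subset_iff]
          refine ⟨⟨hic, hKocc⟩, fun x hx hS => mem_insert_of_mem (hSK x hx hS), fun x hx hxχ => ?_⟩
          rcases mem_insert.1 hx with rfl | hx
          · exact hmono _ _ hadv
          · exact hmono _ _ (hsupp x hx hxχ))
        rw [card_insert_of_notMem hcK] at this
        omega
    · have hY : profileOf (T K) i c = .Y := by simp [profileOf, T, hc]
      rw [hY]
      refine sum_le_sum fun w _ => mul_le_mul_of_nonneg_left ?_ (hW w)
      rw [hc]; cases m <;> simp [payoff]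
  · simp only [mem_revolters, profileOf, ite_eq_left_iff, reduceCtorEq, imp_false,
      not_not, T]
    intro hS
    rcases hc : (contextOf G t v).1 with _ | _ | _
    · exact Or.inl rfl
    · exact Or.inr ⟨rfl, hSK _ (hocc t v) hS⟩
    · exact absurd hS (hν _ _ hc)

end Equilibria

/-! ### Which revolts an equilibrium can support -/

section Thresholds

variable {n : ℕ}

lemma worldProb_withThresholds (P : Prior) (a b : ℚ) (w : WorldState × (Fin n → AgentType)) :
    worldProb (P.withThresholds a b) w = worldProb P w := rfl

lemma sub_le_payoff_sub_payoff (P : Prior) (hp : P.p ≤ 1) {x y : ℕ} (hyx : y ≤ x) :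
    (1 - P.p) - (if (y : ℚ) < P.μ * n then 1 else 0) ≤
      payoff P n x .χ .R - payoff P n y .χ .Y := by
  have hyx' : (y : ℚ) ≤ x := by exact_mod_cast hyx
  simp only [payoff]
  split_ifs <;> linarith

lemma payoff_sub_payoff_le_sub (P : Prior) (hp : 0 ≤ P.p) {x y : ℕ} (hyx : y ≤ x) :
    payoff P n x .χ .R - payoff P n y .χ .Y ≤ (if P.μ * n ≤ (x : ℚ) then 1 else 0) - P.p := by
  have hyx' : (y : ℚ) ≤ x := by exact_mod_cast hyx
  simp only [payoff]
  split_ifs <;> linarith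

variable (G : SimpleGraph (Fin n)) [DecidableRel G.Adj]

/-- The joint probability of the state `s` and the context `c` of agent `i`. -/
def contextProb (P : Prior) (s : WorldState) (i : Fin n) (c : Context) : ℚ :=
  ∑ t with contextOf G t i = c, worldProb P (s, t)

lemma contextProb_nonneg {P : Prior} (hP : P.Valid) (s : WorldState) (i : Fin n) (c : Context) :
    0 ≤ contextProb G P s i c := sum_nonneg fun _ _ => worldProb_nonneg hP _

lemma contextProb_eq (P : Prior) (s : WorldState) (i : Fin n) (c : Context) :
    contextProb G P s i c = P.stateProb s * ∑ t with contextOf G t i = c, typesProb P s t := by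
  rw [contextProb, mul_sum]; rfl

lemma posteriorA_eq (P : Prior) (i : Fin n) (c : Context) :
    posteriorA G P i c = contextProb G P .A i c / ∑ s, contextProb G P s i c := by
  unfold posteriorA
  rw [sum_filter_world, sum_filter_world, sum_worldState]
  simp [contextProb]

/-- A lower bound for the advantage of revolting, in terms of the probability that the revolt
succeeds without agent `i`. -/
lemma sub_le_advantage {P : Prior} (hP : P.Valid) {p' μ' : ℚ} (hp : p' ≤ 1)
    (σ : Fin n → Strategy) (i : Fin n) (c : Context) :
    (1 - p') * ∑ s, contextProb G P s i c -
        ∑ s, ∑ t with contextOf G t i = c ∧ (#(revolters G (forced σ i .Y) t) : ℚ) < μ' * n,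
          worldProb P (s, t) ≤
      advantage G (P.withThresholds p' μ') σ i c := by
  unfold advantage contextProb
  rw [sum_filter_world, mul_sum, ← sum_sub_distrib]
  refine sum_le_sum fun s _ => ?_
  rw [mul_sum, ← filter_filter, sum_filter _ (fun t => worldProb P (s, t)), ← sum_sub_distrib]
  refine sum_le_sum fun t _ => ?_
  have hW := worldProb_nonneg hP (s, t)
  have hYR : (#(revolters G (forced σ i .Y) t) : ℚ) ≤ #(revolters G (forced σ i .R) t) := by
    exact_mod_cast card_le_card (revolters_forced_Y_subset G σ i t)
  rw [worldProb_withThresholds]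
  have key := mul_le_mul_of_nonneg_left
    (sub_le_payoff_sub_payoff (n := n) (P.withThresholds p' μ') hp (by exact_mod_cast hYR)) hW
  simp only [Prior.withThresholds] at key ⊢
  split_ifs at key ⊢ with h1 <;> simp only [h1, if_true, if_false] at key <;> linarith

/-- An upper bound for the advantage of revolting, in terms of the probability that the revolt
succeeds with agent `i`. -/
lemma advantage_le_sub {P : Prior} (hP : P.Valid) {p' μ' : ℚ} (hp : 0 ≤ p')
    (σ : Fin n → Strategy) (i : Fin n) (c : Context) :
    advantage G (P.withThresholds p' μ') σ i c ≤
      (∑ s, ∑ t with contextOf G t i = c ∧ μ' * n ≤ (#(revolters G (forced σ i .R) t) : ℚ),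
          worldProb P (s, t)) - p' * ∑ s, contextProb G P s i c := by
  unfold advantage contextProb
  rw [sum_filter_world, mul_sum, ← sum_sub_distrib]
  refine sum_le_sum fun s _ => ?_
  rw [mul_sum, ← filter_filter, sum_filter _ (fun t => worldProb P (s, t)), ← sum_sub_distrib]
  refine sum_le_sum fun t _ => ?_
  have hW := worldProb_nonneg hP (s, t)
  have hYR : (#(revolters G (forced σ i .Y) t) : ℚ) ≤ #(revolters G (forced σ i .R) t) := by
    exact_mod_cast card_le_card (revolters_forced_Y_subset G σ i t)
  rw [worldProb_withThresholds]
  have key := mul_le_mul_of_nonneg_left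
    (payoff_sub_payoff_le_sub (n := n) (P.withThresholds p' μ') hp (by exact_mod_cast hYR)) hW
  simp only [Prior.withThresholds] at key ⊢
  split_ifs at key ⊢ with h1 <;> simp only [h1, if_true, if_false] at key <;> linarith

/-- Almost surely, the revolters are among the agents described by `S`. -/
def RevoltersWithin (P : Prior) (σ : Fin n → Strategy) (S : Fin n → Context → Prop) : Prop :=
  ∀ s t v, worldProb P (s, t) ≠ 0 → σ v (contextOf G t v) = .R → S v (contextOf G t v)

variable {G}

lemma RevoltersWithin.card_le {P : Prior} {σ : Fin n → Strategy} {S : Fin n → Context → Prop}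
    [∀ v c, Decidable (S v c)] (h : RevoltersWithin G P σ S) {s : WorldState}
    {t : Fin n → AgentType} (hw : worldProb P (s, t) ≠ 0) :
    #(revolters G σ t) ≤ contextCount G S t := by
  refine card_le_card fun v hv => ?_
  simp only [mem_filter_univ]
  exact h s t v hw ((mem_revolters G).1 hv)

lemma sum_filter_worldProb_le {P : Prior} (hP : P.Valid) {s : WorldState}
    {Q R : (Fin n → AgentType) → Prop} [DecidablePred Q] [DecidablePred R]
    (h : ∀ t, worldProb P (s, t) ≠ 0 → Q t → R t) :
    ∑ t with Q t, worldProb P (s, t) ≤ P.stateProb s * ∑ t with R t, typesProb P s t := by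
  have e : P.stateProb s * ∑ t with R t, typesProb P s t = ∑ t with R t, worldProb P (s, t) := by
    rw [mul_sum]; rfl
  rw [e, sum_filter, sum_filter]
  refine sum_le_sum fun t _ => ?_
  have hW := worldProb_nonneg hP (s, t)
  by_cases h0 : worldProb P (s, t) = 0
  · simp [h0]
  · split_ifs with h1 h2
    · exact le_rfl
    · exact absurd (h t h0 h1) h2
    · exact hW
    · exact le_rfl

/-- If the revolters are among agents described by `S` of whom too few are expected in state `s`,
then, conditional on any context, the revolt hardly ever succeeds in state `s`. -/
lemma success_le {P : Prior} (hP : P.Valid) {ε η : ℚ} (hc : Concentrated G P ε η)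
    {σ : Fin n → Strategy} {S : Fin n → Context → Prop} [∀ v c, Decidable (S v c)]
    (hS : RevoltersWithin G P σ S) {s : WorldState} {μ' : ℚ}
    (hμ : expectedFraction G P s S + ε ≤ μ') (i : Fin n) (c : Context) :
    ∑ t with contextOf G t i = c ∧ μ' * n ≤ (#(revolters G (forced σ i .R) t) : ℚ),
      worldProb P (s, t) ≤ η * contextProb G P s i c := by
  have h1 := sum_filter_worldProb_le hP (s := s)
    (Q := fun t => contextOf G t i = c ∧ μ' * n ≤ (#(revolters G (forced σ i .R) t) : ℚ))
    (R := fun t => contextOf G t i = c ∧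
      (expectedFraction G P s S + ε) * n ≤ contextCount G S t + 1) (by
      rintro t hw ⟨hct, hr⟩
      refine ⟨hct, ?_⟩
      have h2 : #(revolters G (forced σ i .R) t) ≤ contextCount G S t + 1 :=
        (card_le_card (revolters_forced_R_subset G σ i t)).trans
          ((card_insert_le _ _).trans (Nat.add_le_add_right (hS.card_le hw) 1))
      have h3 : (#(revolters G (forced σ i .R) t) : ℚ) ≤ contextCount G S t + 1 := by
        exact_mod_cast h2
      have h4 := mul_le_mul_of_nonneg_right hμ (Nat.cast_nonneg (α := ℚ) n)
      linarith)
  refine h1.trans ?_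
  rw [contextProb_eq, mul_left_comm]
  exact mul_le_mul_of_nonneg_left (hc.upper_cond S s i c) (hP.stateProb_nonneg s)

lemma success_le_contextProb {P : Prior} (hP : P.Valid) (Q : (Fin n → AgentType) → Prop)
    [DecidablePred Q] (s : WorldState) (i : Fin n) (c : Context) :
    ∑ t with contextOf G t i = c ∧ Q t, worldProb P (s, t) ≤ contextProb G P s i c :=
  sum_le_sum_of_subset_of_nonneg (fun t => by simp +contextual) fun _ _ _ => worldProb_nonneg hP _

/-- Conversely, if all agents described by `S` revolt and enough of them are expected in
state `s`, then, conditional on any context, the revolt hardly ever fails in state `s`. -/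
lemma failure_le {P : Prior} (hP : P.Valid) {ε η : ℚ} (hc : Concentrated G P ε η)
    {S : Fin n → Context → Prop} [∀ v c, Decidable (S v c)] {s : WorldState} {μ' : ℚ}
    (hμ : μ' + ε ≤ expectedFraction G P s S) (i : Fin n) (c : Context) :
    ∑ t with contextOf G t i = c ∧
        (#(revolters G (forced (profileOf S) i .Y) t) : ℚ) < μ' * n, worldProb P (s, t) ≤
      η * contextProb G P s i c := by
  have h1 := sum_filter_worldProb_le hP (s := s)
    (Q := fun t => contextOf G t i = c ∧
        (#(revolters G (forced (profileOf S) i .Y) t) : ℚ) < μ' * n)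
    (R := fun t => contextOf G t i = c ∧
      (contextCount G S t : ℚ) ≤ (expectedFraction G P s S - ε) * n + 1) (by
      rintro t hw ⟨hct, hr⟩
      refine ⟨hct, ?_⟩
      have h2 : contextCount G S t ≤ #(revolters G (forced (profileOf S) i .Y) t) + 1 := by
        rw [← card_revolters_profileOf]
        exact (card_le_card (revolters_subset_forced_Y G (profileOf S) i t)).trans
          (card_insert_le _ _)
      have h3 : (contextCount G S t : ℚ) ≤ #(revolters G (forced (profileOf S) i .Y) t) + 1 := by
        exact_mod_cast h2
      have h4 := mul_le_mul_of_nonneg_right hμ (Nat.cast_nonneg (α := ℚ) n)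
      linarith)
  refine h1.trans ?_
  rw [contextProb_eq, mul_left_comm]
  exact mul_le_mul_of_nonneg_left (hc.lower_cond S s i c) (hP.stateProb_nonneg s)

/-- In equilibrium, agents of type `χ` who revolt are not worse off by doing so, and no agent of
type `ν` revolts. -/
lemma IsEquilibrium.revolters_cases {P Q : Prior} (hQ : Q.Valid)
    (hPQ : ∀ w, worldProb (n := n) P w = worldProb Q w) {σ : Fin n → Strategy}
    (hσ : IsEquilibrium G P σ) {s : WorldState} {t : Fin n → AgentType} {v : Fin n}
    (hw : worldProb Q (s, t) ≠ 0) (hR : σ v (contextOf G t v) = .R) :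
    t v = .α ∨ (t v = .χ ∧ 0 ≤ advantage G P σ v (contextOf G t v)) := by
  have hW : ∀ w, 0 ≤ worldProb (n := n) P w := fun w => (hPQ w) ▸ worldProb_nonneg hQ w
  have h := (isEquilibrium_iff G P σ).1 hσ v (contextOf G t v) .Y
  rw [hR] at h
  rcases ht : t v with _ | _ | _
  · exact Or.inl rfl
  · refine Or.inr ⟨rfl, ?_⟩
    rw [← contextPayoff_sub G (by exact ht)]
    linarith
  · exfalso
    have hc : (contextOf G t v).1 = .ν := ht
    have h1 : contextPayoff G P σ v (contextOf G t v) .R = 0 :=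
      sum_eq_zero fun w _ => by rw [hc]; simp [payoff]
    have h2 : worldProb P (s, t) ≤ contextPayoff G P σ v (contextOf G t v) .Y := by
      unfold contextPayoff
      rw [hc]
      simp only [payoff, mul_one]
      exact single_le_sum (f := fun w => worldProb P w) (fun w _ => hW w) (by simp)
    have h3 := (hW (s, t)).lt_of_ne (by rw [hPQ]; exact hw.symm)
    linarith

lemma IsEquilibrium.revoltersWithin_χα {P : Prior} (hP : P.Valid) {p' μ' : ℚ}
    {σ : Fin n → Strategy} (hσ : IsEquilibrium G (P.withThresholds p' μ') σ) :
    RevoltersWithin G P σ fun _ c => c.1 = .χ ∨ c.1 = .α := by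
  intro s t v hw hR
  rcases hσ.revolters_cases hP (worldProb_withThresholds P p' μ') hw hR with h | ⟨h, -⟩
  · exact Or.inr h
  · exact Or.inl h

lemma contextProb_pos {P : Prior} (hP : P.Valid) {s : WorldState} {t : Fin n → AgentType}
    (hw : worldProb P (s, t) ≠ 0) (v : Fin n) :
    0 < ∑ s, contextProb G P s v (contextOf G t v) := by
  refine sum_pos' (fun s _ => contextProb_nonneg G hP s v _) ⟨s, mem_univ _, ?_⟩
  refine ((worldProb_nonneg hP (s, t)).lt_of_ne hw.symm).trans_le ?_
  exact single_le_sum (f := fun t => worldProb P (s, t)) (fun t _ => worldProb_nonneg hP _)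
    (by simp)

/-- If the revolters of an equilibrium are among agents described by `S`, too few in either state
for a successful revolt, then only agents of type `α` revolt. -/
lemma IsEquilibrium.revoltersWithin_α {P : Prior} (hP : P.Valid) {ε η p' μ' : ℚ}
    (hc : Concentrated G P ε η) (hp : 0 ≤ p') (hη : η < p') {σ : Fin n → Strategy}
    (hσ : IsEquilibrium G (P.withThresholds p' μ') σ) {S : Fin n → Context → Prop}
    [∀ v c, Decidable (S v c)] (hS : RevoltersWithin G P σ S)
    (hμ : ∀ s, expectedFraction G P s S + ε ≤ μ') :
    RevoltersWithin G P σ fun _ c => c.1 = .α := by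
  intro s t v hw hR
  refine (hσ.revolters_cases hP (worldProb_withThresholds P p' μ') hw hR).resolve_right ?_
  rintro ⟨-, hadv⟩
  have h1 := hadv.trans (advantage_le_sub G hP hp σ v (contextOf G t v))
  have h2 := sum_le_sum fun s (_ : s ∈ (univ : Finset WorldState)) =>
    success_le hP hc hS (hμ s) v (contextOf G t v)
  rw [← mul_sum] at h2
  have h3 := mul_lt_mul_of_pos_right hη (contextProb_pos (G := G) hP hw v)
  linarith

/-- If too few agents are of type `χ` or `α` in state `B` for a successful revolt, then the
revolters of an equilibrium of type `χ` are confident that the state is `A`. -/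
lemma IsEquilibrium.revoltersWithin_cand {P : Prior} (hP : P.Valid) {ε η a p' μ' : ℚ}
    (hc : Concentrated G P ε η) (hp : 0 ≤ p') (hη0 : 0 ≤ η) (hη : a + η ≤ p')
    {σ : Fin n → Strategy}
    (hσ : IsEquilibrium G (P.withThresholds p' μ') σ)
    (hμ : fracχα G P .B + ε ≤ μ') :
    RevoltersWithin G P σ fun v c => (c.1 = .χ ∧ a ≤ posteriorA G P v c) ∨ c.1 = .α := by
  intro s t v hw hR
  rcases hσ.revolters_cases hP (worldProb_withThresholds P p' μ') hw hR with h | ⟨hχ, hadv⟩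
  · exact Or.inr h
  refine Or.inl ⟨hχ, ?_⟩
  have hpos := contextProb_pos (G := G) hP hw v
  rw [posteriorA_eq, le_div_iff₀ hpos]
  have h1 := hadv.trans (advantage_le_sub G hP hp σ v (contextOf G t v))
  have h2 := success_le hP hc (hσ.revoltersWithin_χα hP) hμ v (contextOf G t v)
  have h3 := success_le_contextProb (G := G) hP
    (fun t => μ' * n ≤ (#(revolters G (forced σ v .R) t) : ℚ)) .A v (contextOf G t v)
  have h4 := mul_le_mul_of_nonneg_right hη hpos.le
  have h5 := mul_nonneg hη0 (contextProb_nonneg G hP .A v (contextOf G t v))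
  rw [sum_worldState, sum_worldState] at *
  linarith

end Thresholds

/-! ### The first algorithm bounds the revolts in equilibria -/

section Supported

variable {n : ℕ}

lemma univ_agentType : (univ : Finset AgentType) = {.α, .χ, .ν} := rfl

lemma sum_agentType {M : Type*} [AddCommMonoid M] (f : AgentType → M) :
    ∑ a, f a = f .α + f .χ + f .ν := by
  rw [univ_agentType, sum_insert (by decide), sum_pair (by decide), add_assoc]

/-- The marginal distribution of the type of one agent. -/
lemma sum_typesProb_mul_ite {P : Prior} (hP : P.Valid) (s : WorldState) (v : Fin n)
    (q : AgentType → Prop) [DecidablePred q] :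
    ∑ t : Fin n → AgentType, typesProb P s t * (if q (t v) then 1 else 0) =
      ∑ a, if q a then P.typeDist s a else 0 := by
  have h : ∀ t : Fin n → AgentType, typesProb P s t * (if q (t v) then 1 else 0) =
      ∏ u, (if u = v then (if q (t u) then P.typeDist s (t u) else 0) else P.typeDist s (t u)) := by
    intro t
    unfold typesProb
    rw [← mul_prod_erase univ _ (mem_univ v),
      ← mul_prod_erase univ (fun u => if u = v then _ else _) (mem_univ v), if_pos rfl]
    rw [prod_congr rfl fun u hu => if_neg (ne_of_mem_erase hu)]
    split_ifs <;> ring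
  simp_rw [h]
  rw [← Fintype.piFinset_univ, ← Finset.prod_univ_sum (fun _ => univ)
    fun u a => (if u = v then (if q a then P.typeDist s a else 0) else P.typeDist s a)]
  rw [← mul_prod_erase univ _ (mem_univ v)]
  simp only [if_true]
  rw [prod_congr rfl fun u hu => ?_, prod_const_one, mul_one]
  simp only [if_neg (ne_of_mem_erase hu), hP.typeDist_sum s]

variable (G : SimpleGraph (Fin n)) [DecidableRel G.Adj]

lemma sum_mul_card_eq {P : Prior} (s : WorldState) (S : Fin n → Context → Prop)
    [∀ v c, Decidable (S v c)] :
    ∑ t : Fin n → AgentType, typesProb P s t * (#{v | S v (contextOf G t v)} : ℚ) =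
      ∑ v, ∑ t : Fin n → AgentType, typesProb P s t * if S v (contextOf G t v) then 1 else 0 := by
  rw [sum_comm]
  refine sum_congr rfl fun t _ => ?_
  rw [← mul_sum, sum_boole]

lemma expectedFraction_type {P : Prior} (hP : P.Valid) (s : WorldState) (q : AgentType → Prop)
    [DecidablePred q] :
    expectedFraction G P s (fun _ c => q c.1) =
      n * (∑ a, if q a then P.typeDist s a else 0) / n := by
  rw [expectedFraction, sum_mul_card_eq G s fun _ c => q c.1]
  congr 1
  refine (sum_congr rfl fun v _ => sum_typesProb_mul_ite hP s v q).trans ?_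
  rw [sum_const, card_univ, Fintype.card_fin, nsmul_eq_mul]

lemma fracα_eq {P : Prior} (hP : P.Valid) (s : WorldState) :
    fracα G P s = n * P.typeDist s .α / n := by
  rw [fracα, expectedFraction_type G hP (q := fun a => a = .α), sum_agentType]; simp

lemma fracχα_eq {P : Prior} (hP : P.Valid) (s : WorldState) :
    fracχα G P s = n * (P.typeDist s .α + P.typeDist s .χ) / n := by
  rw [fracχα, expectedFraction_type G hP (q := fun a => a = .χ ∨ a = .α), sum_agentType]; simp

lemma fracχα_B_le {P : Prior} (hP : P.Valid) : fracχα G P .B ≤ fracχα G P .A := by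
  rw [fracχα_eq G hP, fracχα_eq G hP]
  have hA := hP.typeDist_sum .A
  have hB := hP.typeDist_sum .B
  have := hP.ν_lt
  rw [sum_agentType] at hA hB
  gcongr ?_ / _
  exact mul_le_mul_of_nonneg_left (by linarith) (Nat.cast_nonneg n)

lemma alg1_withThresholds (P : Prior) (a b : ℚ) : alg1 G (P.withThresholds a b) =
    if fracχα G P .A < b ∧ fracχα G P .B < b then (fracα G P .A, fracα G P .B)
    else if b ≤ fracχα G P .A ∧ b ≤ fracχα G P .B then (fracχα G P .A, fracχα G P .B)
    else if b ≤ fracCandα G (P.withThresholds a b) .A then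
      (fracCandα G (P.withThresholds a b) .A, fracCandα G (P.withThresholds a b) .B)
    else (fracα G P .A, fracα G P .B) := rfl

/-- The component of a pair `(X_A, X_B)` for a state. -/
def stateComponent (X : ℚ × ℚ) : WorldState → ℚ
  | .A => X.1
  | .B => X.2

/-- The pair that the first algorithm computes is an upper bound for the revolts in every
equilibrium of a game with slightly higher thresholds. -/
lemma IsEquilibrium.sum_worldProb_ge_le {P : Prior} (hP : P.Valid) {ε η a b p' μ' : ℚ}
    (hc : Concentrated G P ε η) (hp : 0 ≤ p') (hη0 : 0 ≤ η) (hη : η < p') (ha : a + η ≤ p')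
    (hb : b + ε ≤ μ') {σ : Fin n → Strategy}
    (hσ : IsEquilibrium G (P.withThresholds p' μ') σ) (s : WorldState) :
    ∑ t with (stateComponent (alg1 G (P.withThresholds a b)) s + ε) * n ≤ #(revolters G σ t),
      worldProb P (s, t) ≤ η * P.stateProb s := by
  have main : ∀ (S : Fin n → Context → Prop) [∀ v c, Decidable (S v c)],
      RevoltersWithin G P σ S →
      (∀ s, stateComponent (alg1 G (P.withThresholds a b)) s = expectedFraction G P s S) →
      ∑ t with (stateComponent (alg1 G (P.withThresholds a b)) s + ε) * n ≤ #(revolters G σ t),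
        worldProb P (s, t) ≤ η * P.stateProb s := by
    intro S _ hS hX
    rw [hX]
    have h1 := sum_filter_worldProb_le hP (s := s)
      (Q := fun t => (expectedFraction G P s S + ε) * n ≤ #(revolters G σ t))
      (R := fun t => (expectedFraction G P s S + ε) * n ≤ contextCount G S t + 1)
      fun t hw h => by
        have : (#(revolters G σ t) : ℚ) ≤ contextCount G S t := by exact_mod_cast hS.card_le hw
        linarith
    refine h1.trans ?_
    rw [mul_comm η]
    exact mul_le_mul_of_nonneg_left (hc.upper S s) (hP.stateProb_nonneg s)
  have hχα := hσ.revoltersWithin_χα hP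
  by_cases h1 : fracχα G P .A < b ∧ fracχα G P .B < b
  · refine main (fun _ c => c.1 = .α)
      (hσ.revoltersWithin_α hP hc hp hη hχα fun s => ?_) fun s => ?_
    · have h2 : fracχα G P s < b := by cases s; exacts [h1.1, h1.2]
      exact (add_le_add_left h2.le ε).trans hb
    · rw [alg1_withThresholds, if_pos h1]; cases s <;> rfl
  by_cases h2 : b ≤ fracχα G P .A ∧ b ≤ fracχα G P .B
  · refine main _ hχα fun s => ?_
    rw [alg1_withThresholds, if_neg h1, if_pos h2]; cases s <;> rfl
  have hB : fracχα G P .B < b := by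
    by_contra hB
    exact h2 ⟨(not_lt.1 hB).trans (fracχα_B_le G hP), not_lt.1 hB⟩
  have hcand := hσ.revoltersWithin_cand hP hc hp hη0 ha ((add_le_add_left hB.le ε).trans hb)
  by_cases h3 : b ≤ fracCandα G (P.withThresholds a b) .A
  · refine main _ hcand fun s => ?_
    rw [alg1_withThresholds, if_neg h1, if_neg h2, if_pos h3]; cases s <;> rfl
  · refine main (fun _ c => c.1 = .α)
      (hσ.revoltersWithin_α hP hc hp hη hcand fun s => ?_) fun s => ?_
    · cases s
      · exact (add_le_add_left (not_le.1 h3).le ε).trans hb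
      · refine (add_le_add_left ?_ ε).trans ((add_le_add_left hB.le ε).trans hb)
        unfold fracχα expectedFraction
        refine div_le_div_of_nonneg_right (sum_le_sum fun t _ =>
          mul_le_mul_of_nonneg_left ?_ (typesProb_nonneg hP _ _)) (Nat.cast_nonneg n)
        rw [Nat.cast_le]
        refine card_le_card fun v => ?_
        simp only [mem_filter_univ]
        tauto
    · rw [alg1_withThresholds, if_neg h1, if_neg h2, if_neg h3]; cases s <;> rfl

/-- The pair that the first algorithm computes is a lower bound for the revolts in some
equilibrium of a game with slightly lower thresholds. -/
lemma exists_isEquilibrium_sum_worldProb_lt_le {P : Prior} (hP : P.Valid) {ε η a b p' μ' : ℚ}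
    (hc : Concentrated G P ε η) (hη0 : 0 ≤ η) (hη : η ≤ 1 - p') (ha : p' + η ≤ a)
    (hb : μ' + ε ≤ b) :
    ∃ σ, IsEquilibrium G (P.withThresholds p' μ') σ ∧ ∀ s,
      ∑ t with (#(revolters G σ t) : ℚ) <
          (stateComponent (alg1 G (P.withThresholds a b)) s - ε) * n, worldProb P (s, t) ≤
        η * P.stateProb s := by
  have hp1 : p' ≤ 1 := by linarith
  have main : ∀ (S : Fin n → Context → Prop) [∀ v c, Decidable (S v c)],
      (∀ v c, c.1 = .ν → ¬ S v c) →
      (∀ v c, c.1 = .χ → S v c → ∑ s, ∑ t with contextOf G t v = c ∧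
        (#(revolters G (forced (profileOf S) v .Y) t) : ℚ) < μ' * n, worldProb P (s, t) ≤
          (1 - p') * ∑ s, contextProb G P s v c) →
      (∀ s, stateComponent (alg1 G (P.withThresholds a b)) s = expectedFraction G P s S) →
      ∃ σ, IsEquilibrium G (P.withThresholds p' μ') σ ∧ ∀ s,
        ∑ t with (#(revolters G σ t) : ℚ) <
          (stateComponent (alg1 G (P.withThresholds a b)) s - ε) * n, worldProb P (s, t) ≤
        η * P.stateProb s := by
    intro S _ hν hS hX
    obtain ⟨σ, hσ, hle⟩ := exists_isEquilibrium_ge G hP (worldProb_withThresholds P p' μ') S hν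
      fun v c hχ hvc => (sub_nonneg.2 (hS v c hχ hvc)).trans
        (sub_le_advantage G hP hp1 (profileOf S) v c)
    refine ⟨σ, hσ, fun s => ?_⟩
    rw [hX]
    have h1 := sum_filter_worldProb_le hP (s := s)
      (Q := fun t => (#(revolters G σ t) : ℚ) < (expectedFraction G P s S - ε) * n)
      (R := fun t => (contextCount G S t : ℚ) ≤ (expectedFraction G P s S - ε) * n + 1)
      fun t _ h => by
        have : (contextCount G S t : ℚ) ≤ #(revolters G σ t) := by
          rw [← card_revolters_profileOf]; exact_mod_cast card_le_card (hle t)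
        linarith
    refine h1.trans ?_
    rw [mul_comm η]
    exact mul_le_mul_of_nonneg_left (hc.lower S s) (hP.stateProb_nonneg s)
  have hα := main (fun _ c => c.1 = .α) (fun v c h => by simp [h])
    (fun v c h h' => by rw [h] at h'; cases h')
  by_cases h1 : fracχα G P .A < b ∧ fracχα G P .B < b
  · refine hα fun s => ?_
    rw [alg1_withThresholds, if_pos h1]; cases s <;> rfl
  by_cases h2 : b ≤ fracχα G P .A ∧ b ≤ fracχα G P .B
  · refine main (fun _ c => c.1 = .χ ∨ c.1 = .α) (fun v c h => by simp [h])
      (fun v c _ _ => ?_) fun s => ?_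
    · have h3 := sum_le_sum fun s (_ : s ∈ (univ : Finset WorldState)) =>
        failure_le hP hc (S := fun _ c => c.1 = .χ ∨ c.1 = .α) (s := s) (μ' := μ')
          (by cases s; exacts [hb.trans h2.1, hb.trans h2.2]) v c
      rw [← mul_sum] at h3
      exact h3.trans (mul_le_mul_of_nonneg_right hη
        (sum_nonneg fun s _ => contextProb_nonneg G hP s v c))
    · rw [alg1_withThresholds, if_neg h1, if_pos h2]; cases s <;> rfl
  by_cases h3 : b ≤ fracCandα G (P.withThresholds a b) .A
  · refine main (fun v c => (c.1 = .χ ∧ a ≤ posteriorA G P v c) ∨ c.1 = .α)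
      (fun v c h => by simp [h]) (fun v c hχ hvc => ?_) fun s => ?_
    · have hpost : a ≤ posteriorA G P v c := by
        rcases hvc with h | h
        · exact h.2
        · rw [hχ] at h; cases h
      have h4 := failure_le hP hc (S := fun v c => (c.1 = .χ ∧ a ≤ posteriorA G P v c) ∨ c.1 = .α)
        (s := .A) (μ' := μ') (hb.trans h3) v c
      have h5 := success_le_contextProb (G := G) hP
        (fun t => (#(revolters G (forced (profileOf fun v c =>
          (c.1 = .χ ∧ a ≤ posteriorA G P v c) ∨ c.1 = .α) v .Y) t) : ℚ) < μ' * n) .B v c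
      have hA := contextProb_nonneg G hP .A v c
      have hB := contextProb_nonneg G hP .B v c
      have h6 : a * ∑ s, contextProb G P s v c ≤ contextProb G P .A v c := by
        rw [posteriorA_eq] at hpost
        rcases (sum_nonneg fun s (_ : s ∈ (univ : Finset WorldState)) =>
          contextProb_nonneg G hP s v c).eq_or_lt with h0 | h0
        · rw [← h0]; linarith
        · exact (le_div_iff₀ h0).1 hpost
      have h7 := mul_le_mul_of_nonneg_right ha (add_nonneg hA hB)
      have h8 := mul_nonneg hη0 hB
      rw [sum_worldState] at h6
      rw [sum_worldState, sum_worldState]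
      linarith
    · rw [alg1_withThresholds, if_neg h1, if_neg h2, if_pos h3]; cases s <;> rfl
  · refine hα fun s => ?_
    rw [alg1_withThresholds, if_neg h1, if_neg h2, if_neg h3]; cases s <;> rfl

end Supported

/-! ### The first algorithm in terms of degrees -/

/-- The multiset of `i` types `α`, `j` types `χ` and `l` types `ν`. -/
def typeMultiset (i j l : ℕ) : Multiset AgentType :=
  i • {AgentType.α} + j • {AgentType.χ} + l • {AgentType.ν}

lemma typeMultiset_inj {i j l i' j' l' : ℕ} :
    typeMultiset i j l = typeMultiset i' j' l' ↔ i = i' ∧ j = j' ∧ l = l' := by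
  refine ⟨fun h => ?_, by rintro ⟨rfl, rfl, rfl⟩; rfl⟩
  have h1 := congrArg (Multiset.count AgentType.α) h
  have h2 := congrArg (Multiset.count AgentType.χ) h
  have h3 := congrArg (Multiset.count AgentType.ν) h
  simp [typeMultiset] at h1 h2 h3
  exact ⟨h1, h2, h3⟩

/-- The probability that `k` independent types with distribution `q` are `i` times `α`, `j` times
`χ` and otherwise `ν`. -/
def trinomialProb (q : AgentType → ℚ) (k i j : ℕ) : ℚ :=
  k.choose i * (k - i).choose j * (q .α ^ i * q .χ ^ j * q .ν ^ (k - i - j))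

section Degrees

variable {n : ℕ}

/-- The linear functional on formal combinations of multisets that extends `F`. -/
noncomputable def evalFunctional (F : Multiset AgentType → ℚ) :
    AddMonoidAlgebra ℚ (Multiset AgentType) →+ ℚ :=
  (Finsupp.liftAddHom fun m => AddMonoidHom.mulRight (F m)).comp
    AddMonoidAlgebra.coeffAddEquiv.toAddMonoidHom

lemma evalFunctional_single (F : Multiset AgentType → ℚ) (m : Multiset AgentType) (r : ℚ) :
    evalFunctional F (AddMonoidAlgebra.single m r) = r * F m := by
  simp [evalFunctional]

lemma sum_single_pow (q : AgentType → ℚ) (k : ℕ) :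
    (∑ a, AddMonoidAlgebra.single ({a} : Multiset AgentType) (q a)) ^ k =
      ∑ i ∈ range (k + 1), ∑ j ∈ range (k - i + 1),
        AddMonoidAlgebra.single (typeMultiset i j (k - i - j)) (trinomialProb q k i j) := by
  rw [sum_agentType, add_assoc, add_pow]
  refine sum_congr rfl fun i _ => ?_
  rw [add_pow, mul_sum, sum_mul]
  refine sum_congr rfl fun j _ => ?_
  simp only [AddMonoidAlgebra.single_pow, AddMonoidAlgebra.natCast_def,
    AddMonoidAlgebra.single_mul_single, trinomialProb, typeMultiset]
  congr 1
  · simp only [add_zero, add_assoc]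
  · ring

/-- The generating function of the neighborhood of `v`: the formal sum of the multisets of the
types of the neighbors, weighted with their probabilities, is a power by independence. -/
lemma sum_typesProb_mul_neighborhood (G : SimpleGraph (Fin n)) [DecidableRel G.Adj] {P : Prior}
    (hP : P.Valid) (s : WorldState) (v : Fin n) (F : Multiset AgentType → ℚ) :
    ∑ t : Fin n → AgentType, typesProb P s t *
        (if t v = .χ then F ((G.neighborFinset v).val.map t) else 0) =
      ∑ i ∈ range (G.degree v + 1), ∑ j ∈ range (G.degree v - i + 1),
        P.typeDist s .χ * trinomialProb (P.typeDist s) (G.degree v) i j *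
          F (typeMultiset i j (G.degree v - i - j)) := by
  let m : Fin n → AgentType → Multiset AgentType := fun u a =>
    if u ∈ G.neighborFinset v then {a} else 0
  let r : Fin n → AgentType → ℚ := fun u a =>
    if u = v then (if a = .χ then P.typeDist s a else 0) else P.typeDist s a
  have hm : ∀ t : Fin n → AgentType, ∑ u, m u (t u) = (G.neighborFinset v).val.map t := by
    intro t
    simp only [m, sum_ite_mem, univ_inter]
    have h := Multiset.sum_map_singleton ((G.neighborFinset v).val.map t)
    rw [Multiset.map_map] at h
    exact h
  have hr : ∀ t : Fin n → AgentType, ∏ u, r u (t u) =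
      typesProb P s t * if t v = .χ then 1 else 0 := by
    intro t
    unfold typesProb
    rw [← mul_prod_erase univ _ (mem_univ v),
      ← mul_prod_erase univ (fun u => P.typeDist s (t u)) (mem_univ v),
      prod_congr rfl fun u hu => if_neg (ne_of_mem_erase hu)]
    simp only [r, if_true]
    split_ifs <;> ring
  have key : ∑ t : Fin n → AgentType,
      AddMonoidAlgebra.single ((G.neighborFinset v).val.map t)
        (typesProb P s t * if t v = .χ then 1 else 0) =
      AddMonoidAlgebra.single 0 (P.typeDist s .χ) *
        (∑ a, AddMonoidAlgebra.single ({a} : Multiset AgentType) (P.typeDist s a)) ^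
          G.degree v := by
    calc _ = ∑ t : Fin n → AgentType, ∏ u, AddMonoidAlgebra.single (m u (t u)) (r u (t u)) := by
          refine sum_congr rfl fun t _ => ?_
          rw [AddMonoidAlgebra.prod_single, hm, hr]
      _ = ∏ u, ∑ a, AddMonoidAlgebra.single (m u a) (r u a) := by
          rw [Finset.prod_univ_sum, Fintype.piFinset_univ]
      _ = _ := by
          have hv : ∀ u ∈ G.neighborFinset v, u ≠ v := by
            rintro u hu rfl; simp at hu
          rw [← mul_prod_erase univ _ (mem_univ v)]
          congr 1
          · simp [m, r, sum_agentType]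
          · rw [← prod_subset (s₁ := G.neighborFinset v)
              (fun u hu => mem_erase.2 ⟨hv u hu, mem_univ u⟩)]
            · rw [← SimpleGraph.card_neighborFinset_eq_degree, ← prod_const]
              refine prod_congr rfl fun u hu => sum_congr rfl fun a _ => ?_
              simp only [m, r, if_pos hu, if_neg (hv u hu)]
            · intro u hu hu'
              simp only [m, r, if_neg hu', if_neg (ne_of_mem_erase hu)]
              have h := hP.typeDist_sum s
              rw [sum_agentType] at h ⊢
              rw [← AddMonoidAlgebra.single_add, ← AddMonoidAlgebra.single_add, h]
              rfl
  have := congrArg (evalFunctional F) key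
  rw [sum_single_pow, map_sum, mul_sum, map_sum] at this
  simp only [evalFunctional_single, mul_sum, map_sum, AddMonoidAlgebra.single_mul_single,
    zero_add] at this
  rw [← this]
  refine sum_congr rfl fun t _ => ?_
  split_ifs <;> ring

/-- The probability of state `A` given that an agent of degree `k` has type `χ` and `i`, `j` and
`k - i - j` neighbors of type `α`, `χ` and `ν`. -/
def degreePosterior (P : Prior) (k i j : ℕ) : ℚ :=
  P.probA * (P.typeDist .A .χ * trinomialProb (P.typeDist .A) k i j) /
    (P.probA * (P.typeDist .A .χ * trinomialProb (P.typeDist .A) k i j) +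
      (1 - P.probA) * (P.typeDist .B .χ * trinomialProb (P.typeDist .B) k i j))

/-- The probability in state `s` that an agent of degree `k` has a candidate context for the
threshold `a`. -/
def degreeCandProb (P : Prior) (a : ℚ) (s : WorldState) (k : ℕ) : ℚ :=
  ∑ i ∈ range (k + 1), ∑ j ∈ range (k - i + 1),
    if a ≤ degreePosterior P k i j then
      P.typeDist s .χ * trinomialProb (P.typeDist s) k i j else 0

lemma contextProb_typeMultiset (G : SimpleGraph (Fin n)) [DecidableRel G.Adj] {P : Prior}
    (hP : P.Valid) (s : WorldState) (v : Fin n) {i j : ℕ} (hi : i < G.degree v + 1)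
    (hj : j < G.degree v - i + 1) :
    contextProb G P s v (.χ, typeMultiset i j (G.degree v - i - j)) =
      P.stateProb s * (P.typeDist s .χ * trinomialProb (P.typeDist s) (G.degree v) i j) := by
  rw [contextProb_eq, sum_filter]
  congr 1
  have h := sum_typesProb_mul_neighborhood G hP s v
    fun m => if m = typeMultiset i j (G.degree v - i - j) then 1 else 0
  refine Eq.trans (sum_congr rfl fun t _ => ?_) (h.trans ?_)
  · simp only [contextOf, Prod.mk.injEq]
    split_ifs <;> simp_all
  · rw [sum_eq_single_of_mem i (mem_range.2 hi), sum_eq_single_of_mem j (mem_range.2 hj)]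
    · simp
    · intro j' _ hne
      simp [typeMultiset_inj, hne]
    · intro i' _ hne
      simp [typeMultiset_inj, hne]

lemma posteriorA_typeMultiset (G : SimpleGraph (Fin n)) [DecidableRel G.Adj] {P : Prior}
    (hP : P.Valid) (v : Fin n) {i j : ℕ} (hi : i < G.degree v + 1)
    (hj : j < G.degree v - i + 1) :
    posteriorA G P v (.χ, typeMultiset i j (G.degree v - i - j)) =
      degreePosterior P (G.degree v) i j := by
  rw [posteriorA_eq, sum_worldState, contextProb_typeMultiset G hP _ v hi hj,
    contextProb_typeMultiset G hP _ v hi hj]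
  rfl

lemma fracCandα_withThresholds_eq (G : SimpleGraph (Fin n)) [DecidableRel G.Adj] {P : Prior}
    (hP : P.Valid) (a b : ℚ) (s : WorldState) :
    fracCandα G (P.withThresholds a b) s =
      (∑ v, degreeCandProb P a s (G.degree v) + n * P.typeDist s .α) / n := by
  have h1 : fracCandα G (P.withThresholds a b) s = expectedFraction G P s fun v c =>
    (c.1 = .χ ∧ a ≤ posteriorA G P v c) ∨ c.1 = .α := rfl
  rw [h1, expectedFraction, sum_mul_card_eq G s fun v c =>
    (c.1 = .χ ∧ a ≤ posteriorA G P v c) ∨ c.1 = .α]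
  congr 1
  have h2 : (n : ℚ) * P.typeDist s .α = ∑ _v : Fin n, P.typeDist s .α := by simp
  rw [h2, ← sum_add_distrib]
  refine sum_congr rfl fun v _ => ?_
  have h3 := sum_typesProb_mul_neighborhood G hP s v
    fun m => if a ≤ posteriorA G P v (.χ, m) then 1 else 0
  have h4 := sum_typesProb_mul_ite hP s v (fun a => a = .α)
  rw [sum_agentType] at h4
  simp only [if_true, reduceCtorEq, if_false, add_zero] at h4
  rw [← h4]
  have h5 : degreeCandProb P a s (G.degree v) = ∑ t : Fin n → AgentType, typesProb P s t *
        (if t v = .χ then (if a ≤ posteriorA G P v (.χ, (G.neighborFinset v).val.map t) then 1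
          else 0) else 0) := by
    rw [h3]
    refine sum_congr rfl fun i hi => sum_congr rfl fun j hj => ?_
    rw [posteriorA_typeMultiset G hP v (mem_range.1 hi) (mem_range.1 hj), mul_ite, mul_one,
      mul_zero]
  rw [h5, ← sum_add_distrib]
  refine sum_congr rfl fun t _ => ?_
  rw [← mul_add]
  congr 1
  rcases h : t v with _ | _ | _ <;> simp [contextOf, h]

/-- The first algorithm, run on a degree sequence with thresholds `a` and `b`. The factors `n / n`
are kept, as expected fractions are `0` for `n = 0`. -/
def listAlg1 (d : List ℕ) (P : Prior) (a b : ℚ) : ℚ × ℚ :=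
  let n : ℚ := d.length
  let F : WorldState → ℚ := fun s => n * (P.typeDist s .α + P.typeDist s .χ) / n
  let C : WorldState → ℚ := fun s =>
    ((d.map (degreeCandProb P a s)).sum + n * P.typeDist s .α) / n
  let L : WorldState → ℚ := fun s => n * P.typeDist s .α / n
  if F .A < b ∧ F .B < b then (L .A, L .B)
  else if b ≤ F .A ∧ b ≤ F .B then (F .A, F .B)
  else if b ≤ C .A then (C .A, C .B)
  else (L .A, L .B)

lemma IsDegreeSequence.length_eq {G : SimpleGraph (Fin n)} [DecidableRel G.Adj] {d : List ℕ}
    (hd : IsDegreeSequence G d) : d.length = n := by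
  have := congrArg Multiset.card hd
  simpa using this

lemma IsDegreeSequence.sum_map {G : SimpleGraph (Fin n)} [DecidableRel G.Adj] {d : List ℕ}
    (hd : IsDegreeSequence G d) (g : ℕ → ℚ) : (d.map g).sum = ∑ v, g (G.degree v) := by
  have := congrArg (fun m => (Multiset.map g m).sum) hd
  rw [Multiset.map_map] at this
  exact this

lemma alg1_eq_listAlg1 (G : SimpleGraph (Fin n)) [DecidableRel G.Adj] {d : List ℕ}
    (hd : IsDegreeSequence G d) {P : Prior} (hP : P.Valid) (a b : ℚ) :
    alg1 G (P.withThresholds a b) = listAlg1 d P a b := by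
  rw [alg1_withThresholds, listAlg1]
  simp only [fracχα_eq G hP, fracα_eq G hP, fracCandα_withThresholds_eq G hP, hd.length_eq,
    hd.sum_map]

end Degrees

/-! ### Costs of programs -/

namespace RAM

/-- The height of a rational number, a bound for the bit lengths of numerator and denominator that
is subadditive for each of the four arithmetic operations. -/
def ht (q : ℚ) : ℕ := Nat.size (max q.num.natAbs q.den) + 1

lemma one_le_ht (q : ℚ) : 1 ≤ ht q := Nat.le_add_left _ _

lemma bits_le (q : ℚ) : bits q ≤ 2 * ht q := by
  have h1 := Nat.size_le_size (le_max_left q.num.natAbs q.den)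
  have h2 := Nat.size_le_size (le_max_right q.num.natAbs q.den)
  unfold bits ht
  omega

lemma ht_le_bits (q : ℚ) : ht q ≤ bits q := by
  unfold bits ht
  rcases max_choice q.num.natAbs q.den with h | h <;> rw [h] <;> omega

lemma ht_divInt_le {a b : ℤ} {M : ℕ} (hb : b ≠ 0) (ha : a.natAbs ≤ M) (hbM : b.natAbs ≤ M) :
    ht (Rat.divInt a b) ≤ Nat.size M + 1 := by
  unfold ht
  have hd : (Rat.divInt a b).den ≤ M := by
    have h1 := Rat.den_dvd a b
    have h2 := Int.natAbs_dvd_natAbs.2 h1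
    exact (Nat.le_of_dvd (Int.natAbs_pos.2 hb) h2).trans hbM
  have hn : (Rat.divInt a b).num.natAbs ≤ M := by
    by_cases h0 : a = 0
    · simp [h0]
    · have h2 := Int.natAbs_dvd_natAbs.2 (Rat.num_dvd a hb)
      exact (Nat.le_of_dvd (Int.natAbs_pos.2 h0) h2).trans ha
  exact Nat.add_le_add_right (Nat.size_le_size (max_le hn hd)) 1

lemma size_mul_le (a b : ℕ) : Nat.size (a * b) ≤ Nat.size a + Nat.size b := by
  rw [Nat.size_le, pow_add]
  exact Nat.mul_lt_mul'' (Nat.lt_size_self a) (Nat.lt_size_self b)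

lemma size_two_mul_mul_le (a b : ℕ) : Nat.size (2 * (a * b)) ≤ Nat.size a + Nat.size b + 1 := by
  rw [Nat.size_le, pow_succ, mul_comm, pow_add]
  exact Nat.mul_lt_mul_of_pos_right
    (Nat.mul_lt_mul'' (Nat.lt_size_self a) (Nat.lt_size_self b)) two_pos

lemma ht_neg (q : ℚ) : ht (-q) = ht q := by simp [ht]

lemma ht_add_le (q r : ℚ) : ht (q + r) ≤ ht q + ht r := by
  set a := max q.num.natAbs q.den with ha
  set b := max r.num.natAbs r.den with hb
  have e : q + r = Rat.divInt (q.num * r.den + r.num * q.den) (q.den * r.den) := by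
    conv_lhs => rw [← Rat.num_divInt_den q, ← Rat.num_divInt_den r]
    rw [Rat.divInt_add_divInt _ _ (by exact_mod_cast q.den_nz) (by exact_mod_cast r.den_nz)]
  have hq : q.num.natAbs ≤ a := le_max_left _ _
  have hq' : q.den ≤ a := le_max_right _ _
  have hr : r.num.natAbs ≤ b := le_max_left _ _
  have hr' : r.den ≤ b := le_max_right _ _
  have h : ht (q + r) ≤ Nat.size (2 * (a * b)) + 1 := by
    rw [e]
    refine ht_divInt_le ?_ ?_ ?_
    · exact_mod_cast mul_ne_zero q.den_nz r.den_nz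
    · refine (Int.natAbs_add_le _ _).trans ?_
      rw [Int.natAbs_mul, Int.natAbs_mul, Int.natAbs_natCast, Int.natAbs_natCast]
      have h1 := Nat.mul_le_mul hq hr'
      have h2 := Nat.mul_le_mul hr hq'
      rw [mul_comm b a] at h2
      omega
    · rw [Int.natAbs_mul, Int.natAbs_natCast, Int.natAbs_natCast]
      have := Nat.mul_le_mul hq' hr'
      omega
  have := size_two_mul_mul_le a b
  have e1 : ht q = a.size + 1 := rfl
  have e2 : ht r = b.size + 1 := rfl
  omega

lemma ht_sub_le (q r : ℚ) : ht (q - r) ≤ ht q + ht r := by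
  rw [sub_eq_add_neg, ← ht_neg r]; exact ht_add_le _ _

lemma ht_mul_le (q r : ℚ) : ht (q * r) ≤ ht q + ht r := by
  set a := max q.num.natAbs q.den with ha
  set b := max r.num.natAbs r.den with hb
  have e : q * r = Rat.divInt (q.num * r.num) (q.den * r.den) := by
    conv_lhs => rw [← Rat.num_divInt_den q, ← Rat.num_divInt_den r]
    rw [Rat.divInt_mul_divInt]
  have h : ht (q * r) ≤ Nat.size (a * b) + 1 := by
    rw [e]
    refine ht_divInt_le ?_ ?_ ?_
    · exact_mod_cast mul_ne_zero q.den_nz r.den_nz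
    · rw [Int.natAbs_mul]
      exact Nat.mul_le_mul (le_max_left _ _) (le_max_left _ _)
    · rw [Int.natAbs_mul, Int.natAbs_natCast, Int.natAbs_natCast]
      exact Nat.mul_le_mul (le_max_right _ _) (le_max_right _ _)
  have := size_mul_le a b
  have e1 : ht q = a.size + 1 := rfl
  have e2 : ht r = b.size + 1 := rfl
  omega

lemma ht_inv_le (q : ℚ) : ht q⁻¹ ≤ ht q := by
  by_cases h : q = 0
  · simp [h]
  · rw [Rat.inv_def]
    refine ht_divInt_le (Rat.num_ne_zero.2 h) ?_ (le_max_left _ _)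
    rw [Int.natAbs_natCast]
    exact le_max_right _ _

lemma ht_div_le (q r : ℚ) : ht (q / r) ≤ ht q + ht r := by
  rw [div_eq_mul_inv]
  exact (ht_mul_le _ _).trans (Nat.add_le_add_left (ht_inv_le r) _)

lemma ht_natCast_le (k : ℕ) : ht (k : ℚ) ≤ k + 2 := by
  unfold ht
  simp only [Rat.num_natCast, Int.natAbs_natCast, Rat.den_natCast]
  have : Nat.size (max k 1) ≤ max k 1 := Nat.size_le.2 Nat.lt_two_pow_self
  omega

lemma ht_zero : ht 0 = 2 := by simp [ht]

lemma ht_one : ht 1 = 2 := by simp [ht]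

lemma ht_sum_range_le {f : ℕ → ℚ} {m B : ℕ} (h : ∀ i < m, ht (f i) ≤ B) :
    ht (∑ i ∈ range m, f i) ≤ 2 + m * B := by
  induction m with
  | zero => simp [ht_zero]
  | succ m ih =>
    rw [sum_range_succ]
    have h1 := ih fun i hi => h i (hi.trans (Nat.lt_succ_self m))
    have h2 := h m (Nat.lt_succ_self m)
    have h3 := ht_add_le (∑ i ∈ range m, f i) (f m)
    rw [Nat.succ_mul]
    omega

lemma ht_prod_range_le {f : ℕ → ℚ} {m B : ℕ} (h : ∀ i < m, ht (f i) ≤ B) :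
    ht (∏ i ∈ range m, f i) ≤ 2 + m * B := by
  induction m with
  | zero => simp [ht_one]
  | succ m ih =>
    rw [prod_range_succ]
    have h1 := ih fun i hi => h i (hi.trans (Nat.lt_succ_self m))
    have h2 := h m (Nat.lt_succ_self m)
    have h3 := ht_mul_le (∏ i ∈ range m, f i) (f m)
    rw [Nat.succ_mul]
    omega

/-- The value of an expression has height at most `e.weight * M` if registers and memory have
heights at most `M`. -/
def Expr.weight : Expr → ℕ
  | .const q => ht q
  | .reg _ => 1
  | .mem _ => 1
  | .add a b => a.weight + b.weight
  | .sub a b => a.weight + b.weight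
  | .mul a b => a.weight + b.weight
  | .div a b => a.weight + b.weight
  | .le a b => a.weight + b.weight

/-- Evaluating an expression costs at most `e.costFactor * M` if registers and memory have heights
at most `M`. -/
def Expr.costFactor : Expr → ℕ
  | .const q => bits q
  | .reg _ => 2
  | .mem a => a.costFactor + 2
  | .add a b => a.costFactor + b.costFactor + 2 * (a.weight + b.weight)
  | .sub a b => a.costFactor + b.costFactor + 2 * (a.weight + b.weight)
  | .mul a b => a.costFactor + b.costFactor + 2 * (a.weight + b.weight)
  | .div a b => a.costFactor + b.costFactor + 2 * (a.weight + b.weight)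
  | .le a b => a.costFactor + b.costFactor + 2 * (a.weight + b.weight)

lemma Expr.one_le_weight : ∀ e : Expr, 1 ≤ e.weight
  | .const q => one_le_ht q
  | .reg _ => le_rfl
  | .mem _ => le_rfl
  | .add a _ => (one_le_weight a).trans (Nat.le_add_right _ _)
  | .sub a _ => (one_le_weight a).trans (Nat.le_add_right _ _)
  | .mul a _ => (one_le_weight a).trans (Nat.le_add_right _ _)
  | .div a _ => (one_le_weight a).trans (Nat.le_add_right _ _)
  | .le a _ => (one_le_weight a).trans (Nat.le_add_right _ _)

lemma Expr.ht_eval_le {c : Config} {M : ℕ} (hM : 1 ≤ M) (hr : ∀ x, ht (c.reg x) ≤ M)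
    (hm : ∀ a, ht (c.mem a) ≤ M) (e : Expr) : ht (e.eval c) ≤ e.weight * M := by
  induction e with
  | const q => exact Nat.le_mul_of_pos_right _ hM
  | reg x => simpa [weight, eval] using hr x
  | mem a => simpa [weight, eval] using hm _
  | add a b iha ihb =>
    rw [weight, add_mul]; exact (ht_add_le _ _).trans (Nat.add_le_add iha ihb)
  | sub a b iha ihb =>
    rw [weight, add_mul]; exact (ht_sub_le _ _).trans (Nat.add_le_add iha ihb)
  | mul a b iha ihb =>
    rw [weight, add_mul]; exact (ht_mul_le _ _).trans (Nat.add_le_add iha ihb)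
  | div a b iha ihb =>
    rw [weight, add_mul]; exact (ht_div_le _ _).trans (Nat.add_le_add iha ihb)
  | le a b =>
    have h1 := Nat.mul_le_mul (one_le_weight a) hM
    have h2 := Nat.mul_le_mul (one_le_weight b) hM
    rw [weight, add_mul, eval]
    split_ifs
    · rw [ht_one]; omega
    · rw [ht_zero]; omega

lemma Expr.cost_le {c : Config} {M : ℕ} (hM : 1 ≤ M) (hr : ∀ x, ht (c.reg x) ≤ M)
    (hm : ∀ a, ht (c.mem a) ≤ M) (e : Expr) : e.cost c ≤ e.costFactor * M := by
  have hbits : ∀ e : Expr, bits (e.eval c) ≤ 2 * (e.weight * M) := fun e =>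
    (bits_le _).trans (Nat.mul_le_mul_left 2 (ht_eval_le hM hr hm e))
  have hop : ∀ {a b e : Expr}, a.cost c ≤ a.costFactor * M → b.cost c ≤ b.costFactor * M →
      e.weight = a.weight + b.weight → a.cost c + b.cost c + bits (e.eval c) ≤
        (a.costFactor + b.costFactor + 2 * (a.weight + b.weight)) * M := by
    intro a b e ha hb he
    have := hbits e
    rw [he, ← mul_assoc] at this
    rw [add_mul, add_mul]
    omega
  induction e with
  | const q => exact Nat.le_mul_of_pos_right _ hM
  | reg x => simpa [weight, eval, costFactor, cost] using hbits (.reg x)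
  | mem a ih =>
    have := hbits (.mem a)
    rw [weight, one_mul] at this
    rw [costFactor, cost, add_mul]
    exact Nat.add_le_add ih this
  | add a b iha ihb => exact hop iha ihb rfl
  | sub a b iha ihb => exact hop iha ihb rfl
  | mul a b iha ihb => exact hop iha ihb rfl
  | div a b iha ihb => exact hop iha ihb rfl
  | le a b iha ihb => exact hop iha ihb rfl

/-- A bound for the cost of a program in which no loop is iterated more than `N` times each time it
is entered and in which the numbers have heights at most `M`. -/
def Program.bound (N M : ℕ) : Program → ℕ
  | .skip => 1
  | .assign _ e => e.costFactor * M + 1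
  | .store a e => a.costFactor * M + e.costFactor * M + 1
  | .seq s t => s.bound N M + t.bound N M
  | .ite e s t => e.costFactor * M + s.bound N M + t.bound N M + 1
  | .loop e s => N * (e.costFactor * M + s.bound N M + 1) + (e.costFactor * M + 1)

/-- `Program.bound` as a polynomial in the number of iterations, if the heights are bounded by the
polynomial `M`. -/
noncomputable def Program.boundPoly (M : Polynomial ℕ) : Program → Polynomial ℕ
  | .skip => 1
  | .assign _ e => e.costFactor * M + 1
  | .store a e => a.costFactor * M + e.costFactor * M + 1
  | .seq s t => s.boundPoly M + t.boundPoly M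
  | .ite e s t => e.costFactor * M + s.boundPoly M + t.boundPoly M + 1
  | .loop e s =>
    Polynomial.X * ((e.costFactor : Polynomial ℕ) * M + s.boundPoly M + 1) +
      ((e.costFactor : Polynomial ℕ) * M + 1)

lemma Program.eval_boundPoly (M : Polynomial ℕ) (N : ℕ) (s : Program) :
    (s.boundPoly M).eval N = s.bound N (M.eval N) := by
  induction s with
  | skip => simp [boundPoly, bound]
  | assign x e => simp [boundPoly, bound]
  | store a e => simp [boundPoly, bound]
  | seq s t hs ht => simp [boundPoly, bound, hs, ht]
  | ite e s t hs ht => simp [boundPoly, bound, hs, ht]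
  | loop e s hs => simp [boundPoly, bound, hs]

/-- The program `s` leads from `c` to `c'`, at a cost within `Program.bound N M`. -/
def Runs (N M : ℕ) (s : Program) (c c' : Config) : Prop := ∃ k ≤ s.bound N M, Exec s c k c'

/-- The configuration with memory `m` and the entries of the list `l` in the first registers. -/
def state (m : ℕ → ℚ) (l : List ℚ) : Config := ⟨fun x => l.getD x 0, m⟩

/-- All numbers in the list have height at most `M`. -/
def Bdd (M : ℕ) (l : List ℚ) : Prop := ∀ q ∈ l, ht q ≤ M

lemma bdd_cons {M : ℕ} {q : ℚ} {l : List ℚ} : Bdd M (q :: l) ↔ ht q ≤ M ∧ Bdd M l :=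
  List.forall_mem_cons

lemma bdd_nil {M : ℕ} : Bdd M [] := by simp [Bdd]

variable {N M : ℕ} {m : ℕ → ℚ}

lemma Bdd.ht_reg_le (hM : 2 ≤ M) {l : List ℚ} (hl : Bdd M l) (x : ℕ) :
    ht ((state m l).reg x) ≤ M := by
  by_cases hx : x < l.length
  · have : (state m l).reg x = l[x] := List.getD_eq_getElem _ _ hx
    rw [this]
    exact hl _ (List.getElem_mem hx)
  · have : (state m l).reg x = 0 := List.getD_eq_default _ _ (not_lt.1 hx)
    rw [this, ht_zero]
    exact hM

lemma Runs.seq {s t : Program} {c₁ c₂ c₃ : Config} (h₁ : Runs N M s c₁ c₂)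
    (h₂ : Runs N M t c₂ c₃) : Runs N M (.seq s t) c₁ c₃ := by
  obtain ⟨k, hk, h₁⟩ := h₁
  obtain ⟨l, hl, h₂⟩ := h₂
  exact ⟨k + l, Nat.add_le_add hk hl, .seq h₁ h₂⟩

lemma Runs.assign (hM : 2 ≤ M) (hm : ∀ a, ht (m a) ≤ M) {x : ℕ} {e : Expr} {l l' : List ℚ}
    (hl : Bdd M l) (hx : x < l.length) {q : ℚ} (hq : e.eval (state m l) = q)
    (hl' : l.set x q = l') : Runs N M (.assign x e) (state m l) (state m l') := by
  have hstate : (state m l' : Config) =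
      { state m l with reg := Function.update (state m l).reg x (e.eval (state m l)) } := by
    simp only [state, Config.mk.injEq, and_true]
    funext y
    rw [← hl', ← hq]
    by_cases hy : y = x
    · subst hy; simp [state, hx]
    · simp [hy, state, List.getElem?_set_ne (Ne.symm hy)]
  refine ⟨e.cost (state m l) + 1, ?_, ?_⟩
  · exact Nat.add_le_add_right (e.cost_le (by omega) (hl.ht_reg_le hM) hm) 1
  · rw [hstate]; exact .assign x e _

/-- The rule for loops: `f i` is the list of registers before the iteration with number `i`. -/
lemma Runs.loop (hM : 2 ≤ M) (hm : ∀ a, ht (m a) ≤ M) {e : Expr} {s : Program} {n : ℕ}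
    (f : ℕ → List ℚ) (hn : n ≤ N) (hf : ∀ i ≤ n, Bdd M (f i))
    (hcond : ∀ i < n, e.eval (state m (f i)) ≠ 0) (hend : e.eval (state m (f n)) = 0)
    (hbody : ∀ i < n, Runs N M s (state m (f i)) (state m (f (i + 1)))) :
    Runs N M (.loop e s) (state m (f 0)) (state m (f n)) := by
  have hcost : ∀ i ≤ n, e.cost (state m (f i)) ≤ e.costFactor * M := fun i hi =>
    e.cost_le (by omega) ((hf i hi).ht_reg_le hM) hm
  have key : ∀ r ≤ n, ∃ k ≤ r * (e.costFactor * M + s.bound N M + 1) + (e.costFactor * M + 1),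
      Exec (.loop e s) (state m (f (n - r))) k (state m (f n)) := by
    intro r
    induction r with
    | zero =>
      intro _
      exact ⟨_, by simpa using hcost n le_rfl, .loop_false hend⟩
    | succ r ih =>
      intro hr
      obtain ⟨k, hk, h⟩ := ih (by omega)
      obtain ⟨l, hl, hb⟩ := hbody (n - (r + 1)) (by omega)
      have e1 : n - (r + 1) + 1 = n - r := by omega
      rw [e1] at hb
      refine ⟨_, ?_, .loop_true (hcond _ (by omega)) hb h⟩
      have := hcost (n - (r + 1)) (by omega)
      rw [Nat.succ_mul]
      omega
  obtain ⟨k, hk, h⟩ := key n le_rfl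
  rw [Nat.sub_self] at h
  refine ⟨k, hk.trans ?_, h⟩
  exact Nat.add_le_add_right (Nat.mul_le_mul_right _ hn) _

end RAM

/-! ### Sums and products for the program -/

/-- The factor with index `u` in a product that evaluates `trinomialProb`: multinomial coefficient
and powers are accumulated block by block (`i` times `α`, `j` times `χ`, then `ν`). -/
def trinomialFactor (q : AgentType → ℚ) (i j u : ℕ) : ℚ :=
  (u + 1) * ((if (u : ℚ) + 1 ≤ i then 1 else 0) * (q .α / (u + 1)) +
    (1 - if (u : ℚ) + 1 ≤ i then 1 else 0) *
      ((if (u : ℚ) + 1 ≤ i + j then 1 else 0) * (q .χ / (u - i + 1)) +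
        (1 - if (u : ℚ) + 1 ≤ i + j then 1 else 0) * (q .ν / (u - i - j + 1))))

lemma prod_range_div_add_one (x : ℚ) (i : ℕ) :
    ∏ u ∈ range i, x / ((u : ℚ) + 1) = x ^ i / (i.factorial : ℚ) := by
  rw [prod_div_distrib, prod_const, card_range, ← prod_range_add_one_eq_factorial]
  push_cast
  rfl

lemma prod_trinomialFactor (q : AgentType → ℚ) {k i j : ℕ} (h : i + j ≤ k) :
    ∏ u ∈ range k, trinomialFactor q i j u = trinomialProb q k i j := by
  obtain ⟨l, rfl⟩ := Nat.exists_eq_add_of_le h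
  set g : ℕ → ℚ := fun u => (if (u : ℚ) + 1 ≤ i then 1 else 0) * (q .α / (u + 1)) +
    (1 - if (u : ℚ) + 1 ≤ i then 1 else 0) *
      ((if (u : ℚ) + 1 ≤ i + j then 1 else 0) * (q .χ / (u - i + 1)) +
        (1 - if (u : ℚ) + 1 ≤ i + j then 1 else 0) * (q .ν / (u - i - j + 1))) with hg
  have h0 : ∀ u, trinomialFactor q i j u = (u + 1) * g u := fun _ => rfl
  have h1 : ∏ u ∈ range (i + j + l), ((u : ℚ) + 1) = ((i + j + l).factorial : ℚ) := by
    rw [← prod_range_add_one_eq_factorial]; push_cast; rfl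
  have e1 : ∀ u ∈ range i, g u = q .α / ((u : ℚ) + 1) := by
    intro u hu
    have : (u : ℚ) + 1 ≤ i := by exact_mod_cast mem_range.1 hu
    simp [hg, this]
  have e2 : ∀ u ∈ range j, g (i + u) = q .χ / ((u : ℚ) + 1) := by
    intro u hu
    have h2 : ¬ (((i + u : ℕ) : ℚ) + 1 ≤ i) := by
      push_cast; have : (0 : ℚ) ≤ u := Nat.cast_nonneg u
      linarith
    have h3 : ((i + u : ℕ) : ℚ) + 1 ≤ i + j := by
      have : (u : ℚ) + 1 ≤ j := by exact_mod_cast mem_range.1 hu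
      push_cast; linarith
    simp only [hg]
    rw [if_neg h2, if_pos h3]
    push_cast
    ring
  have e3 : ∀ u ∈ range l, g (i + j + u) = q .ν / ((u : ℚ) + 1) := by
    intro u _
    have h0 : (0 : ℚ) ≤ u := Nat.cast_nonneg u
    have h0' : (0 : ℚ) ≤ j := Nat.cast_nonneg j
    have h2 : ¬ (((i + j + u : ℕ) : ℚ) + 1 ≤ i) := by push_cast; linarith
    have h3 : ¬ (((i + j + u : ℕ) : ℚ) + 1 ≤ i + j) := by push_cast; linarith
    simp only [hg]
    rw [if_neg h2, if_neg h3]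
    push_cast
    ring
  simp_rw [h0]
  rw [prod_mul_distrib, prod_range_add g (i + j) l, prod_range_add g i j]
  rw [prod_congr rfl e1, prod_congr rfl e2, prod_congr rfl e3, h1, prod_range_div_add_one,
    prod_range_div_add_one, prod_range_div_add_one, trinomialProb]
  have e4 : i + j + l - i = j + l := by omega
  have e5 : j + l - j = l := by omega
  have c1 : ((i + j + l).choose i : ℚ) =
      (i + (j + l)).factorial / (i.factorial * (j + l).factorial) := by
    rw [add_assoc]; exact Nat.cast_add_choose ℚ
  have c2 : ((j + l).choose j : ℚ) = (j + l).factorial / (j.factorial * l.factorial) :=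
    Nat.cast_add_choose ℚ
  rw [e4, e5, c1, c2, ← add_assoc]
  have f1 : (i.factorial : ℚ) ≠ 0 := by exact_mod_cast i.factorial_ne_zero
  have f2 : (j.factorial : ℚ) ≠ 0 := by exact_mod_cast j.factorial_ne_zero
  have f3 : (l.factorial : ℚ) ≠ 0 := by exact_mod_cast l.factorial_ne_zero
  have f4 : ((j + l).factorial : ℚ) ≠ 0 := by exact_mod_cast (j + l).factorial_ne_zero
  field_simp

lemma sum_map_eq_sum_range (g : ℕ → ℚ) (d : List ℕ) :
    (d.map g).sum = ∑ v ∈ range d.length, g (d.getD v 0) := by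
  induction d with
  | nil => simp
  | cons a d ih =>
    rw [List.length_cons, sum_range_succ', List.map_cons, List.sum_cons, ih]
    simp [add_comm]

/-- The contribution of one context to `degreeCandProb`. -/
def candTerm (P : Prior) (a : ℚ) (s : WorldState) (k i j : ℕ) : ℚ :=
  (if a ≤ degreePosterior P k i j then 1 else 0) *
    (P.typeDist s .χ * trinomialProb (P.typeDist s) k i j)

lemma degreeCandProb_eq (P : Prior) (a : ℚ) (s : WorldState) (k : ℕ) :
    degreeCandProb P a s k =
      ∑ i ∈ range (k + 1), ∑ j ∈ range (k + 1 - i), candTerm P a s k i j := by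
  refine sum_congr rfl fun i hi => ?_
  have : k - i + 1 = k + 1 - i := by have := mem_range.1 hi; omega
  rw [this]
  refine sum_congr rfl fun j _ => ?_
  rw [candTerm]; split_ifs <;> simp

/-- The sum accumulated when the three outer loops have reached the agent with index `v` and the
numbers `i` and `j` of neighbors of types `α` and `χ`. -/
def partialSum (P : Prior) (a : ℚ) (d : List ℕ) (s : WorldState) (v i j : ℕ) : ℚ :=
  ∑ v' ∈ range v, degreeCandProb P a s (d.getD v' 0) +
    ∑ i' ∈ range i, ∑ j' ∈ range (d.getD v 0 + 1 - i'), candTerm P a s (d.getD v 0) i' j' +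
    ∑ j' ∈ range j, candTerm P a s (d.getD v 0) i j'

section PartialSum

variable (P : Prior) (a : ℚ) (d : List ℕ) (s : WorldState)

lemma partialSum_zero : partialSum P a d s 0 0 0 = 0 := by simp [partialSum]

lemma partialSum_succ_j (v i j : ℕ) : partialSum P a d s v i (j + 1) =
    partialSum P a d s v i j + candTerm P a s (d.getD v 0) i j := by
  simp only [partialSum, sum_range_succ]; ring

lemma partialSum_succ_i (v i : ℕ) : partialSum P a d s v (i + 1) 0 =
    partialSum P a d s v i (d.getD v 0 + 1 - i) := by
  simp only [partialSum, sum_range_succ, range_zero, sum_empty]; ring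

lemma partialSum_succ_v (v : ℕ) : partialSum P a d s (v + 1) 0 0 =
    partialSum P a d s v (d.getD v 0 + 1) 0 := by
  simp only [partialSum, range_zero, sum_empty, add_zero]
  rw [sum_range_succ, degreeCandProb_eq]

lemma partialSum_length : partialSum P a d s d.length 0 0 =
    (d.map (degreeCandProb P a s)).sum := by
  simp [partialSum, sum_map_eq_sum_range]

end PartialSum

namespace RAM

/-- The memory cells `0` to `12` hold the parameters, the next ones the degree sequence. The
natural number `N` bounds lengths, degrees and heights. -/
structure Setting (N : ℕ) (m : ℕ → ℚ) (d : List ℕ) (P : Prior) (μs ε δ : ℚ) : Prop where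
  n : m 0 = d.length
  p : m 1 = P.p
  μ : m 2 = P.μ
  Aα : m 3 = P.typeDist .A .α
  Aχ : m 4 = P.typeDist .A .χ
  Aν : m 5 = P.typeDist .A .ν
  Bα : m 6 = P.typeDist .B .α
  Bχ : m 7 = P.typeDist .B .χ
  Bν : m 8 = P.typeDist .B .ν
  probA : m 9 = P.probA
  μs : m 10 = μs
  ε : m 11 = ε
  δ : m 12 = δ
  deg : ∀ v, m (13 + v) = d.getD v 0
  le_N : 13 ≤ N
  length_le : d.length ≤ N
  deg_lt : ∀ v, d.getD v 0 < N
  ht_le : ∀ x, ht (m x) ≤ N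

/-- A bound for the heights of all numbers that occur, when `N` is as in `Setting`. -/
def heightBound (N : ℕ) : ℕ := 40 * N ^ 5

section Heights

variable {N : ℕ} {m : ℕ → ℚ} {d : List ℕ} {P : Prior} {μs ε δ : ℚ}

lemma Setting.ht_typeDist_le (h : Setting N m d P μs ε δ) (s : WorldState) (a : AgentType) :
    ht (P.typeDist s a) ≤ N := by
  cases s <;> cases a
  · rw [← h.Aα]; exact h.ht_le _
  · rw [← h.Aχ]; exact h.ht_le _
  · rw [← h.Aν]; exact h.ht_le _
  · rw [← h.Bα]; exact h.ht_le _
  · rw [← h.Bχ]; exact h.ht_le _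
  · rw [← h.Bν]; exact h.ht_le _

lemma Setting.ht_trinomialFactor_le (h : Setting N m d P μs ε δ) (s : WorldState) {i j u : ℕ}
    (hi : i ≤ N) (hj : j ≤ N) (hu : u < N) :
    ht (trinomialFactor (P.typeDist s) i j u) ≤ 6 * N := by
  have hN := h.le_N
  have h1 := ht_natCast_le u
  have h2 := ht_natCast_le i
  have h3 := ht_natCast_le j
  have h4 := ht_add_le (u : ℚ) 1
  have h5 := ht_sub_le (u : ℚ) i
  have h6 := ht_add_le ((u : ℚ) - i) 1
  have h7 := ht_sub_le ((u : ℚ) - i) j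
  have h8 := ht_add_le ((u : ℚ) - i - j) 1
  have ho := ht_one
  have key : ∀ (a : AgentType) (z : ℚ),
      ht (((u : ℚ) + 1) * (P.typeDist s a / z)) ≤ ht ((u : ℚ) + 1) + (N + ht z) := fun a z =>
    (ht_mul_le _ _).trans (Nat.add_le_add_left ((ht_div_le _ _).trans
      (Nat.add_le_add_right (h.ht_typeDist_le s a) _)) _)
  unfold trinomialFactor
  split_ifs
  · simp only [one_mul, sub_self, zero_mul, add_zero]
    have := key .α ((u : ℚ) + 1); omega
  · simp only [one_mul, sub_self, zero_mul, add_zero]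
    have := key .α ((u : ℚ) + 1); omega
  · simp only [one_mul, sub_self, sub_zero, zero_mul, add_zero, zero_add]
    have := key .χ ((u : ℚ) - i + 1); omega
  · simp only [one_mul, sub_zero, zero_mul, zero_add]
    have := key .ν ((u : ℚ) - i - j + 1); omega

lemma Setting.ht_prod_trinomialFactor_le (h : Setting N m d P μs ε δ) (s : WorldState)
    {i j u : ℕ} (hi : i ≤ N) (hj : j ≤ N) (hu : u ≤ N) :
    ht (∏ w ∈ range u, trinomialFactor (P.typeDist s) i j w) ≤ 7 * N ^ 2 := by
  have hN := h.le_N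
  have h1 := ht_prod_range_le (f := trinomialFactor (P.typeDist s) i j) (m := u) (B := 6 * N)
    fun w hw => h.ht_trinomialFactor_le s hi hj (hw.trans_le hu)
  have h2 : u * (6 * N) ≤ N * (6 * N) := Nat.mul_le_mul_right _ hu
  nlinarith

lemma Setting.ht_candTerm_le (h : Setting N m d P μs ε δ) (a : ℚ) (s : WorldState) {k i j : ℕ}
    (hk : k ≤ N) (hij : i + j ≤ k) : ht (candTerm P a s k i j) ≤ 8 * N ^ 2 := by
  have hN := h.le_N
  have h1 := h.ht_prod_trinomialFactor_le s (i := i) (j := j) (u := k) (by omega) (by omega) hk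
  rw [prod_trinomialFactor _ hij] at h1
  have h2 := ht_mul_le (P.typeDist s .χ) (trinomialProb (P.typeDist s) k i j)
  have h3 := h.ht_typeDist_le s .χ
  unfold candTerm
  split_ifs
  · rw [one_mul]; nlinarith
  · rw [zero_mul, ht_zero]; nlinarith

lemma Setting.ht_sum_candTerm_le (h : Setting N m d P μs ε δ) (a : ℚ) (s : WorldState)
    {k i j : ℕ} (hk : k < N) (hi : i ≤ k + 1) (hj : j ≤ k + 1 - i) :
    ht (∑ j' ∈ range j, candTerm P a s k i j') ≤ 9 * N ^ 3 := by
  have hN := h.le_N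
  have h1 := ht_sum_range_le (f := candTerm P a s k i) (m := j) (B := 8 * N ^ 2)
    fun w hw => h.ht_candTerm_le a s hk.le (by omega)
  have h2 : j * (8 * N ^ 2) ≤ N * (8 * N ^ 2) := Nat.mul_le_mul_right _ (by omega)
  have h3 : 2 ≤ N ^ 3 := (by omega : 2 ≤ N).trans (Nat.le_self_pow (by norm_num) N)
  have h4 : N * (8 * N ^ 2) = 8 * N ^ 3 := by ring
  omega

lemma Setting.ht_sum_sum_candTerm_le (h : Setting N m d P μs ε δ) (a : ℚ) (s : WorldState)
    {k i : ℕ} (hk : k < N) (hi : i ≤ k + 1) :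
    ht (∑ i' ∈ range i, ∑ j' ∈ range (k + 1 - i'), candTerm P a s k i' j') ≤ 10 * N ^ 4 := by
  have hN := h.le_N
  have h1 := ht_sum_range_le (f := fun i' => ∑ j' ∈ range (k + 1 - i'), candTerm P a s k i' j')
    (m := i) (B := 9 * N ^ 3) fun w hw => h.ht_sum_candTerm_le a s hk (by omega) le_rfl
  have h2 : i * (9 * N ^ 3) ≤ N * (9 * N ^ 3) := Nat.mul_le_mul_right _ (by omega)
  have h3 : 2 ≤ N ^ 4 := (by omega : 2 ≤ N).trans (Nat.le_self_pow (by norm_num) N)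
  have h4 : N * (9 * N ^ 3) = 9 * N ^ 4 := by ring
  omega

lemma Setting.ht_partialSum_le (h : Setting N m d P μs ε δ) (a : ℚ) (s : WorldState)
    {v i j : ℕ} (hv : v ≤ d.length) (hi : i ≤ d.getD v 0 + 1) (hj : j ≤ d.getD v 0 + 1 - i) :
    ht (partialSum P a d s v i j) ≤ 30 * N ^ 5 := by
  have hN := h.le_N
  have h1 := ht_sum_range_le (f := fun v' => degreeCandProb P a s (d.getD v' 0)) (m := v)
    (B := 10 * N ^ 4) fun w _ => by
      rw [degreeCandProb_eq]; exact h.ht_sum_sum_candTerm_le a s (h.deg_lt w) le_rfl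
  have h2 : v * (10 * N ^ 4) ≤ N * (10 * N ^ 4) :=
    Nat.mul_le_mul_right _ (hv.trans h.length_le)
  have h3 : 2 ≤ N ^ 5 := (by omega : 2 ≤ N).trans (Nat.le_self_pow (by norm_num) N)
  have h4 : N * (10 * N ^ 4) = 10 * N ^ 5 := by ring
  have h5 : N ^ 4 ≤ N ^ 5 := Nat.pow_le_pow_right (by omega) (by norm_num)
  have h6 : N ^ 3 ≤ N ^ 5 := Nat.pow_le_pow_right (by omega) (by norm_num)
  have h7 := h.ht_sum_sum_candTerm_le a s (h.deg_lt v) hi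
  have h8 := h.ht_sum_candTerm_le a s (h.deg_lt v) hi hj
  have h9 := ht_add_le (∑ v' ∈ range v, degreeCandProb P a s (d.getD v' 0) +
    ∑ i' ∈ range i, ∑ j' ∈ range (d.getD v 0 + 1 - i'), candTerm P a s (d.getD v 0) i' j')
    (∑ j' ∈ range j, candTerm P a s (d.getD v 0) i j')
  have h10 := ht_add_le (∑ v' ∈ range v, degreeCandProb P a s (d.getD v' 0))
    (∑ i' ∈ range i, ∑ j' ∈ range (d.getD v 0 + 1 - i'), candTerm P a s (d.getD v 0) i' j')
  unfold partialSum
  omega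

lemma le_heightBound (hN : 13 ≤ N) : N + 2 ≤ heightBound N := by
  have : N ≤ N ^ 5 := Nat.le_self_pow (by norm_num) N
  unfold heightBound
  omega

lemma Setting.ht_listAlg1_le (h : Setting N m d P μs ε δ) (a b : ℚ) :
    ht (listAlg1 d P a b).1 ≤ heightBound N ∧ ht (listAlg1 d P a b).2 ≤ heightBound N := by
  have hN := h.le_N
  have hn := (ht_natCast_le d.length).trans (Nat.add_le_add_right h.length_le 2)
  have hpow : 13 * N ≤ N ^ 5 := by
    have : N ^ 5 = N ^ 4 * N := by ring
    rw [this]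
    exact Nat.mul_le_mul_right _ (hN.trans (Nat.le_self_pow (by norm_num) N))
  have hF : ∀ s, ht ((d.length : ℚ) * (P.typeDist s .α + P.typeDist s .χ) / d.length) ≤
      heightBound N := by
    intro s
    have h1 := ht_div_le ((d.length : ℚ) * (P.typeDist s .α + P.typeDist s .χ)) d.length
    have h2 := ht_mul_le (d.length : ℚ) (P.typeDist s .α + P.typeDist s .χ)
    have h3 := ht_add_le (P.typeDist s .α) (P.typeDist s .χ)
    have h4 := h.ht_typeDist_le s .α
    have h5 := h.ht_typeDist_le s .χ
    unfold heightBound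
    omega
  have hL : ∀ s, ht ((d.length : ℚ) * P.typeDist s .α / d.length) ≤ heightBound N := by
    intro s
    have h1 := ht_div_le ((d.length : ℚ) * P.typeDist s .α) d.length
    have h2 := ht_mul_le (d.length : ℚ) (P.typeDist s .α)
    have h4 := h.ht_typeDist_le s .α
    unfold heightBound
    omega
  have hC : ∀ s, ht (((d.map (degreeCandProb P a s)).sum + d.length * P.typeDist s .α) /
      d.length) ≤ heightBound N := by
    intro s
    have h1 := ht_div_le ((d.map (degreeCandProb P a s)).sum + d.length * P.typeDist s .α)
      d.length
    have h2 := ht_mul_le (d.length : ℚ) (P.typeDist s .α)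
    have h3 := ht_add_le ((d.map (degreeCandProb P a s)).sum) (d.length * P.typeDist s .α)
    have h4 := h.ht_typeDist_le s .α
    have h5 := h.ht_partialSum_le a s (i := 0) (j := 0) le_rfl (Nat.zero_le _) (Nat.zero_le _)
    rw [partialSum_length] at h5
    unfold heightBound
    omega
  unfold listAlg1
  dsimp only
  split_ifs
  · exact ⟨hL _, hL _⟩
  · exact ⟨hF _, hF _⟩
  · exact ⟨hC _, hC _⟩
  · exact ⟨hL _, hL _⟩

end Heights

end RAM

/-! ### The program and its runs -/

namespace RAM

/-- The value of the memory cell with the given address. -/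
def memE (k : ℕ) : Expr := .mem (.const k)

/-- The degree of the agent whose index is in register `3`. -/
def degreeE : Expr := .mem (.add (.const 13) (.reg 3))

/-- Computes `trinomialFactor` for the distribution in the cells `x`, `y` and `z`, with `i`, `j`
and `u` in the registers `4`, `5` and `6`. Case distinctions are products with values of
comparisons. -/
def factorE (x y z : ℕ) : Expr :=
  .mul (.add (.reg 6) (.const 1))
    (.add (.mul (.le (.add (.reg 6) (.const 1)) (.reg 4))
        (.div (memE x) (.add (.reg 6) (.const 1))))
      (.mul (.sub (.const 1) (.le (.add (.reg 6) (.const 1)) (.reg 4)))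
        (.add (.mul (.le (.add (.reg 6) (.const 1)) (.add (.reg 4) (.reg 5)))
            (.div (memE y) (.add (.sub (.reg 6) (.reg 4)) (.const 1))))
          (.mul (.sub (.const 1) (.le (.add (.reg 6) (.const 1)) (.add (.reg 4) (.reg 5))))
            (.div (memE z) (.add (.sub (.sub (.reg 6) (.reg 4)) (.reg 5)) (.const 1)))))))

/-- Multiplies the registers `7` and `8` by the probabilities of the current neighborhood in the
states `A` and `B`. -/
def trinomialLoop : Program :=
  .loop (.le (.add (.reg 6) (.const 1)) degreeE)
    (.seq (.assign 7 (.mul (.reg 7) (factorE 3 4 5)))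
      (.seq (.assign 8 (.mul (.reg 8) (factorE 6 7 8)))
        (.assign 6 (.add (.reg 6) (.const 1)))))

/-- The posterior probability of state `A`, from the registers `7` and `8`. -/
def posteriorE : Expr :=
  .div (.mul (memE 9) (.mul (memE 4) (.reg 7)))
    (.add (.mul (memE 9) (.mul (memE 4) (.reg 7)))
      (.mul (.sub (.const 1) (memE 9)) (.mul (memE 7) (.reg 8))))

/-- Adds the current context to the sums in the registers `1` and `2` if it is a candidate context
for the threshold `ea`. -/
def contextStep (ea : Expr) : Program :=
  .seq (.assign 7 (.const 1)) <| .seq (.assign 8 (.const 1)) <| .seq trinomialLoop <|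
  .seq (.assign 1 (.add (.reg 1) (.mul (.le ea posteriorE) (.mul (memE 4) (.reg 7))))) <|
  .seq (.assign 2 (.add (.reg 2) (.mul (.le ea posteriorE) (.mul (memE 7) (.reg 8))))) <|
  .seq (.assign 7 (.const 0)) <| .seq (.assign 8 (.const 0)) <| .seq (.assign 6 (.const 0)) <|
  .assign 5 (.add (.reg 5) (.const 1))

/-- Runs through the numbers of neighbors of type `χ`. -/
def chiLoop (ea : Expr) : Program :=
  .loop (.le (.add (.reg 4) (.reg 5)) degreeE) (contextStep ea)

/-- Runs through the numbers of neighbors of type `α`. -/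
def alphaLoop (ea : Expr) : Program :=
  .loop (.le (.reg 4) degreeE)
    (.seq (chiLoop ea) (.seq (.assign 5 (.const 0)) (.assign 4 (.add (.reg 4) (.const 1)))))

/-- Runs through the agents. -/
def agentLoop (ea : Expr) : Program :=
  .loop (.le (.add (.reg 3) (.const 1)) (memE 0))
    (.seq (alphaLoop ea) (.seq (.assign 4 (.const 0)) (.assign 3 (.add (.reg 3) (.const 1)))))

/-- The expected fraction of agents of type `α` or `χ`; `x` and `y` are the cells with the
probabilities of these types. -/
def fullE (x y : ℕ) : Expr := .div (.mul (memE 0) (.add (memE x) (memE y))) (memE 0)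

/-- The expected fraction of agents of type `α`. -/
def lowE (x : ℕ) : Expr := .div (.mul (memE 0) (memE x)) (memE 0)

/-- The expected fraction of candidates and agents of type `α`; the register `r` holds the expected
number of candidates. -/
def candE (r x : ℕ) : Expr := .div (.add (.reg r) (.mul (memE 0) (memE x))) (memE 0)

/-- `1` if both states are candidate states, otherwise `0`. -/
def bothE (eb : Expr) : Expr := .mul (.le eb (fullE 3 4)) (.le eb (fullE 6 7))

/-- `1` if the candidates suffice for a revolt and some state is a candidate state, otherwise
`0`. -/
def someE (eb : Expr) : Expr :=
  .mul (.sub (.add (.le eb (fullE 3 4)) (.le eb (fullE 6 7))) (bothE eb)) (.le eb (candE 1 3))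

/-- A component of the output of the first algorithm. -/
def componentE (eb : Expr) (r x y : ℕ) : Expr :=
  .add (.mul (bothE eb) (fullE x y)) (.mul (.sub (.const 1) (bothE eb))
    (.add (.mul (someE eb) (candE r x)) (.mul (.sub (.const 1) (someE eb)) (lowE x))))

/-- The first algorithm with thresholds `ea` and `eb`; the output is left in the registers `9` and
`10`. -/
def alg1Program (ea eb : Expr) : Program :=
  .seq (agentLoop ea) <| .seq (.assign 9 (componentE eb 1 3 4)) <|
  .seq (.assign 10 (componentE eb 2 6 7)) <| .seq (.assign 1 (.const 0)) <|
  .seq (.assign 2 (.const 0)) (.assign 3 (.const 0))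

/-- The list of registers: the output, the sums for the two states, the four loop counters, the
probabilities of the current neighborhood, and the pairs computed so far. -/
def regs (SA SB : ℚ) (v i j u : ℕ) (TA TB x y z w : ℚ) : List ℚ :=
  [0, SA, SB, v, i, j, u, TA, TB, x, y, z, w]

lemma bdd_regs {N M : ℕ} {SA SB TA TB x y z w : ℚ} {v i j u : ℕ} (hN : N + 2 ≤ M)
    (hA : ht SA ≤ M) (hB : ht SB ≤ M) (hv : v ≤ N) (hi : i ≤ N) (hj : j ≤ N) (hu : u ≤ N)
    (hTA : ht TA ≤ M) (hTB : ht TB ≤ M) (hx : Bdd M [x, y, z, w]) :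
    Bdd M (regs SA SB v i j u TA TB x y z w) := by
  have key : ∀ k ≤ N, ht (k : ℚ) ≤ M := fun k hk => (ht_natCast_le k).trans (by omega)
  simp only [regs, bdd_cons]
  simp only [bdd_cons] at hx
  exact ⟨by rw [ht_zero]; omega, hA, hB, key v hv, key i hi, key j hj, key u hu, hTA, hTB, hx⟩

lemma eval_memE (m : ℕ → ℚ) (l : List ℚ) (k : ℕ) : (memE k).eval (state m l) = m k := by
  simp [memE, Expr.eval, state]

section Correctness

variable {N : ℕ} {m : ℕ → ℚ} {d : List ℕ} {P : Prior} {μs ε δ : ℚ}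

lemma Setting.eval_degreeE (h : Setting N m d P μs ε δ) (SA SB : ℚ) (v i j u : ℕ)
    (TA TB x y z w : ℚ) :
    degreeE.eval (state m (regs SA SB v i j u TA TB x y z w)) = d.getD v 0 := by
  rw [← h.deg v, degreeE]
  simp only [Expr.eval]
  have : (13 : ℚ) + (state m (regs SA SB v i j u TA TB x y z w)).reg 3 = ((13 + v : ℕ) : ℚ) := by
    push_cast; rfl
  rw [this, Nat.floor_natCast]
  rfl

lemma eval_factorE {q : AgentType → ℚ} {a b c : ℕ} (h1 : m a = q .α) (h2 : m b = q .χ)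
    (h3 : m c = q .ν) (SA SB : ℚ) (v i j u : ℕ) (TA TB x y z w : ℚ) :
    (factorE a b c).eval (state m (regs SA SB v i j u TA TB x y z w)) =
      trinomialFactor q i j u := by
  simp only [factorE, Expr.eval, eval_memE, h1, h2, h3]
  rfl

lemma two_le_heightBound (h : Setting N m d P μs ε δ) : 2 ≤ heightBound N :=
  (by omega : 2 ≤ N + 2).trans (le_heightBound h.le_N)

lemma Setting.ht_mem_le (h : Setting N m d P μs ε δ) (x : ℕ) : ht (m x) ≤ heightBound N :=
  (h.ht_le x).trans ((Nat.le_add_right _ 2).trans (le_heightBound h.le_N))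

lemma Setting.ht_prod_le (h : Setting N m d P μs ε δ) (s : WorldState)
    {i j u : ℕ} (hi : i ≤ N) (hj : j ≤ N) (hu : u ≤ N) :
    ht (∏ w ∈ range u, trinomialFactor (P.typeDist s) i j w) ≤ heightBound N := by
  refine (h.ht_prod_trinomialFactor_le s hi hj hu).trans ?_
  have : N ^ 2 ≤ N ^ 5 := Nat.pow_le_pow_right (by have := h.le_N; omega) (by norm_num)
  unfold heightBound
  omega

lemma Setting.runs_trinomialLoop (h : Setting N m d P μs ε δ) {SA SB x y z w : ℚ} {v i j : ℕ}
    (hA : ht SA ≤ heightBound N) (hB : ht SB ≤ heightBound N) (hv : v ≤ N)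
    (hij : i + j ≤ d.getD v 0) (hx : Bdd (heightBound N) [x, y, z, w]) :
    Runs N (heightBound N) trinomialLoop (state m (regs SA SB v i j 0 1 1 x y z w))
      (state m (regs SA SB v i j (d.getD v 0)
        (trinomialProb (P.typeDist .A) (d.getD v 0) i j)
        (trinomialProb (P.typeDist .B) (d.getD v 0) i j) x y z w)) := by
  have hM := two_le_heightBound h
  have hk := h.deg_lt v
  have hi : i ≤ N := by omega
  have hj : j ≤ N := by omega
  have hb : ∀ u u' u'' : ℕ, u ≤ N → u' ≤ N → u'' ≤ N → Bdd (heightBound N)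
      (regs SA SB v i j u (∏ w ∈ range u', trinomialFactor (P.typeDist .A) i j w)
        (∏ w ∈ range u'', trinomialFactor (P.typeDist .B) i j w) x y z w) :=
    fun u u' u'' hu hu' hu'' => bdd_regs (le_heightBound h.le_N) hA hB hv hi hj hu
      (h.ht_prod_le _ hi hj hu') (h.ht_prod_le _ hi hj hu'') hx
  have := Runs.loop (N := N) hM h.ht_mem_le (n := d.getD v 0)
    (e := .le (.add (.reg 6) (.const 1)) degreeE)
    (s := .seq (.assign 7 (.mul (.reg 7) (factorE 3 4 5)))
      (.seq (.assign 8 (.mul (.reg 8) (factorE 6 7 8)))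
        (.assign 6 (.add (.reg 6) (.const 1)))))
    (fun u => regs SA SB v i j u (∏ w ∈ range u, trinomialFactor (P.typeDist .A) i j w)
        (∏ w ∈ range u, trinomialFactor (P.typeDist .B) i j w) x y z w) hk.le
    (fun u hu => hb u u u (by omega) (by omega) (by omega)) (fun u hu => ?_) ?_ (fun u hu => ?_)
  · simp only [prod_trinomialFactor _ hij] at this
    simp only [range_zero, prod_empty] at this
    exact this
  · simp only [Expr.eval, h.eval_degreeE]
    have : (state m (regs SA SB v i j u (∏ w ∈ range u, trinomialFactor (P.typeDist .A) i j w)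
        (∏ w ∈ range u, trinomialFactor (P.typeDist .B) i j w) x y z w)).reg 6 = (u : ℚ) := rfl
    rw [this, if_pos (by exact_mod_cast hu)]
    exact one_ne_zero
  · simp only [Expr.eval, h.eval_degreeE]
    refine if_neg ?_
    have : (state m (regs SA SB v i j (d.getD v 0)
      (∏ w ∈ range (d.getD v 0), trinomialFactor (P.typeDist .A) i j w)
        (∏ w ∈ range (d.getD v 0), trinomialFactor (P.typeDist .B) i j w) x y z w)).reg 6 =
          ((d.getD v 0 : ℕ) : ℚ) := rfl
    rw [this, not_le]
    exact lt_add_one _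
  · refine Runs.seq (c₂ := state m (regs SA SB v i j u
      (∏ w ∈ range (u + 1), trinomialFactor (P.typeDist .A) i j w)
      (∏ w ∈ range u, trinomialFactor (P.typeDist .B) i j w) x y z w)) ?_
      (Runs.seq (c₂ := state m (regs SA SB v i j u
      (∏ w ∈ range (u + 1), trinomialFactor (P.typeDist .A) i j w)
      (∏ w ∈ range (u + 1), trinomialFactor (P.typeDist .B) i j w) x y z w)) ?_ ?_)
    · refine Runs.assign hM h.ht_mem_le (hb u u u (by omega) (by omega) (by omega))
        (by simp [regs]) ?_ rfl
      simp only [Expr.eval, eval_factorE h.Aα h.Aχ h.Aν, prod_range_succ]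
      rfl
    · refine Runs.assign hM h.ht_mem_le (hb u (u + 1) u (by omega) (by omega) (by omega))
        (by simp [regs]) ?_ rfl
      simp only [Expr.eval, eval_factorE h.Bα h.Bχ h.Bν, prod_range_succ]
      rfl
    · refine Runs.assign hM h.ht_mem_le (hb u (u + 1) (u + 1) (by omega) (by omega) (by omega))
        (by simp [regs]) (q := ((u + 1 : ℕ) : ℚ)) ?_ rfl
      simp only [Expr.eval]
      push_cast
      rfl

lemma Setting.runs_contextStep (h : Setting N m d P μs ε δ) {ea : Expr} {a : ℚ}
    (hea : ∀ l, ea.eval (state m l) = a) {x y z w : ℚ} {v i j : ℕ} (hv : v < d.length)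
    (hij : i + j ≤ d.getD v 0) (hx : Bdd (heightBound N) [x, y, z, w]) :
    Runs N (heightBound N) (contextStep ea)
      (state m (regs (partialSum P a d .A v i j) (partialSum P a d .B v i j) v i j 0 0 0 x y z w))
      (state m (regs (partialSum P a d .A v i (j + 1)) (partialSum P a d .B v i (j + 1))
        v i (j + 1) 0 0 0 x y z w)) := by
  have hM := two_le_heightBound h
  have hN := le_heightBound h.le_N
  have hk := h.deg_lt v
  have hlen := h.length_le
  have hle : 30 * N ^ 5 ≤ heightBound N := by unfold heightBound; omega
  have hS : ∀ s, ht (partialSum P a d s v i j) ≤ heightBound N := fun s =>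
    (h.ht_partialSum_le a s hv.le (by omega) (by omega)).trans hle
  have hS' : ∀ s, ht (partialSum P a d s v i (j + 1)) ≤ heightBound N := fun s =>
    (h.ht_partialSum_le a s hv.le (by omega) (by omega)).trans hle
  have hT : ∀ s, ht (trinomialProb (P.typeDist s) (d.getD v 0) i j) ≤ heightBound N := by
    intro s
    rw [← prod_trinomialFactor _ hij]
    exact h.ht_prod_le s (by omega) (by omega) hk.le
  have h0 : ht 0 ≤ heightBound N := by rw [ht_zero]; exact hM
  have h1 : ht 1 ≤ heightBound N := by rw [ht_one]; exact hM
  have hb : ∀ {SA SB TA TB : ℚ} {u : ℕ}, ht SA ≤ heightBound N → ht SB ≤ heightBound N →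
      ht TA ≤ heightBound N → ht TB ≤ heightBound N → u ≤ N →
      Bdd (heightBound N) (regs SA SB v i j u TA TB x y z w) := fun hA hB hTA hTB hu =>
    bdd_regs hN hA hB (by omega) (by omega) (by omega) hu hTA hTB hx
  have hpost : ∀ SA SB : ℚ, posteriorE.eval (state m (regs SA SB v i j (d.getD v 0)
        (trinomialProb (P.typeDist .A) (d.getD v 0) i j)
        (trinomialProb (P.typeDist .B) (d.getD v 0) i j) x y z w)) =
      degreePosterior P (d.getD v 0) i j := by
    intro SA SB
    simp only [posteriorE, Expr.eval, eval_memE, h.probA, h.Aχ, h.Bχ]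
    rfl
  refine .seq (c₂ := state m (regs (partialSum P a d .A v i j) (partialSum P a d .B v i j)
    v i j 0 1 0 x y z w)) ?_ <|
    .seq (c₂ := state m (regs (partialSum P a d .A v i j) (partialSum P a d .B v i j)
    v i j 0 1 1 x y z w)) ?_ <|
    .seq (h.runs_trinomialLoop (hS _) (hS _) (hv.le.trans hlen) hij hx) <|
    .seq (c₂ := state m (regs (partialSum P a d .A v i (j + 1)) (partialSum P a d .B v i j)
      v i j (d.getD v 0) (trinomialProb (P.typeDist .A) (d.getD v 0) i j)
        (trinomialProb (P.typeDist .B) (d.getD v 0) i j) x y z w)) ?_ <|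
    .seq (c₂ := state m (regs (partialSum P a d .A v i (j + 1))
      (partialSum P a d .B v i (j + 1))
      v i j (d.getD v 0) (trinomialProb (P.typeDist .A) (d.getD v 0) i j)
        (trinomialProb (P.typeDist .B) (d.getD v 0) i j) x y z w)) ?_ <|
    .seq (c₂ := state m (regs (partialSum P a d .A v i (j + 1))
      (partialSum P a d .B v i (j + 1)) v i j (d.getD v 0) 0
        (trinomialProb (P.typeDist .B) (d.getD v 0) i j) x y z w)) ?_ <|
    .seq (c₂ := state m (regs (partialSum P a d .A v i (j + 1))
      (partialSum P a d .B v i (j + 1)) v i j (d.getD v 0) 0 0 x y z w)) ?_ <|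
    .seq (c₂ := state m (regs (partialSum P a d .A v i (j + 1))
      (partialSum P a d .B v i (j + 1)) v i j 0 0 0 x y z w)) ?_ ?_
  · exact .assign hM h.ht_mem_le (hb (hS _) (hS _) h0 h0 (Nat.zero_le _)) (by simp [regs]) rfl rfl
  · exact .assign hM h.ht_mem_le (hb (hS _) (hS _) h1 h0 (Nat.zero_le _)) (by simp [regs]) rfl rfl
  · refine .assign hM h.ht_mem_le (hb (hS _) (hS _) (hT _) (hT _) hk.le) (by simp [regs]) ?_ rfl
    simp only [Expr.eval, eval_memE, hea, hpost, partialSum_succ_j, candTerm, h.Aχ]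
    rfl
  · refine .assign hM h.ht_mem_le (hb (hS' _) (hS _) (hT _) (hT _) hk.le) (by simp [regs]) ?_ rfl
    simp only [Expr.eval, eval_memE, hea, hpost, partialSum_succ_j, candTerm, h.Bχ]
    rfl
  · exact .assign hM h.ht_mem_le (hb (hS' _) (hS' _) (hT _) (hT _) hk.le) (by simp [regs]) rfl rfl
  · exact .assign hM h.ht_mem_le (hb (hS' _) (hS' _) h0 (hT _) hk.le) (by simp [regs]) rfl rfl
  · exact .assign hM h.ht_mem_le (hb (hS' _) (hS' _) h0 h0 hk.le) (by simp [regs])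
      (q := ((0 : ℕ) : ℚ)) (by simp [Expr.eval]) rfl
  · refine .assign hM h.ht_mem_le (hb (hS' _) (hS' _) h0 h0 (Nat.zero_le _)) (by simp [regs])
      (q := ((j + 1 : ℕ) : ℚ)) ?_ rfl
    simp only [Expr.eval]
    push_cast
    rfl

/-- The list of registers at the start of an iteration of one of the three outer loops. -/
def sumRegs (P : Prior) (a : ℚ) (d : List ℕ) (v i j : ℕ) (x y z w : ℚ) : List ℚ :=
  regs (partialSum P a d .A v i j) (partialSum P a d .B v i j) v i j 0 0 0 x y z w

lemma Setting.bdd_sumRegs (h : Setting N m d P μs ε δ) (a : ℚ) {x y z w : ℚ} {v i j : ℕ}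
    (hv : v ≤ d.length) (hi : i ≤ d.getD v 0 + 1) (hj : j ≤ d.getD v 0 + 1 - i)
    (hx : Bdd (heightBound N) [x, y, z, w]) :
    Bdd (heightBound N) (sumRegs P a d v i j x y z w) := by
  have hM := two_le_heightBound h
  have hk := h.deg_lt v
  have hlen := h.length_le
  have hle : 30 * N ^ 5 ≤ heightBound N := by unfold heightBound; omega
  have h0 : ht 0 ≤ heightBound N := by rw [ht_zero]; exact hM
  exact bdd_regs (le_heightBound h.le_N) ((h.ht_partialSum_le a _ hv hi hj).trans hle)
    ((h.ht_partialSum_le a _ hv hi hj).trans hle) (by omega) (by omega) (by omega)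
    (Nat.zero_le _) h0 h0 hx

lemma Setting.runs_chiLoop (h : Setting N m d P μs ε δ) {ea : Expr} {a : ℚ}
    (hea : ∀ l, ea.eval (state m l) = a) {x y z w : ℚ} {v i : ℕ} (hv : v < d.length)
    (hi : i ≤ d.getD v 0) (hx : Bdd (heightBound N) [x, y, z, w]) :
    Runs N (heightBound N) (chiLoop ea) (state m (sumRegs P a d v i 0 x y z w))
      (state m (sumRegs P a d v i (d.getD v 0 + 1 - i) x y z w)) := by
  have hk := h.deg_lt v
  refine Runs.loop (two_le_heightBound h) h.ht_mem_le (fun j => sumRegs P a d v i j x y z w)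
    (by omega) (fun j hj => h.bdd_sumRegs a hv.le (by omega) (by omega) hx) (fun j hj => ?_) ?_
    fun j hj => h.runs_contextStep hea hv (by omega) hx
  all_goals
    simp only [Expr.eval, sumRegs, h.eval_degreeE]
    simp only [regs, state, List.getD_cons_succ, List.getD_cons_zero]
  · have : (i : ℚ) + j ≤ (d.getD v 0 : ℕ) := by exact_mod_cast (by omega : i + j ≤ d.getD v 0)
    rw [if_pos this]
    exact one_ne_zero
  · refine if_neg ?_
    have : ((d.getD v 0 : ℕ) : ℚ) < i + (d.getD v 0 + 1 - i : ℕ) := by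
      exact_mod_cast (by omega : d.getD v 0 < i + (d.getD v 0 + 1 - i))
    exact not_le.2 this

lemma Setting.runs_alphaLoop (h : Setting N m d P μs ε δ) {ea : Expr} {a : ℚ}
    (hea : ∀ l, ea.eval (state m l) = a) {x y z w : ℚ} {v : ℕ} (hv : v < d.length)
    (hx : Bdd (heightBound N) [x, y, z, w]) :
    Runs N (heightBound N) (alphaLoop ea) (state m (sumRegs P a d v 0 0 x y z w))
      (state m (sumRegs P a d v (d.getD v 0 + 1) 0 x y z w)) := by
  have hk := h.deg_lt v
  have hM := two_le_heightBound h
  refine Runs.loop hM h.ht_mem_le (fun i => sumRegs P a d v i 0 x y z w)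
    (by omega) (fun i hi => h.bdd_sumRegs a hv.le (by omega) (Nat.zero_le _) hx)
    (fun i hi => ?_) ?_ fun i hi => ?_
  · simp only [Expr.eval, sumRegs, h.eval_degreeE]
    simp only [regs, state, List.getD_cons_succ, List.getD_cons_zero]
    rw [if_pos (by exact_mod_cast Nat.lt_succ_iff.1 hi)]
    exact one_ne_zero
  · simp only [Expr.eval, sumRegs, h.eval_degreeE]
    simp only [regs, state, List.getD_cons_succ, List.getD_cons_zero]
    refine if_neg (not_le.2 ?_)
    exact_mod_cast Nat.lt_succ_self _
  · have hS : ∀ s, partialSum P a d s v i (d.getD v 0 + 1 - i) = partialSum P a d s v (i + 1) 0 :=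
      fun s => (partialSum_succ_i P a d s v i).symm
    have hb := h.bdd_sumRegs a hv.le hi.le (le_refl (d.getD v 0 + 1 - i)) hx
    simp only [sumRegs, hS] at hb
    refine .seq (h.runs_chiLoop hea hv (by omega) hx) <|
      .seq (c₂ := state m (regs (partialSum P a d .A v (i + 1) 0)
        (partialSum P a d .B v (i + 1) 0) v i 0 0 0 0 x y z w)) ?_ ?_
    · simp only [sumRegs, hS]
      exact .assign hM h.ht_mem_le hb (by simp [regs]) (q := ((0 : ℕ) : ℚ)) (by simp [Expr.eval])
        rfl
    · refine .assign hM h.ht_mem_le ?_ (by simp [regs]) (q := ((i + 1 : ℕ) : ℚ)) ?_ rfl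
      · simp only [regs, bdd_cons] at hb ⊢
        simp only [hb, true_and]
      · simp only [Expr.eval]
        push_cast
        rfl

lemma Setting.runs_agentLoop (h : Setting N m d P μs ε δ) {ea : Expr} {a : ℚ}
    (hea : ∀ l, ea.eval (state m l) = a) {x y z w : ℚ}
    (hx : Bdd (heightBound N) [x, y, z, w]) :
    Runs N (heightBound N) (agentLoop ea) (state m (sumRegs P a d 0 0 0 x y z w))
      (state m (sumRegs P a d d.length 0 0 x y z w)) := by
  have hM := two_le_heightBound h
  refine Runs.loop hM h.ht_mem_le (fun v => sumRegs P a d v 0 0 x y z w)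
    h.length_le (fun v hv => h.bdd_sumRegs a hv (by omega) (Nat.zero_le _) hx)
    (fun v hv => ?_) ?_ fun v hv => ?_
  · simp only [Expr.eval, sumRegs, eval_memE, h.n]
    simp only [regs, state, List.getD_cons_succ, List.getD_cons_zero]
    rw [if_pos (by exact_mod_cast hv)]
    exact one_ne_zero
  · simp only [Expr.eval, sumRegs, eval_memE, h.n]
    simp only [regs, state, List.getD_cons_succ, List.getD_cons_zero]
    exact if_neg (not_le.2 (lt_add_one _))
  · have hS : ∀ s, partialSum P a d s v (d.getD v 0 + 1) 0 = partialSum P a d s (v + 1) 0 0 :=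
      fun s => (partialSum_succ_v P a d s v).symm
    have hb := h.bdd_sumRegs a hv.le (le_refl (d.getD v 0 + 1)) (Nat.zero_le _) hx
    simp only [sumRegs, hS] at hb
    refine .seq (h.runs_alphaLoop hea hv hx) <|
      .seq (c₂ := state m (regs (partialSum P a d .A (v + 1) 0 0)
        (partialSum P a d .B (v + 1) 0 0) v 0 0 0 0 0 x y z w)) ?_ ?_
    · simp only [sumRegs, hS]
      exact .assign hM h.ht_mem_le hb (by simp [regs]) (q := ((0 : ℕ) : ℚ)) (by simp [Expr.eval])
        rfl
    · refine .assign hM h.ht_mem_le ?_ (by simp [regs]) (q := ((v + 1 : ℕ) : ℚ)) ?_ rfl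
      · simp only [regs, bdd_cons] at hb ⊢
        simp only [hb, true_and]
      · simp only [Expr.eval]
        push_cast
        rfl

end Correctness

end RAM

/-! ### Polynomial time for the third algorithm and for the answer -/

namespace RAM

section Output

variable {N : ℕ} {m : ℕ → ℚ} {d : List ℕ} {P : Prior} {μs ε δ : ℚ}

/-- The case distinction of the first algorithm, with products instead of branches. -/
lemma select_eq (b FA FB CA F C L : ℚ) :
    (if b ≤ FA then 1 else 0) * (if b ≤ FB then 1 else 0) * F +
      (1 - (if b ≤ FA then 1 else 0) * (if b ≤ FB then 1 else 0)) *
        (((if b ≤ FA then 1 else 0) + (if b ≤ FB then 1 else 0) -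
            (if b ≤ FA then 1 else 0) * (if b ≤ FB then 1 else 0)) *
          (if b ≤ CA then 1 else 0) * C +
        (1 - ((if b ≤ FA then 1 else 0) + (if b ≤ FB then 1 else 0) -
            (if b ≤ FA then 1 else 0) * (if b ≤ FB then 1 else 0)) *
          (if b ≤ CA then 1 else 0)) * L) =
    if FA < b ∧ FB < b then L else if b ≤ FA ∧ b ≤ FB then F else if b ≤ CA then C else L := by
  by_cases h1 : b ≤ FA <;> by_cases h2 : b ≤ FB <;> by_cases h3 : b ≤ CA <;>
    simp [h1, h2, h3, ← not_le]

lemma listAlg1_fst (d : List ℕ) (P : Prior) (a b : ℚ) : (listAlg1 d P a b).1 =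
    if d.length * (P.typeDist .A .α + P.typeDist .A .χ) / d.length < b ∧
        d.length * (P.typeDist .B .α + P.typeDist .B .χ) / d.length < b then
      d.length * P.typeDist .A .α / d.length
    else if b ≤ d.length * (P.typeDist .A .α + P.typeDist .A .χ) / d.length ∧
        b ≤ d.length * (P.typeDist .B .α + P.typeDist .B .χ) / d.length then
      d.length * (P.typeDist .A .α + P.typeDist .A .χ) / d.length
    else if b ≤ ((d.map (degreeCandProb P a .A)).sum + d.length * P.typeDist .A .α) / d.length then
      ((d.map (degreeCandProb P a .A)).sum + d.length * P.typeDist .A .α) / d.length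
    else d.length * P.typeDist .A .α / d.length := by
  unfold listAlg1
  dsimp only
  split_ifs <;> rfl

lemma listAlg1_snd (d : List ℕ) (P : Prior) (a b : ℚ) : (listAlg1 d P a b).2 =
    if d.length * (P.typeDist .A .α + P.typeDist .A .χ) / d.length < b ∧
        d.length * (P.typeDist .B .α + P.typeDist .B .χ) / d.length < b then
      d.length * P.typeDist .B .α / d.length
    else if b ≤ d.length * (P.typeDist .A .α + P.typeDist .A .χ) / d.length ∧
        b ≤ d.length * (P.typeDist .B .α + P.typeDist .B .χ) / d.length then
      d.length * (P.typeDist .B .α + P.typeDist .B .χ) / d.length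
    else if b ≤ ((d.map (degreeCandProb P a .A)).sum + d.length * P.typeDist .A .α) / d.length then
      ((d.map (degreeCandProb P a .B)).sum + d.length * P.typeDist .B .α) / d.length
    else d.length * P.typeDist .B .α / d.length := by
  unfold listAlg1
  dsimp only
  split_ifs <;> rfl

lemma Setting.runs_alg1Program (h : Setting N m d P μs ε δ) {ea eb : Expr} {a b : ℚ}
    (hea : ∀ l, ea.eval (state m l) = a) (heb : ∀ l, eb.eval (state m l) = b) {x y z w : ℚ}
    (hx : Bdd (heightBound N) [x, y, z, w]) :
    Runs N (heightBound N) (alg1Program ea eb) (state m (regs 0 0 0 0 0 0 0 0 x y z w))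
      (state m (regs 0 0 0 0 0 0 0 0 (listAlg1 d P a b).1 (listAlg1 d P a b).2 z w)) := by
  have hM := two_le_heightBound h
  have h0 : ht 0 ≤ heightBound N := by rw [ht_zero]; exact hM
  have hX := h.ht_listAlg1_le a b
  have hloop := h.runs_agentLoop hea hx
  have hS := h.bdd_sumRegs a (i := 0) (j := 0) le_rfl (Nat.zero_le _) (Nat.zero_le _) hx
  simp only [sumRegs, partialSum_zero, partialSum_length] at hloop hS
  have hb : ∀ {SA SB x' y' : ℚ}, ht SA ≤ heightBound N → ht SB ≤ heightBound N →
      ht x' ≤ heightBound N → ht y' ≤ heightBound N →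
      Bdd (heightBound N) (regs SA SB d.length 0 0 0 0 0 x' y' z w) := by
    intro SA SB x' y' hA hB hx' hy'
    simp only [bdd_cons] at hx
    exact bdd_regs (le_heightBound h.le_N) hA hB h.length_le (Nat.zero_le _) (Nat.zero_le _)
      (Nat.zero_le _) h0 h0 (by simp only [bdd_cons]; exact ⟨hx', hy', hx.2.2⟩)
  have hSA : ht ((d.map (degreeCandProb P a .A)).sum) ≤ heightBound N := hS _ (by simp [regs])
  have hSB : ht ((d.map (degreeCandProb P a .B)).sum) ≤ heightBound N := hS _ (by simp [regs])
  refine .seq hloop <|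
    .seq (c₂ := state m (regs (d.map (degreeCandProb P a .A)).sum
      (d.map (degreeCandProb P a .B)).sum d.length 0 0 0 0 0 (listAlg1 d P a b).1 y z w)) ?_ <|
    .seq (c₂ := state m (regs (d.map (degreeCandProb P a .A)).sum
      (d.map (degreeCandProb P a .B)).sum d.length 0 0 0 0 0 (listAlg1 d P a b).1
        (listAlg1 d P a b).2 z w)) ?_ <|
    .seq (c₂ := state m (regs 0 (d.map (degreeCandProb P a .B)).sum d.length 0 0 0 0 0
        (listAlg1 d P a b).1 (listAlg1 d P a b).2 z w)) ?_ <|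
    .seq (c₂ := state m (regs 0 0 d.length 0 0 0 0 0
        (listAlg1 d P a b).1 (listAlg1 d P a b).2 z w)) ?_ ?_
  · refine .assign hM h.ht_mem_le hS (by simp [regs]) ?_ rfl
    rw [listAlg1_fst, ← select_eq]
    simp only [componentE, bothE, someE, fullE, lowE, candE, Expr.eval, eval_memE, heb, h.n, h.Aα,
      h.Aχ, h.Bα, h.Bχ]
    rfl
  · have hy : ht y ≤ heightBound N := hx y (by simp)
    refine .assign hM h.ht_mem_le (hb hSA hSB hX.1 hy) (by simp [regs]) ?_ rfl
    rw [listAlg1_snd, ← select_eq]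
    simp only [componentE, bothE, someE, fullE, lowE, candE, Expr.eval, eval_memE, heb, h.n, h.Aα,
      h.Aχ, h.Bα, h.Bχ]
    rfl
  · exact .assign hM h.ht_mem_le (hb hSA hSB hX.1 hX.2) (by simp [regs]) rfl rfl
  · exact .assign hM h.ht_mem_le (hb h0 hSB hX.1 hX.2) (by simp [regs]) rfl rfl
  · exact .assign hM h.ht_mem_le (hb h0 h0 hX.1 hX.2) (by simp [regs]) (q := ((0 : ℕ) : ℚ))
      (by simp [Expr.eval]) rfl

/-- The threshold `p + δ / 3`. -/
def raisedP : Expr := .add (memE 1) (.div (memE 12) (.const 3))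

/-- The threshold `μ + ε / 3`. -/
def raisedμ : Expr := .add (memE 2) (.div (memE 11) (.const 3))

/-- The threshold `p - δ / 3`. -/
def loweredP : Expr := .sub (memE 1) (.div (memE 12) (.const 3))

/-- The threshold `μ - ε / 3`. -/
def loweredμ : Expr := .sub (memE 2) (.div (memE 11) (.const 3))

/-- Runs the first algorithm with raised thresholds, leaving its output in the registers `11` and
`12`, then with lowered thresholds, leaving its output in the registers `9` and `10`, and finally
evaluates `out`. -/
def twoRunsProgram (out : Expr) : Program :=
  .seq (alg1Program raisedP raisedμ) <| .seq (.assign 11 (.reg 9)) <|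
  .seq (.assign 12 (.reg 10)) <| .seq (alg1Program loweredP loweredμ) (.assign 0 out)

/-- The output pair `(X_A, X_B)` of the first algorithm for raised thresholds. -/
def raisedX (d : List ℕ) (P : Prior) (ε δ : ℚ) : ℚ × ℚ :=
  listAlg1 d P (P.p + δ / 3) (P.μ + ε / 3)

/-- The output pair `(X_A, X_B)` of the first algorithm for lowered thresholds. -/
def loweredX (d : List ℕ) (P : Prior) (ε δ : ℚ) : ℚ × ℚ :=
  listAlg1 d P (P.p - δ / 3) (P.μ - ε / 3)

lemma Setting.runs_twoRunsProgram (h : Setting N m d P μs ε δ) {out : Expr} {q : ℚ}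
    (hq : out.eval (state m (regs 0 0 0 0 0 0 0 0 (loweredX d P ε δ).1 (loweredX d P ε δ).2
      (raisedX d P ε δ).1 (raisedX d P ε δ).2)) = q) :
    Runs N (heightBound N) (twoRunsProgram out) (state m (regs 0 0 0 0 0 0 0 0 0 0 0 0))
      (state m ((regs 0 0 0 0 0 0 0 0 (loweredX d P ε δ).1 (loweredX d P ε δ).2
        (raisedX d P ε δ).1 (raisedX d P ε δ).2).set 0 q)) := by
  have hM := two_le_heightBound h
  have h0 : ht 0 ≤ heightBound N := by rw [ht_zero]; exact hM
  have hb : ∀ {x y z w : ℚ}, ht x ≤ heightBound N → ht y ≤ heightBound N →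
      ht z ≤ heightBound N → ht w ≤ heightBound N →
      Bdd (heightBound N) [x, y, z, w] := by
    intro x y z w hx hy hz hw
    simp only [bdd_cons]
    exact ⟨hx, hy, hz, hw, bdd_nil⟩
  have hb' : ∀ {x y z w : ℚ}, ht x ≤ heightBound N → ht y ≤ heightBound N →
      ht z ≤ heightBound N → ht w ≤ heightBound N →
      Bdd (heightBound N) (regs 0 0 0 0 0 0 0 0 x y z w) := fun hx hy hz hw =>
    bdd_regs (le_heightBound h.le_N) h0 h0 (Nat.zero_le _) (Nat.zero_le _) (Nat.zero_le _)
      (Nat.zero_le _) h0 h0 (hb hx hy hz hw)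
  obtain ⟨hX1, hX2⟩ := h.ht_listAlg1_le (P.p + δ / 3) (P.μ + ε / 3)
  obtain ⟨hY1, hY2⟩ := h.ht_listAlg1_le (P.p - δ / 3) (P.μ - ε / 3)
  have e1 : ∀ l, raisedP.eval (state m l) = P.p + δ / 3 := fun l => by
    simp only [raisedP, Expr.eval, eval_memE, h.p, h.δ]
  have e2 : ∀ l, raisedμ.eval (state m l) = P.μ + ε / 3 := fun l => by
    simp only [raisedμ, Expr.eval, eval_memE, h.μ, h.ε]
  have e3 : ∀ l, loweredP.eval (state m l) = P.p - δ / 3 := fun l => by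
    simp only [loweredP, Expr.eval, eval_memE, h.p, h.δ]
  have e4 : ∀ l, loweredμ.eval (state m l) = P.μ - ε / 3 := fun l => by
    simp only [loweredμ, Expr.eval, eval_memE, h.μ, h.ε]
  exact .seq (h.runs_alg1Program e1 e2 (hb h0 h0 h0 h0)) <|
    .seq (.assign hM h.ht_mem_le (hb' hX1 hX2 h0 h0) (by simp [regs]) rfl rfl) <|
    .seq (.assign hM h.ht_mem_le (hb' hX1 hX2 hX1 h0) (by simp [regs]) rfl rfl) <|
    .seq (h.runs_alg1Program e3 e4 (hb hX1 hX2 hX1 hX2))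
      (.assign hM h.ht_mem_le (hb' hY1 hY2 hX1 hX2) (by simp [regs]) hq rfl)

lemma setting_encodeInput {n : ℕ} {G : SimpleGraph (Fin n)} [DecidableRel G.Adj] {d : List ℕ}
    (hd : IsDegreeSequence G d) (P : Prior) (μs ε δ : ℚ) :
    Setting (inputSize (encodeInput d P μs ε δ)) (init (encodeInput d P μs ε δ)).mem
      d P μs ε δ := by
  set l := encodeInput d P μs ε δ with hl
  have hlen : l.length = 13 + d.length := by simp [hl, encodeInput]; omega
  have hsize : l.length ≤ inputSize l := by
    have := List.length_le_sum_of_one_le (l.map bits) (by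
      simp only [List.mem_map]
      rintro _ ⟨q, -, rfl⟩
      exact Nat.le_add_left _ _)
    simpa [inputSize] using this
  refine ⟨rfl, rfl, rfl, rfl, rfl, rfl, rfl, rfl, rfl, rfl, rfl, rfl, rfl, fun v => ?_, by omega,
    by omega, fun v => ?_, fun x => ?_⟩
  · change (encodeInput d P μs ε δ).getD (13 + v) 0 = _
    rw [encodeInput, List.getD_append_right _ _ _ _ (by simp)]
    simp only [List.length_cons, List.length_nil]
    rw [show 13 + v - (0 + 1 + 1 + 1 + 1 + 1 + 1 + 1 + 1 + 1 + 1 + 1 + 1 + 1) = v by omega]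
    have h0 := List.getD_map d 0 (n := v) (fun k : ℕ => (k : ℚ))
    rw [← h0, Nat.cast_zero]
    congr 1
    simp only [List.map_id']
    exact List.map_eq_flatMap.symm
  · by_cases hv : v < d.length
    · rw [List.getD_eq_getElem _ _ hv]
      have h1 : d[v] ∈ (d : Multiset ℕ) := List.getElem_mem hv
      rw [hd] at h1
      obtain ⟨u, -, hu⟩ := Multiset.mem_map.1 h1
      have h2 := G.degree_lt_card_verts u
      rw [Fintype.card_fin, hu, ← hd.length_eq] at h2
      omega
    · rw [List.getD_eq_default _ _ (not_lt.1 hv)]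
      omega
  · change ht (l.getD x 0) ≤ _
    by_cases hx : x < l.length
    · rw [List.getD_eq_getElem _ _ hx]
      refine (ht_le_bits _).trans ?_
      exact List.single_le_sum (by simp) _ (List.mem_map_of_mem (List.getElem_mem hx))
    · rw [List.getD_eq_default _ _ (not_lt.1 hx), ht_zero]
      omega

/-- A function of the two outputs of the first algorithm that an expression evaluates is computable
in polynomial time. -/
lemma polyTimeFromDegrees_of_eval {f : List ℕ → Prior → ℚ → ℚ → ℚ → Option Outcome} (out : Expr)
    (hout : ∀ {N : ℕ} {m : ℕ → ℚ} {d : List ℕ} {P : Prior} {μs ε δ : ℚ},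
      Setting N m d P μs ε δ →
      out.eval (state m (regs 0 0 0 0 0 0 0 0 (loweredX d P ε δ).1 (loweredX d P ε δ).2
        (raisedX d P ε δ).1 (raisedX d P ε δ).2)) = encodeOutput (f d P μs ε δ)) :
    PolyTimeFromDegrees f := by
  refine ⟨twoRunsProgram out, (twoRunsProgram out).boundPoly (40 * Polynomial.X ^ 5), ?_⟩
  intro n G _ d hd P μs ε δ _ _ _ _ _
  have h := setting_encodeInput hd P μs ε δ
  obtain ⟨k, hk, hex⟩ := h.runs_twoRunsProgram (hout h)
  have hinit : init (encodeInput d P μs ε δ) =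
      state (init (encodeInput d P μs ε δ)).mem (regs 0 0 0 0 0 0 0 0 0 0 0 0) := by
    simp only [init, state, Config.mk.injEq, and_true]
    funext x
    have : regs 0 0 0 0 0 0 0 0 0 0 0 0 = List.replicate 13 (0 : ℚ) := by
      simp [regs, List.replicate]
    rw [this]
    by_cases hx : x < 13
    · rw [List.getD_eq_getElem _ _ (by simpa using hx), List.getElem_replicate]
    · rw [List.getD_eq_default _ _ (by simpa using hx)]
  rw [← hinit] at hex
  refine ⟨k, _, hex, ?_, rfl⟩
  rw [Program.eval_boundPoly]
  simpa [heightBound] using hk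

/-- The code of the answer of the second algorithm; the registers `r` and `r'` hold its input. -/
def alg2E (r r' : ℕ) : Expr :=
  .add (.mul (.le (memE 10) (.reg r)) (.sub (.const 2) (.le (memE 10) (.reg r'))))
    (.mul (.sub (.const 1) (.le (memE 10) (.reg r)))
      (.mul (.const 3) (.sub (.const 1) (.le (memE 10) (.reg r')))))

lemma encodeOutput_alg2 (X : ℚ × ℚ) (μs : ℚ) :
    (if μs ≤ X.1 then 1 else 0) * (2 - if μs ≤ X.2 then 1 else 0) +
      (1 - if μs ≤ X.1 then 1 else 0) * (3 * (1 - if μs ≤ X.2 then 1 else 0)) =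
      encodeOutput (alg2 X μs) := by
  unfold alg2
  by_cases h1 : μs ≤ X.1 <;> by_cases h2 : μs ≤ X.2 <;>
    simp [h1, h2, ← not_le, encodeOutput]
  norm_num

lemma encodeOutput_injective : Function.Injective encodeOutput := by
  rintro (_ | _ | _ | _) (_ | _ | _ | _) h <;> simp_all [encodeOutput]

/-- The code of the answer of the third algorithm. -/
def alg3E : Expr :=
  .mul (.mul (.le (alg2E 11 12) (alg2E 9 10)) (.le (alg2E 9 10) (alg2E 11 12))) (alg2E 11 12)

/-- The third algorithm on a degree sequence. -/
def listAlg3 (d : List ℕ) (P : Prior) (μs ε δ : ℚ) : Option Outcome :=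
  if alg2 (raisedX d P ε δ) μs = alg2 (loweredX d P ε δ) μs then alg2 (raisedX d P ε δ) μs else none

lemma polyTimeFromDegrees_listAlg3 : PolyTimeFromDegrees listAlg3 := by
  refine polyTimeFromDegrees_of_eval alg3E fun {N m d P μs ε δ} h => ?_
  have h1 : ∀ l r r', (alg2E r r').eval (state m l) =
      encodeOutput (alg2 (l.getD r 0, l.getD r' 0) μs) := by
    intro l r r'
    rw [← encodeOutput_alg2]
    simp only [alg2E, Expr.eval, eval_memE, h.μs]
    rfl
  simp only [alg3E, Expr.eval, h1]
  simp only [regs, List.getD_cons_succ, List.getD_cons_zero]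
  change (if encodeOutput (alg2 (raisedX d P ε δ) μs) ≤ encodeOutput (alg2 (loweredX d P ε δ) μs)
      then 1 else 0) *
    (if encodeOutput (alg2 (loweredX d P ε δ) μs) ≤ encodeOutput (alg2 (raisedX d P ε δ) μs)
      then 1 else 0) * encodeOutput (alg2 (raisedX d P ε δ) μs) = _
  unfold listAlg3
  by_cases heq : alg2 (raisedX d P ε δ) μs = alg2 (loweredX d P ε δ) μs
  · simp [heq]
  · have hne := fun h => heq (encodeOutput_injective h)
    rw [if_neg heq, show encodeOutput none = 0 from rfl]
    rcases lt_or_gt_of_ne hne with h2 | h2 <;> simp [h2.not_ge]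

/-- The answer to the problem: `Ω` if both outputs for lowered thresholds reach `μ* - ε / 2`, the
empty outcome if neither output for raised thresholds exceeds `μ* + ε / 2`, otherwise `A`. -/
def answer (d : List ℕ) (P : Prior) (μs ε δ : ℚ) : Option Outcome :=
  if μs - ε / 2 ≤ (loweredX d P ε δ).1 ∧ μs - ε / 2 ≤ (loweredX d P ε δ).2 then some .Omega
  else if (raisedX d P ε δ).1 ≤ μs + ε / 2 ∧ (raisedX d P ε δ).2 ≤ μs + ε / 2 then some .empty
  else some .stateA

/-- The code of `answer`. -/
def answerE : Expr :=
  let t : Expr := .sub (memE 10) (.div (memE 11) (.const 2))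
  let t' : Expr := .add (memE 10) (.div (memE 11) (.const 2))
  let o : Expr := .mul (.le t (.reg 9)) (.le t (.reg 10))
  let e : Expr := .mul (.le (.reg 11) t') (.le (.reg 12) t')
  .add o (.mul (.sub (.const 1) o) (.add (.const 2) e))

lemma polyTimeFromDegrees_answer : PolyTimeFromDegrees answer := by
  refine polyTimeFromDegrees_of_eval answerE fun {N m d P μs ε δ} h => ?_
  simp only [answerE, Expr.eval, eval_memE, h.μs, h.ε]
  simp only [regs, state, List.getD_cons_succ, List.getD_cons_zero]
  unfold answer
  by_cases h1 : μs - ε / 2 ≤ (loweredX d P ε δ).1 <;>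
    by_cases h2 : μs - ε / 2 ≤ (loweredX d P ε δ).2 <;>
    by_cases h3 : (raisedX d P ε δ).1 ≤ μs + ε / 2 <;>
    by_cases h4 : (raisedX d P ε δ).2 ≤ μs + ε / 2 <;>
    simp [h1, h2, h3, h4, encodeOutput] <;> norm_num

end Output

end RAM

/-! ### Probabilities of revolts -/

section Promise

variable {n : ℕ} (G : SimpleGraph (Fin n)) [DecidableRel G.Adj] {P : Prior}

lemma sum_worldProb_eq_stateProb (hP : P.Valid) (s : WorldState) :
    ∑ t : Fin n → AgentType, worldProb P (s, t) = P.stateProb s := by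
  simp only [worldProb, ← mul_sum, sum_typesProb hP, mul_one]

lemma sum_filter_worldProb_le_stateProb (hP : P.Valid) (s : WorldState)
    (Q : (Fin n → AgentType) → Prop) [DecidablePred Q] :
    ∑ t with Q t, worldProb P (s, t) ≤ P.stateProb s := by
  rw [← sum_worldProb_eq_stateProb (n := n) hP s]
  exact sum_le_sum_of_subset_of_nonneg (filter_subset _ _) fun t _ _ => worldProb_nonneg hP _

lemma revoltProb_eq (σ : Fin n → Strategy) (a b m : ℚ) :
    revoltProb G (P.withThresholds a b) σ m =
      ∑ t with m * n ≤ (#(revolters G σ t) : ℚ), worldProb P (.A, t) +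
        ∑ t with m * n ≤ (#(revolters G σ t) : ℚ), worldProb P (.B, t) := by
  rw [revoltProb, sum_filter_world, sum_worldState]
  rfl

lemma revoltProb_nonneg (hP : P.Valid) (σ : Fin n → Strategy) (a b m : ℚ) :
    0 ≤ revoltProb G (P.withThresholds a b) σ m :=
  sum_nonneg fun w _ => (worldProb_withThresholds P a b w).symm ▸ worldProb_nonneg hP w

lemma revoltProb_le_one (hP : P.Valid) (σ : Fin n → Strategy) (a b m : ℚ) :
    revoltProb G (P.withThresholds a b) σ m ≤ 1 := by
  rw [revoltProb_eq]
  refine (add_le_add (sum_filter_worldProb_le_stateProb hP _ _)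
    (sum_filter_worldProb_le_stateProb hP _ _)).trans (le_of_eq ?_)
  simp [Prior.stateProb]

/-- Equilibria exist, and only finitely many probabilities are possible, so that the largest one is
attained. -/
lemma exists_supportedWithProb (hP : P.Valid) (a b m : ℚ) :
    ∃ q, SupportedWithProb G (P.withThresholds a b) m q := by
  obtain ⟨σ, hσ, -⟩ := exists_isEquilibrium_ge G hP (worldProb_withThresholds P a b)
    (fun _ c => c.1 = .α) (fun v c h => by simp [h])
    (fun v c h h' => by rw [h] at h'; cases h')
  have hfin : {x | ∃ σ, IsEquilibrium G (P.withThresholds a b) σ ∧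
      x = revoltProb G (P.withThresholds a b) σ m}.Finite := by
    refine (univ.powerset.image fun W : Finset (WorldState × (Fin n → AgentType)) =>
      ∑ w ∈ W, worldProb (P.withThresholds a b) w).finite_toSet.subset ?_
    rintro _ ⟨σ, -, rfl⟩
    exact mem_coe.2 (mem_image.2 ⟨_, mem_powerset.2 (subset_univ _), rfl⟩)
  obtain ⟨q, hq, hmax⟩ := Set.exists_max_image _ id hfin ⟨_, σ, hσ, rfl⟩
  exact ⟨q, hq, fun x hx => hmax x hx⟩

/-- Few revolters are unlikely, so many are likely. -/
lemma stateProb_sub_le (hP : P.Valid) (σ : Fin n → Strategy) (s : WorldState) {m m' q : ℚ}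
    (hm : m ≤ m') (h : ∑ t with (#(revolters G σ t) : ℚ) < m' * n, worldProb P (s, t) ≤ q) :
    P.stateProb s - q ≤ ∑ t with m * n ≤ (#(revolters G σ t) : ℚ), worldProb P (s, t) := by
  have h1 := sum_filter_add_sum_filter_not univ
    (fun t => m * n ≤ (#(revolters G σ t) : ℚ)) fun t => worldProb P (s, t)
  rw [sum_worldProb_eq_stateProb hP] at h1
  have h2 : ∑ t with ¬ m * n ≤ (#(revolters G σ t) : ℚ), worldProb P (s, t) ≤
      ∑ t with (#(revolters G σ t) : ℚ) < m' * n, worldProb P (s, t) :=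
    sum_le_sum_of_subset_of_nonneg (fun t => by
      simp only [mem_filter_univ, not_le]
      exact fun h => h.trans_le (mul_le_mul_of_nonneg_right hm (Nat.cast_nonneg n)))
      fun t _ _ => worldProb_nonneg hP _
  linarith

lemma sum_worldProb_filter_mono (hP : P.Valid) (σ : Fin n → Strategy) (s : WorldState) {m m' : ℚ}
    (hm : m ≤ m') : ∑ t with m' * n ≤ (#(revolters G σ t) : ℚ), worldProb P (s, t) ≤
      ∑ t with m * n ≤ (#(revolters G σ t) : ℚ), worldProb P (s, t) :=
  sum_le_sum_of_subset_of_nonneg (fun t => by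
    simp only [mem_filter_univ]
    exact (mul_le_mul_of_nonneg_right hm (Nat.cast_nonneg n)).trans)
    fun t _ _ => worldProb_nonneg hP _

/-! ### The cases of the problem -/

lemma SolvesInstance.of_caseTrue {μs ε δ : ℚ} {o : Outcome} (h : CaseTrue G P μs ε δ o) :
    SolvesInstance G P μs ε δ (some o) := fun _ _ hs => congrArg some (hs o h)

/-- For `δ ≥ 1` the cases `Ω` and `∅` are both true, so that every answer is admissible. -/
lemma solvesInstance_of_one_le (hP : P.Valid) (μs ε : ℚ) {δ : ℚ} (hδ : 1 ≤ δ)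
    (o : Option Outcome) : SolvesInstance G P μs ε δ o := by
  intro s _ hs
  have h1 : CaseTrue G P μs ε δ .Omega := by
    obtain ⟨q, hq⟩ := exists_supportedWithProb G hP (P.p - δ) (P.μ - ε) (μs - ε)
    obtain ⟨σ, -, rfl⟩ := hq.1
    exact ⟨_, hq, (sub_nonpos.2 hδ).trans (revoltProb_nonneg G hP _ _ _ _)⟩
  have h2 : CaseTrue G P μs ε δ .empty := by
    obtain ⟨q, hq⟩ := exists_supportedWithProb G hP (P.p + δ) (P.μ + ε) (μs + ε)
    obtain ⟨σ, -, rfl⟩ := hq.1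
    exact ⟨_, hq, (revoltProb_le_one G hP _ _ _ _).trans hδ⟩
  cases (hs _ h1).trans (hs _ h2).symm

variable {μs ε δ η : ℚ}

lemma caseTrue_Omega (hP : P.Valid) (hδ : 0 < δ) (hε : 0 < ε) (hc : Concentrated G P (ε / 3) η)
    (hη0 : 0 ≤ η) (hηδ : η ≤ δ / 3)
    (hX : ∀ s, μs - ε / 2 ≤
      stateComponent (alg1 G (P.withThresholds (P.p - δ / 3) (P.μ - ε / 3))) s) :
    CaseTrue G P μs ε δ .Omega := by
  obtain ⟨σ, hσ, hfail⟩ := exists_isEquilibrium_sum_worldProb_lt_le G hP (p' := P.p - δ)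
    (μ' := P.μ - ε) (a := P.p - δ / 3) (b := P.μ - ε / 3) hc hη0
    (by linarith [hP.p_lt_one]) (by linarith) (by linarith)
  obtain ⟨q, hq⟩ := exists_supportedWithProb G hP (P.p - δ) (P.μ - ε) (μs - ε)
  refine ⟨q, hq, le_trans ?_ (hq.2 ⟨σ, hσ, rfl⟩)⟩
  have h := fun s => stateProb_sub_le G hP σ s (m := μs - ε) (by linarith [hX s]) (hfail s)
  have hA := h .A
  have hB := h .B
  rw [revoltProb_eq]
  simp only [Prior.stateProb] at hA hB
  linarith

lemma caseTrue_empty (hP : P.Valid) (hδ : 0 < δ) (hε : 0 < ε) (hc : Concentrated G P (ε / 3) η)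
    (hη0 : 0 ≤ η) (hηδ : η ≤ δ / 3)
    (hX : ∀ s, stateComponent (alg1 G (P.withThresholds (P.p + δ / 3) (P.μ + ε / 3))) s ≤
      μs + ε / 2) :
    CaseTrue G P μs ε δ .empty := by
  obtain ⟨q, hq⟩ := exists_supportedWithProb G hP (P.p + δ) (P.μ + ε) (μs + ε)
  refine ⟨q, hq, ?_⟩
  obtain ⟨σ, hσ, rfl⟩ := hq.1
  have h := fun s => (sum_worldProb_filter_mono G hP σ s (m' := μs + ε)
    (by linarith [hX s])).trans (hσ.sum_worldProb_ge_le G hP (p' := P.p + δ) (μ' := P.μ + ε)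
      (a := P.p + δ / 3) (b := P.μ + ε / 3) hc (by linarith [hP.p_pos]) hη0
      (by linarith [hP.p_pos]) (by linarith) (by linarith) s)
  have hA := h .A
  have hB := h .B
  rw [revoltProb_eq]
  simp only [Prior.stateProb] at hA hB
  linarith

/-- If `X_A` exceeds `μ*` at the raised thresholds, some equilibrium has a large revolt in state
`A`; if `X_B` stays below `μ*` at the lowered thresholds, no equilibrium has one in state `B`. -/
lemma caseTrue_stateA (hP : P.Valid) (hδ : 0 < δ) (hε : 0 < ε) (hc : Concentrated G P (ε / 3) η)
    (hη0 : 0 ≤ η) (hηδ : η ≤ δ / 3) (hηp : η < P.p) (hηp' : η ≤ 1 - P.p)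
    (hA : μs + ε / 2 ≤ (alg1 G (P.withThresholds (P.p + δ / 3) (P.μ + ε / 3))).1)
    (hB : (alg1 G (P.withThresholds (P.p - δ / 3) (P.μ - ε / 3))).2 ≤ μs - ε / 2) :
    CaseTrue G P μs ε δ .stateA := by
  obtain ⟨q, hq⟩ := exists_supportedWithProb G hP P.p P.μ μs
  refine ⟨q, hq, ?_, ?_⟩
  · obtain ⟨σ, hσ, hfail⟩ := exists_isEquilibrium_sum_worldProb_lt_le G hP (p' := P.p)
      (μ' := P.μ) (a := P.p + δ / 3) (b := P.μ + ε / 3) hc hη0 hηp' (by linarith) (by linarith)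
    refine le_trans ?_ (hq.2 ⟨σ, hσ, rfl⟩)
    have h := stateProb_sub_le G hP σ .A (m := μs)
      (by simp only [stateComponent]; linarith) (hfail .A)
    have h0 : 0 ≤ ∑ t with μs * n ≤ (#(revolters G σ t) : ℚ), worldProb P (.B, t) :=
      sum_nonneg fun t _ => worldProb_nonneg hP _
    rw [revoltProb_eq]
    simp only [Prior.stateProb] at h
    linarith [mul_le_of_le_one_right hη0 hP.probA_le_one]
  · obtain ⟨σ, hσ, rfl⟩ := hq.1
    have h := (sum_worldProb_filter_mono G hP σ .B (m' := μs)
      (by simp only [stateComponent]; linarith)).trans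
      (hσ.sum_worldProb_ge_le G hP (p' := P.p) (μ' := P.μ) (a := P.p - δ / 3) (b := P.μ - ε / 3)
        hc hP.p_pos.le hη0 hηp (by linarith) (by linarith) .B)
    have h1 := sum_filter_worldProb_le_stateProb hP .A
      fun t => μs * n ≤ (#(revolters G σ t) : ℚ)
    rw [revoltProb_eq]
    simp only [Prior.stateProb] at h h1
    linarith [mul_le_of_le_one_right hη0 (sub_le_self 1 hP.probA_nonneg)]

/-- Under concentration, the case of the answer is true. -/
lemma solvesInstance_answer (hP : P.Valid) {d : List ℕ} (hd : IsDegreeSequence G d) (hδ : 0 < δ)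
    (hε : 0 < ε) (hc : Concentrated G P (ε / 3) η) (hη0 : 0 ≤ η) (hηδ : η ≤ δ / 3) (hηp : η < P.p)
    (hηp' : η ≤ 1 - P.p) (hl : CorrectlyLabeled G P ε δ) :
    SolvesInstance G P μs ε δ (RAM.answer d P μs ε δ) := by
  have hr := hl (P.p + δ / 3) (P.μ + ε / 3)
    (by rw [add_sub_cancel_left, abs_of_pos] <;> linarith)
    (by rw [add_sub_cancel_left, abs_of_pos] <;> linarith)
  have hlo := hl (P.p - δ / 3) (P.μ - ε / 3)
    (by rw [sub_sub_cancel_left, abs_neg, abs_of_pos] <;> linarith)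
    (by rw [sub_sub_cancel_left, abs_neg, abs_of_pos] <;> linarith)
  unfold RAM.answer RAM.raisedX RAM.loweredX
  simp only [← alg1_eq_listAlg1 G hd hP]
  split_ifs with h1 h2
  · exact .of_caseTrue G (caseTrue_Omega G hP hδ hε hc hη0 hηδ fun s => by
      cases s; exacts [h1.1, h1.2])
  · exact .of_caseTrue G (caseTrue_empty G hP hδ hε hc hη0 hηδ fun s => by
      cases s; exacts [h2.1, h2.2])
  · refine .of_caseTrue G (caseTrue_stateA G hP hδ hε hc hη0 hηδ hηp hηp' ?_ ?_)
    · by_contra h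
      exact h2 ⟨(not_le.1 h).le, hr.trans (not_le.1 h).le⟩
    · by_contra h
      exact h1 ⟨(not_le.1 h).le.trans hlo, (not_le.1 h).le⟩

end Promise

/-! ### Exponentially small tails -/

/-- For maximum degree `O(n^{1/3})` the squared Lipschitz constants add up to `O(n^{5/3})`, so that
linear deviations have probability `exp(-Ω(n^{1/3}))`. -/
lemma eventually_concentrated {ε C : ℝ} (hε : 0 < ε) {q : ℝ} (hq : 0 < q) :
    ∃ c : ℝ, 0 < c ∧ ∀ᶠ n : ℕ in atTop, 0 < n ∧ ∃ D : ℝ,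
      C * (n : ℝ) ^ (1 / 3 : ℝ) + 1 ≤ D ∧ D ^ 2 + 1 ≤ ε * n / 2 ∧
      Real.exp (-((ε * n / 2) ^ 2 / (2 * n * D ^ 2))) ≤ q ∧
      3 * Real.exp (-((ε * n / 2) ^ 2 / (2 * n * D ^ 2))) ≤
        Real.exp (-(c * (n : ℝ) ^ (1 / 3 : ℝ))) := by
  set K : ℝ := max C 0 + 1 with hK
  have hK0 : 0 < K := by positivity
  have hCK : C + 1 ≤ K := by rw [hK]; linarith [le_max_left C 0]
  set c : ℝ := ε ^ 2 / (16 * K ^ 2) with hc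
  have hc0 : 0 < c := by positivity
  have hx : Tendsto (fun n : ℕ => (n : ℝ) ^ (1 / 3 : ℝ)) atTop atTop :=
    (tendsto_rpow_atTop (by norm_num)).comp tendsto_natCast_atTop_atTop
  have hexp : Tendsto (fun n : ℕ => Real.exp (-(c * (n : ℝ) ^ (1 / 3 : ℝ)))) atTop (nhds 0) :=
    Real.tendsto_exp_neg_atTop_nhds_zero.comp (hx.const_mul_atTop hc0)
  refine ⟨c, hc0, ?_⟩
  filter_upwards [eventually_gt_atTop 0, hx.eventually_ge_atTop 1,
    hx.eventually_ge_atTop (2 * (K ^ 2 + 1) / ε), hexp.eventually_le_const hq,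
    hexp.eventually_le_const (show (0 : ℝ) < 1 / 3 by norm_num)] with n hn h1 h2 h3 h4
  set x : ℝ := (n : ℝ) ^ (1 / 3 : ℝ) with hxn
  have hnx : (n : ℝ) = x ^ 3 := by
    rw [hxn, ← Real.rpow_natCast, ← Real.rpow_mul (Nat.cast_nonneg n)]; norm_num
  have hx0 : 0 < x := by linarith
  -- the bound on the tails is the square of the bound to be proved
  have htail : Real.exp (-((ε * n / 2) ^ 2 / (2 * n * (K * x) ^ 2))) =
      Real.exp (-(c * x)) * Real.exp (-(c * x)) := by
    rw [← Real.exp_add]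
    congr 1
    rw [hnx, hc]
    field_simp
    ring
  have he := Real.exp_pos (-(c * x))
  refine ⟨hn, K * x, ?_, ?_, ?_, ?_⟩
  · have := mul_le_mul_of_nonneg_right hCK hx0.le
    linarith
  · rw [div_le_iff₀ hε] at h2
    have h5 : 1 ≤ x ^ 2 := one_le_pow₀ h1
    have h6 := mul_le_mul_of_nonneg_right h2 (sq_nonneg x)
    rw [hnx]
    nlinarith
  · rw [htail]
    nlinarith
  · rw [htail]
    nlinarith

theorem mainTheorem5 :
    -- The first algorithm uses only the degree sequence.
    (∀ (n : ℕ) (G G' : SimpleGraph (Fin n)) [DecidableRel G.Adj] [DecidableRel G'.Adj]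
      (d : List ℕ), IsDegreeSequence G d → IsDegreeSequence G' d →
      ∀ P : Prior, P.Valid → alg1 G P = alg1 G' P) ∧
    -- The third algorithm can be run in polynomial time on the degree sequence alone.
    (∃ f : List ℕ → Prior → ℚ → ℚ → ℚ → Option Outcome, PolyTimeFromDegrees f ∧
      ∀ (n : ℕ) (G : SimpleGraph (Fin n)) [DecidableRel G.Adj] (d : List ℕ),
        IsDegreeSequence G d →
        ∀ (P : Prior) (μs ε δ : ℚ), P.Valid → 0 ≤ μs → μs ≤ 1 → 0 < ε → 0 < δ →
          alg3 G P μs ε δ = f d P μs ε δ) ∧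
    -- PROMISE REVOLT is solved, in polynomial time, from the degree sequence alone; the answer is
    -- correct for every graph with that degree sequence.
    (∃ f : List ℕ → Prior → ℚ → ℚ → ℚ → Option Outcome, PolyTimeFromDegrees f ∧
      ∀ (ε : ℚ) (P : Prior) (C : ℝ), 0 < ε → P.Valid →
        ∃ δ₀ : ℕ → ℝ, (∀ n, 0 < δ₀ n) ∧
          (∃ c : ℝ, 0 < c ∧ ∀ᶠ n : ℕ in atTop, δ₀ n ≤ Real.exp (-(c * (n : ℝ) ^ (1 / 3 : ℝ)))) ∧
          ∀ (μs : ℚ), 0 ≤ μs → μs ≤ 1 → ∀ (n : ℕ) (d : List ℕ) (δ : ℚ), δ₀ n ≤ (δ : ℝ) →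
            ∀ (G : SimpleGraph (Fin n)) [DecidableRel G.Adj], IsDegreeSequence G d →
              (∀ v, (G.degree v : ℝ) ≤ C * (n : ℝ) ^ (1 / 3 : ℝ)) →
              CorrectlyLabeled G P ε δ →
              SolvesInstance G P μs ε δ (f d P μs ε δ)) := by
  refine ⟨fun n G G' _ _ d hd hd' P hP => ?_, ⟨RAM.listAlg3, RAM.polyTimeFromDegrees_listAlg3, ?_⟩,
    ⟨RAM.answer, RAM.polyTimeFromDegrees_answer, fun ε P C hε hP => ?_⟩⟩
  · exact (alg1_eq_listAlg1 G hd hP P.p P.μ).trans (alg1_eq_listAlg1 G' hd' hP P.p P.μ).symm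
  · intro n G _ d hd P μs ε δ hP _ _ _ _
    rw [alg3, alg1_eq_listAlg1 G hd hP, alg1_eq_listAlg1 G hd hP]
    rfl
  · have hp : (0 : ℝ) < P.p := by exact_mod_cast hP.p_pos
    have hp' : (P.p : ℝ) < 1 := by exact_mod_cast hP.p_lt_one
    have hε' : (0 : ℝ) < ((ε / 3 : ℚ) : ℝ) := by exact_mod_cast div_pos hε three_pos
    obtain ⟨c, hc, hev⟩ := eventually_concentrated (C := C) hε'
      (q := min (P.p / 2) ((1 - P.p) / 2)) (lt_min (by linarith) (by linarith))
    obtain ⟨n₀, hn₀⟩ := eventually_atTop.1 hev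
    -- for the finitely many small `n`, `δ ≥ 1` makes the problem trivial
    refine ⟨fun n => if n < n₀ then 1 else Real.exp (-(c * (n : ℝ) ^ (1 / 3 : ℝ))), fun n => ?_,
      ⟨c, hc, ?_⟩, fun μs _ _ n d δ hδ G _ hd hdeg hl => ?_⟩
    · dsimp only; split_ifs; exacts [one_pos, Real.exp_pos _]
    · filter_upwards [eventually_ge_atTop n₀] with n hn
      rw [if_neg hn.not_gt]
    · dsimp only at hδ
      by_cases hn : n < n₀
      · rw [if_pos hn] at hδ
        exact solvesInstance_of_one_le G hP μs ε (by exact_mod_cast hδ) _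
      · rw [if_neg hn] at hδ
        obtain ⟨hn', D, hCD, hD, hq, h3⟩ := hn₀ n (not_lt.1 hn)
        have hδ0 : 0 < δ := by exact_mod_cast (Real.exp_pos _).trans_le hδ
        have hη := le_min (show _ ≤ ((δ : ℝ) / 3) by linarith) hq
        have hcon : Concentrated G P (ε / 3) (min (δ / 3) (min (P.p / 2) ((1 - P.p) / 2))) :=
          concentrated_of_degree_le G hP hn' (div_pos hε three_pos)
            (fun v => (add_le_add_left (hdeg v) 1).trans hCD) hD (by push_cast at hη ⊢; exact hη)
        have h1 := hP.p_pos
        have h2 := hP.p_lt_one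
        refine solvesInstance_answer G hP hd hδ0 hε hcon ?_ (min_le_left _ _) ?_ ?_ hl
        · exact le_min (by linarith) (le_min (by linarith) (by linarith))
        · exact ((min_le_right _ _).trans (min_le_left _ _)).trans_lt (by linarith)
        · exact ((min_le_right _ _).trans (min_le_right _ _)).trans (by linarith)
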